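/- Let $r\ge 1$ be an integer. Let $\mathcal C$ be the Hankel contour of radius $\epsilon>0$: it runs along the positive real axis from $+\infty$ to $\epsilon$ (top side), counterclockwise around the circle $|x|=\epsilon$, and back along the positive real axis to $+\infty$ (bottom side); $x^{s-1}$ is taken with $\arg x$ running from $0$ to $2\pi$. Put $C(s_1,\dots,s_r)=\prod_{k=1}^r\frac{1}{(e^{2\pi i s_k}-1)\Gamma(s_k)}$ and, for $x\in\mathcal C^r$, $y_j=x_j+\cdots+x_r$. For $t\in(0,1)$ and $s_1,\dots,s_r\in\mathbb C\setminus\mathbb Z$ put $$\hat\zeta^{\rm des}_r(s_1,\dots,s_r)(t)=C(s)\int_{\mathcal C^r}\prod_{j=1}^r\left(\frac{1}{\frac1t e^{y_j}-1}+\frac{(\log t-y_j)\frac1t e^{y_j}}{(\frac1t e^{y_j}-1)^2}\right)\prod_{k=1}^r x_k^{s_k-1}dx_k ,$$ $$\zeta^{\rm des}_r(s_1,\dots,s_r)(t)=\lim_{c\to1,\ c\ne1}\frac{C(s)}{(1-c)^r}\int_{\mathcal C^r}\prod_{j=1}^r\left(\frac{1}{\frac1t e^{y_j}-1}-\frac{c}{\frac1t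 e^{c y_j}-1}\right)\prod_{k=1}^r x_k^{s_k-1}dx_k \qquad(c\in\mathbb R),$$ where $\epsilon$ is any radius with $r\epsilon<2\pi$ in the first formula and with $r\epsilon<|\log t|$ in the second. These integrals converge absolutely (in the second formula, for $c\neq1$ close to $1$), the results do not depend on $\epsilon$, and for each $t\in(0,1)$ both functions extend uniquely to entire functions of $(s_1,\dots,s_r)\in\mathbb C^r$, denoted by the same symbols. For $\mathbf k=(k_1,\dots,k_r)\in\mathbb Z^r$ put $\mathbf k^{(j)}=(k_1,\dots,k_{r-1},k_r-j)$, $D=t\frac{d}{dt}$, $Z_0(\mathbf k;t)=\zeta^{\rm des}_r(\mathbf k)(t)$, which is a smooth function of $t\in(0,1)$, and $$Z_q(\mathbf k;t)=\sum_{i+j=q}(-1)^j\binom qi D^i\left[Z_0(\mathbf k^{(j)};t)\right]\quad(q\ge0),\qquad Z(\mathbf k;t)=\sum_{q\ge0}\frac{(-\log t)^q}{q!}Z_q(\mathbf k;t),$$ where the last sum is finite: $Z_q(\mathbf k;t)=0$ for $q>r$. Let $\mathrm{Li}_{\mathbf k}(t)=\sum_{0<n_1<\cdots<n_r}\frac{t^{n_r}}{n_1^{k_1}\cdots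 n_r^{k_r}}$ (an absolutely convergent series for $t\in(0,1)$), let $(k)_0=1$, $(k)_l=k(k+1)\cdots(k+l-1)$, and, for $0\le q\le r$, define integers $a^r_{\mathbf l,\mathbf m}(q)$ by $$\left(v_r^{-1}\frac{\partial}{\partial u_r}\right)^q\prod_{j=1}^r\left\{1-(u_jv_j+\cdots+u_rv_r)(v_j^{-1}-v_{j-1}^{-1})\right\}=\sum_{\substack{\mathbf l\in\mathbb N_0^r,\ \mathbf m\in\mathbb Z^r\\ m_1+\cdots+m_r=-q}}a^r_{\mathbf l,\mathbf m}(q)\prod_{j=1}^r u_j^{l_j}v_j^{m_j},\qquad v_0^{-1}:=0 .$$ **Theorem.** For all $r\ge1$, $\mathbf k\in\mathbb Z^r$ and $t\in(0,1)$, $$\hat\zeta^{\rm des}_r(\mathbf k)(t)=Z(\mathbf k;t)=\sum_{q=0}^{r}\frac{(-\log t)^q}{q!}\sum_{\substack{\mathbf l\in\mathbb N_0^r,\ \mathbf m\in\mathbb Z^r\\ m_1+\cdots+m_r=-q}}a^r_{\mathbf l,\mathbf m}(q)\left(\prod_{j=1}^r(k_j)_{l_j}\right)\mathrm{Li}_{\mathbf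 k+\mathbf m}(t).$$ -/

import Mathlib

open Filter Topology MeasureTheory
open scoped ContDiff

noncomputable section

namespace DesZeta

/-! ### The Hankel contour -/

/-- A logarithm along the Hankel contour of radius `ε`, parametrised by the real line: the positive
real axis from `+∞` to `ε` on its top side (`a < 0`, argument `0`), the circle of radius `ε` around
the origin, counterclockwise (`0 ≤ a ≤ 2π`, argument `a`), and the positive real axis from `ε`
to `+∞` on its bottom side (`a > 2π`, argument `2π`). -/
def hankelLog (ε a : ℝ) : ℂ :=
  if a < 0 then (Real.log (ε - a) : ℂ)
  else if a ≤ 2 * Real.pi then (Real.log ε : ℂ) + a * Complex.I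
  else (Real.log (ε + (a - 2 * Real.pi)) : ℂ) + 2 * Real.pi * Complex.I

/-- The point of the Hankel contour with parameter `a`. -/
def hankelPoint (ε a : ℝ) : ℂ := Complex.exp (hankelLog ε a)

/-- The velocity of the parametrisation `hankelPoint ε` (away from its two corners). -/
def hankelVelocity (ε a : ℝ) : ℂ :=
  if a < 0 then -1
  else if a ≤ 2 * Real.pi then Complex.I * ε * Complex.exp (a * Complex.I)
  else 1

/-- The integrand, in the parameters `a₁, …, a_r`, of
`∫_{𝒞^r} Φ(x₁, …, x_r) ∏ x_k ^ (s_k - 1) dx_k`, where `x ^ (s - 1)` is taken with the argument of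
`x` running from `0` to `2π` along the contour. -/
def hankelIntegrand {r : ℕ} (ε : ℝ) (Φ : (Fin r → ℂ) → ℂ) (s : Fin r → ℂ) (a : Fin r → ℝ) : ℂ :=
  Φ (fun k => hankelPoint ε (a k)) *
    ∏ k, (Complex.exp ((s k - 1) * hankelLog ε (a k)) * hankelVelocity ε (a k))

/-- `∫_{𝒞^r} Φ(x₁, …, x_r) ∏ x_k ^ (s_k - 1) dx_k`. -/
def hankelIntegral {r : ℕ} (ε : ℝ) (Φ : (Fin r → ℂ) → ℂ) (s : Fin r → ℂ) : ℂ :=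
  ∫ a : Fin r → ℝ, hankelIntegrand ε Φ s a

/-- `C(s) = ∏ 1 / ((e^{2πi s_k} - 1) Γ(s_k))`. -/
def gammaFactor {r : ℕ} (s : Fin r → ℂ) : ℂ :=
  ∏ k, 1 / ((Complex.exp (2 * Real.pi * Complex.I * s k) - 1) * Complex.Gamma (s k))

/-- No coordinate of `s` is an integer. -/
def NonInteger {r : ℕ} (s : Fin r → ℂ) : Prop := ∀ j, ∀ n : ℤ, s j ≠ n

/-- `x_j + ⋯ + x_r`. -/
def tailSum {r : ℕ} (x : Fin r → ℂ) (j : Fin r) : ℂ := ∑ k ∈ Finset.Ici j, x k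

/-! ### The two families of zeta functions -/

/-- The kernel of the one-parameter desingularized zeta function `\hat ζ^des_r(s)(t)`. -/
def hatKernel (r : ℕ) (t : ℝ) (x : Fin r → ℂ) : ℂ :=
  ∏ j, (1 / ((1 / (t : ℂ)) * Complex.exp (tailSum x j) - 1) +
    (((Real.log t : ℝ) : ℂ) - tailSum x j) * ((1 / (t : ℂ)) * Complex.exp (tailSum x j)) /
      ((1 / (t : ℂ)) * Complex.exp (tailSum x j) - 1) ^ 2)

/-- `f` is the entire function of `s ∈ ℂ^r` which for non-integral `s` is given by the (absolutely
convergent) Hankel contour integral that defines `\hat ζ^des_r(s)(t)`. The contour is any one with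
`r * ε < 2π`: then all the sums `x_j + ⋯ + x_r` lie in the strip `|Im y| < 2π`, where the only
zero `y = log t` of the denominators is a removable singularity of the factors. -/
def IsHatDesZeta (r : ℕ) (t : ℝ) (f : (Fin r → ℂ) → ℂ) : Prop :=
  Differentiable ℂ f ∧
    ∀ ε : ℝ, 0 < ε → r * ε < 2 * Real.pi → ∀ s : Fin r → ℂ, NonInteger s →
      Integrable (hankelIntegrand ε (hatKernel r t) s) ∧
        f s = gammaFactor s * hankelIntegral ε (hatKernel r t) s

/-- `\hat ζ^des_r(s)(t)` on all of `ℂ^r`, by analytic continuation. -/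
def hatDesZeta (r : ℕ) (t : ℝ) : (Fin r → ℂ) → ℂ := Classical.epsilon (IsHatDesZeta r t)

/-- The generating function `\tilde H_r(x₁, …, x_r; c; t)`. -/
def desKernel (r : ℕ) (t c : ℝ) (x : Fin r → ℂ) : ℂ :=
  ∏ j, (1 / ((1 / (t : ℂ)) * Complex.exp (tailSum x j) - 1) -
    c / ((1 / (t : ℂ)) * Complex.exp (c * tailSum x j) - 1))

/-- `g` is the entire function of `s ∈ ℂ^r` which for non-integral `s` is given by the limit
`c → 1` of Hankel contour integrals that defines `ζ^des_r(s)(t)`. The contour is any one with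
`r * ε < |log t|`: then all the sums `x_j + ⋯ + x_r` have real part greater than `log t`, and no
pole of the kernel is met. -/
def IsDesZeta (r : ℕ) (t : ℝ) (g : (Fin r → ℂ) → ℂ) : Prop :=
  Differentiable ℂ g ∧
    ∀ ε : ℝ, 0 < ε → r * ε < |Real.log t| → ∀ s : Fin r → ℂ, NonInteger s →
      (∀ᶠ c in 𝓝[≠] (1 : ℝ), Integrable (hankelIntegrand ε (desKernel r t c) s)) ∧
        Tendsto (fun c : ℝ => 1 / (1 - (c : ℂ)) ^ r *
          (gammaFactor s * hankelIntegral ε (desKernel r t c) s)) (𝓝[≠] 1) (𝓝 (g s))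

/-- `ζ^des_r(s)(t)` on all of `ℂ^r`, by analytic continuation. -/
def desZeta (r : ℕ) (t : ℝ) : (Fin r → ℂ) → ℂ := Classical.epsilon (IsDesZeta r t)

/-! ### The functions `Z_q(k; t)` and `Z(k; t)` -/

/-- The last index. -/
def lastIdx (r : ℕ) [NeZero r] : Fin r := ⟨r - 1, Nat.sub_one_lt (NeZero.ne r)⟩

/-- `k^{(j)} = (k₁, …, k_{r-1}, k_r - j)`. -/
def lowerLast {r : ℕ} [NeZero r] (k : Fin r → ℤ) (j : ℕ) : Fin r → ℤ :=
  Function.update k (lastIdx r) (k (lastIdx r) - j)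

/-- The operator `D = t d/dt`. -/
def eulerD (h : ℝ → ℂ) (t : ℝ) : ℂ := t * deriv h t

/-- `Z_0(k; t) = ζ^des_r(k)(t)`. -/
def Z0 {r : ℕ} (k : Fin r → ℤ) (t : ℝ) : ℂ := desZeta r t (fun j => (k j : ℂ))

/-- `Z_q(k; t) = ∑_{i+j=q} (-1)^j binom(q,i) D^i[Z_0(k^{(j)})]`. -/
def Zq {r : ℕ} [NeZero r] (q : ℕ) (k : Fin r → ℤ) (t : ℝ) : ℂ :=
  ∑ p ∈ Finset.HasAntidiagonal.antidiagonal q,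
    (-1) ^ p.2 * (q.choose p.1 : ℂ) * (eulerD^[p.1] (Z0 (lowerLast k p.2))) t

/-- `Z(k; t) = ∑_{q ≥ 0} (-log t)^q / q! * Z_q(k; t)`. -/
def Z {r : ℕ} [NeZero r] (k : Fin r → ℤ) (t : ℝ) : ℂ :=
  ∑' q : ℕ, (((-Real.log t) ^ q / (q.factorial : ℝ) : ℝ) : ℂ) * Zq q k t

/-! ### Multiple polylogarithms -/

/-- The index set `0 < n₁ < ⋯ < n_r`. -/
abbrev LiIndex (r : ℕ) : Type := {n : Fin r → ℕ // StrictMono n ∧ ∀ j, 0 < n j}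

/-- `z^{n_r} / (n₁^{k₁} ⋯ n_r^{k_r})`. -/
def liTerm {r : ℕ} [NeZero r] (k : Fin r → ℤ) (z : ℂ) (n : LiIndex r) : ℂ :=
  z ^ (n.1 (lastIdx r)) / ∏ j, (n.1 j : ℂ) ^ (k j)

/-- The multiple polylogarithm `Li_{k₁,…,k_r}(z)`, for `|z| < 1`. -/
def Li {r : ℕ} [NeZero r] (k : Fin r → ℤ) (z : ℂ) : ℂ := ∑' n : LiIndex r, liTerm k z n

/-! ### The coefficients `a^r_{l,m}(q)` -/

/-- `ℤ[v₁^{±1}, …, v_r^{±1}]`. -/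
abbrev LaurentV (r : ℕ) : Type := AddMonoidAlgebra ℤ (Fin r → ℤ)

/-- `v_j`. -/
def vVar {r : ℕ} (j : Fin r) : LaurentV r := AddMonoidAlgebra.single (Pi.single j 1) 1

/-- `v_j^{-1}`. -/
def vInv {r : ℕ} (j : Fin r) : LaurentV r := AddMonoidAlgebra.single (Pi.single j (-1)) 1

/-- `v_{j-1}^{-1}`, with the convention `v_0^{-1} = 0`. -/
def vInvPrev {r : ℕ} (j : Fin r) : LaurentV r :=
  if 0 < (j : ℕ) then vInv ⟨(j : ℕ) - 1, lt_of_le_of_lt (Nat.sub_le _ _) j.2⟩ else 0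

/-- `G_r = ∏_j (1 - (u_j v_j + ⋯ + u_r v_r) (v_j^{-1} - v_{j-1}^{-1}))`, a polynomial in the `u_j`
over the Laurent polynomials in the `v_j`. -/
def genPoly (r : ℕ) : MvPolynomial (Fin r) (LaurentV r) :=
  ∏ j, (1 - (∑ k ∈ Finset.Ici j, MvPolynomial.X k * MvPolynomial.C (vVar k)) *
    MvPolynomial.C (vInv j - vInvPrev j))

/-- The operator `v_r^{-1} ∂/∂u_r`. -/
def lastDeriv {r : ℕ} [NeZero r] (P : MvPolynomial (Fin r) (LaurentV r)) :
    MvPolynomial (Fin r) (LaurentV r) :=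
  MvPolynomial.C (vInv (lastIdx r)) * MvPolynomial.pderiv (lastIdx r) P

/-- `(v_r^{-1} ∂/∂u_r)^q [G_r]`. -/
def genPolyDeriv (r : ℕ) [NeZero r] (q : ℕ) : MvPolynomial (Fin r) (LaurentV r) :=
  lastDeriv^[q] (genPoly r)

/-- `a^r_{l,m}(q)`, the coefficient of `∏ u_j^{l_j} v_j^{m_j}` in `(v_r^{-1} ∂/∂u_r)^q [G_r]`. -/
def aCoeff (r : ℕ) [NeZero r] (q : ℕ) (l : Fin r →₀ ℕ) (m : Fin r → ℤ) : ℤ :=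
  ((genPolyDeriv r q).coeff l).coeff m

/-- `∑_{l, m, |m| = -q} a^r_{l,m}(q) (∏ (k_j)_{l_j}) Li_{k+m}(t)`; the sum runs over the finitely
many `(l, m)` with non-zero coefficient. -/
def liCombination {r : ℕ} [NeZero r] (q : ℕ) (k : Fin r → ℤ) (t : ℝ) : ℂ :=
  ∑ l ∈ (genPolyDeriv r q).support,
    ∑ m ∈ ((genPolyDeriv r q).coeff l).coeff.support with ∑ j, m j = -(q : ℤ),
      ((aCoeff r q l m * ∏ j, (ascPochhammer ℤ (l j)).eval (k j) : ℤ) : ℂ) * Li (k + m) (t : ℂ)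

end DesZeta

end

noncomputable section

namespace DesZeta

/-! Both zeta functions come from the single kernel `kernelFactor lam L y` with L = log t. The
choice lam = log t gives the first integrand; lam = 0 gives the limit, as c tends to 1, of each
factor of the second one divided by 1 - c. For Re y > Re L the kernel expands as the sum over n ≥ 1
of (1 + n (lam - y)) e^{n (L - y)}. In the product over j put N_k = n_1 + ⋯ + n_k. Since Σ n_j y_j =
Σ N_k x_k, the exponentials separate, and what remains is the polynomial `gapPoly N lam` in u_k =
N_k x_k (`prod_kernelTerm`). Hankel's formula sends (N x)^l e^{-N x} to (e^{2πis} - 1) Γ(s) (s)_l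
N^{-s}. So, after normalisation, monomials in u become products of rising factorials (`riseFun`),
and the integral becomes the sum over N of t^{N_r} ∏ N_k^{-s_k} `riseFun s (gapPoly N lam)`
(`hankelIntegral_kernelFactor`).

The parameter lam only translates u_r by -lam N_r (`shiftVar_gapPoly`). Taylor's formula in u_r
therefore produces the factors (-lam)^q / q! and the polynomials (v_r^{-1} ∂/∂u_r)^q G_r evaluated
at v_k = 1/N_k (`gapPoly_eq_sum`). Monomials in v shift the exponents of the polylogarithms, which
gives the explicit formula `zetaSum`, entire in s.

To identify Z_q, note that D multiplies a term by N_r, so every summand of Z_q carries the same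
factor N_r^q and the summands differ only in their rising factorials. Since (s)_l - (s-1)_l = l
(s)_{l-1}, their alternating binomial sum is the q-th derivative in u_r (`riseFun_pderiv_iterate`,
`Zq_eq`).

Two analytic points remain. The series needs r ε < |log t|, whereas the first integral allows r ε <
2π: there the removable singularity is filled in by `bernoulliDeriv`, the integral is holomorphic in
L, and the identity theorem moves L to log t (`hankelIntegral_bernoulliDeriv`). The limit c → 1 is
taken by dominated convergence, with a majorant from the mean value inequality in c
(`exists_kernelQuotient_bound`). -/

/-! ### Rising factorials and Taylor's formula in the u-variables -/

/-- The linear functional sending `∏ u_k ^ l_k` to the product of rising factorials `∏ (s_k)_{l_k}`. -/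
def riseFun {r : ℕ} (s : Fin r → ℂ) : MvPolynomial (Fin r) ℂ →ₗ[ℂ] ℂ :=
  (MvPolynomial.basisMonomials (Fin r) ℂ).constr ℂ
    fun l => ∏ k, (ascPochhammer ℂ (l k)).eval (s k)

theorem riseFun_monomial {r : ℕ} (s : Fin r → ℂ) (l : Fin r →₀ ℕ) (a : ℂ) :
    riseFun s (MvPolynomial.monomial l a) = a * ∏ k, (ascPochhammer ℂ (l k)).eval (s k) := by
  have h : MvPolynomial.monomial l a = a • MvPolynomial.basisMonomials (Fin r) ℂ l := by
    simp [MvPolynomial.smul_monomial]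
  rw [h, map_smul, riseFun, Module.Basis.constr_basis, smul_eq_mul]

/-- The discrete analogue of differentiating u^n. Truncation in `n - 1` is harmless because the
factor n vanishes at n = 0. -/
theorem ascPochhammer_eval_sub {n : ℕ} (s : ℂ) :
    (ascPochhammer ℂ n).eval s - (ascPochhammer ℂ n).eval (s - 1) =
      n * (ascPochhammer ℂ (n - 1)).eval s := by
  cases n with
  | zero => simp
  | succ n =>
    have h1 : (ascPochhammer ℂ (n + 1)).eval (s - 1) = (s - 1) * (ascPochhammer ℂ n).eval s := by
      rw [ascPochhammer_succ_left]; simp [Polynomial.eval_comp]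
    rw [h1, ascPochhammer_succ_eval]
    simp
    ring

/-- Lowering the exponent `s_i` by one corresponds to the derivative with respect to `u_i`. -/
theorem riseFun_sub_update {r : ℕ} (s : Fin r → ℂ) (i : Fin r) (P : MvPolynomial (Fin r) ℂ) :
    riseFun s P - riseFun (Function.update s i (s i - 1)) P =
      riseFun s (MvPolynomial.pderiv i P) := by
  induction P using MvPolynomial.induction_on' with
  | add p q hp hq => simp only [map_add, ← hp, ← hq]; ring
  | monomial l a =>
    rw [MvPolynomial.pderiv_monomial, riseFun_monomial, riseFun_monomial, riseFun_monomial,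
      ← Finset.mul_prod_erase _ _ (Finset.mem_univ i), ← Finset.mul_prod_erase _ _ (Finset.mem_univ i),
      ← Finset.mul_prod_erase _ _ (Finset.mem_univ i)]
    have h1 : ∏ x ∈ Finset.univ.erase i, (ascPochhammer ℂ (l x)).eval (Function.update s i (s i - 1) x)
        = ∏ x ∈ Finset.univ.erase i, (ascPochhammer ℂ (l x)).eval (s x) :=
      Finset.prod_congr rfl fun x hx => by
        rw [Function.update_of_ne (Finset.ne_of_mem_erase hx)]
    have h2 : ∏ x ∈ Finset.univ.erase i,
          (ascPochhammer ℂ ((l - Finsupp.single i 1 : Fin r →₀ ℕ) x)).eval (s x)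
        = ∏ x ∈ Finset.univ.erase i, (ascPochhammer ℂ (l x)).eval (s x) :=
      Finset.prod_congr rfl fun x hx => by
        simp [(Finset.ne_of_mem_erase hx).symm]
    rw [h1, h2]
    have := @ascPochhammer_eval_sub (l i) (s i)
    simp only [Function.update_self, Finsupp.coe_tsub, Pi.sub_apply, Finsupp.single_eq_same]
    linear_combination a * (∏ x ∈ Finset.univ.erase i, (ascPochhammer ℂ (l x)).eval (s x)) * this

/-- Binomial expansion of the q-fold difference in s_i; the right side has the signs and
coefficients of the definition of Z_q. -/
theorem riseFun_pderiv_iterate {r : ℕ} (s : Fin r → ℂ) (i : Fin r) (P : MvPolynomial (Fin r) ℂ)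
    (q : ℕ) :
    riseFun s ((MvPolynomial.pderiv i)^[q] P) =
      ∑ p ∈ Finset.HasAntidiagonal.antidiagonal q, (-1) ^ p.2 * (q.choose p.1 : ℂ) *
        riseFun (Function.update s i (s i - p.2)) P := by
  -- Raising j lowers the exponent, so each forward difference in j acts as minus the derivative,
  -- whence the sign (-1)^n.
  have key : ∀ (n : ℕ) (j : ℕ) (P : MvPolynomial (Fin r) ℂ),
      ((fwdDiff 1)^[n] fun j : ℕ => riseFun (Function.update s i (s i - j)) P) j =
        (-1) ^ n * riseFun (Function.update s i (s i - j)) ((MvPolynomial.pderiv i)^[n] P) := by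
    intro n
    induction n with
    | zero => intro j P; simp
    | succ n ih =>
      intro j P
      rw [Function.iterate_succ_apply', fwdDiff, ih, ih, Function.iterate_succ_apply']
      have := riseFun_sub_update (Function.update s i (s i - j)) i ((MvPolynomial.pderiv i)^[n] P)
      simp only [Function.update_self, Function.update_idem] at this
      rw [← this]
      push_cast
      rw [← sub_sub]
      ring
  have h := key q 0 P
  rw [fwdDiff_iter_eq_sum_shift] at h
  simp only [Nat.cast_zero, sub_zero, Function.update_eq_self, smul_eq_mul, mul_one, zero_add] at h
  have h2 : riseFun s ((MvPolynomial.pderiv i)^[q] P) = (-1) ^ q * ((-1) ^ q *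
      riseFun s ((MvPolynomial.pderiv i)^[q] P)) := by
    rw [← mul_assoc, ← mul_pow]; simp
  rw [h2, ← h, Finset.mul_sum, ← Finset.Nat.sum_antidiagonal_swap,
    Finset.Nat.sum_antidiagonal_eq_sum_range_succ_mk]
  refine Finset.sum_congr rfl fun k hk => ?_
  have hk' : k ≤ q := Nat.lt_succ_iff.mp (Finset.mem_range.mp hk)
  have e : (-1 : ℂ) ^ q = (-1) ^ (q - k) * (-1) ^ k := by rw [← pow_add, Nat.sub_add_cancel hk']
  have e2 : (-1 : ℂ) ^ (q - k) * (-1) ^ (q - k) = 1 := by rw [← mul_pow]; simp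
  simp only [zsmul_eq_mul, Prod.swap]
  push_cast
  rw [Nat.choose_symm hk', e]
  linear_combination ((-1) ^ k * (q.choose k : ℂ) * riseFun (Function.update s i (s i - k)) P) * e2

theorem pderiv_iterate_mul_X_pow {σ R : Type*} [CommSemiring R] (i : σ)
    (A : MvPolynomial σ R) (hA : MvPolynomial.pderiv i A = 0) (n q : ℕ) :
    (MvPolynomial.pderiv i)^[q] (A * MvPolynomial.X i ^ n) =
      (n.descFactorial q) • (A * MvPolynomial.X i ^ (n - q)) := by
  induction q with
  | zero => simp
  | succ q ih =>
    rw [Function.iterate_succ_apply', ih, map_nsmul, Derivation.leibniz, hA,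
      Derivation.leibniz_pow, MvPolynomial.pderiv_X_self, Nat.descFactorial_succ]
    simp only [smul_eq_mul, mul_one, Nat.sub_sub, nsmul_eq_mul]
    push_cast
    ring

theorem monomial_eq_erase_mul {σ R : Type*} [CommSemiring R] (i : σ) (l : σ →₀ ℕ) (a : R) :
    MvPolynomial.monomial l a = MvPolynomial.monomial (l.erase i) a * MvPolynomial.X i ^ (l i) := by
  classical
  rw [MvPolynomial.X_pow_eq_monomial, MvPolynomial.monomial_mul, mul_one,
    Finsupp.erase_add_single]

theorem pderiv_monomial_erase {σ R : Type*} [CommSemiring R] (i : σ) (l : σ →₀ ℕ) (a : R) :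
    MvPolynomial.pderiv i (MvPolynomial.monomial (l.erase i) a) = 0 := by
  rw [MvPolynomial.pderiv_monomial]; simp

theorem pderiv_iterate_eq_zero {σ R : Type*} [CommSemiring R] (i : σ)
    (P : MvPolynomial σ R) (q : ℕ) (h : P.degreeOf i < q) : (MvPolynomial.pderiv i)^[q] P = 0 := by
  -- Writing the iterate as a power of a linear map lets it pass through the sum over monomials.
  have hlin : ∀ Q : MvPolynomial σ R,
      (MvPolynomial.pderiv i)^[q] Q = ((MvPolynomial.pderiv (R := R) i).toLinearMap ^ q) Q := by
    intro Q; rw [Module.End.pow_apply]; rfl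
  rw [hlin, P.as_sum, map_sum]
  refine Finset.sum_eq_zero fun l hl => ?_
  rw [← hlin, monomial_eq_erase_mul i, pderiv_iterate_mul_X_pow i _ (pderiv_monomial_erase i l _),
    Nat.descFactorial_of_lt, zero_smul]
  exact lt_of_le_of_lt (MvPolynomial.monomial_le_degreeOf i hl) h

/-- The substitution `u_i ↦ u_i + c`. -/
def shiftVar {r : ℕ} (i : Fin r) (c : ℂ) : MvPolynomial (Fin r) ℂ →ₐ[ℂ] MvPolynomial (Fin r) ℂ :=
  MvPolynomial.aeval fun k => MvPolynomial.X k + if k = i then MvPolynomial.C c else 0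

/-- Taylor's formula in one of the variables. -/
theorem shiftVar_eq_sum {r : ℕ} (i : Fin r) (c : ℂ) (M : ℕ) (P : MvPolynomial (Fin r) ℂ)
    (hP : P.degreeOf i ≤ M) :
    shiftVar i c P = ∑ q ∈ Finset.range (M + 1),
      (c ^ q / (q.factorial : ℂ)) • (MvPolynomial.pderiv i)^[q] P := by
  have hlin : ∀ (q : ℕ) (Q : MvPolynomial (Fin r) ℂ), (MvPolynomial.pderiv i)^[q] Q =
      ((MvPolynomial.pderiv (R := ℂ) i).toLinearMap ^ q) Q := by
    intro q Q; rw [Module.End.pow_apply]; rfl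
  simp only [hlin]
  rw [P.as_sum]
  simp only [map_sum, Finset.smul_sum]
  rw [Finset.sum_comm]
  refine Finset.sum_congr rfl fun l hl => ?_
  have hl' : l i ≤ M := (MvPolynomial.monomial_le_degreeOf i hl).trans hP
  simp only [← hlin]
  generalize P.coeff l = a
  rw [monomial_eq_erase_mul i]
  simp only [pderiv_iterate_mul_X_pow i _ (pderiv_monomial_erase i l _)]
  have hA : shiftVar i c (MvPolynomial.monomial (l.erase i) a) =
      MvPolynomial.monomial (l.erase i) a := by
    rw [shiftVar, MvPolynomial.aeval_monomial, MvPolynomial.monomial_eq]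
    refine congrArg₂ _ rfl (Finset.prod_congr rfl fun k hk => ?_)
    have : k ≠ i := by rintro rfl; simp at hk
    simp [this]
  have hX : shiftVar i c (MvPolynomial.X i) = MvPolynomial.X i + MvPolynomial.C c := by
    simp [shiftVar]
  rw [map_mul, map_pow, hA, hX, add_comm, add_pow, Finset.mul_sum]
  -- The binomial sum stops at l_i and the Taylor sum at M; the extra terms vanish with the falling
  -- factorial.
  have hsub : Finset.range (l i + 1) ⊆ Finset.range (M + 1) := by
    intro x hx; simp at hx ⊢; omega
  refine (Finset.sum_congr rfl fun q hq => ?_).trans (Finset.sum_subset hsub fun q _ hq => ?_)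
  · have hf : (q.factorial : ℂ) ≠ 0 := by exact_mod_cast q.factorial_ne_zero
    have e : (c ^ q / (q.factorial : ℂ)) * ((l i).descFactorial q : ℂ) =
        c ^ q * ((l i).choose q : ℂ) := by
      rw [Nat.descFactorial_eq_factorial_mul_choose]; push_cast; field_simp
    rw [← Nat.cast_smul_eq_nsmul ℂ, smul_smul, e, MvPolynomial.smul_eq_C_mul]
    simp only [map_mul, map_pow, map_natCast]
    ring
  · rw [Nat.descFactorial_of_lt (by simp at hq; omega), zero_smul, smul_zero]

/-! ### Evaluation of the Laurent variables -/

/-- `∏ N_k ^ (-s_k)`. -/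
def negPow {r : ℕ} (N : Fin r → ℕ) (s : Fin r → ℂ) : ℂ :=
  Complex.exp (-∑ k, s k * (Real.log (N k) : ℂ))

theorem negPow_add {r : ℕ} (N : Fin r → ℕ) (s s' : Fin r → ℂ) :
    negPow N (s + s') = negPow N s * negPow N s' := by
  simp only [negPow, ← Complex.exp_add, Pi.add_apply, add_mul, Finset.sum_add_distrib, neg_add]

/-- The evaluation of Laurent polynomials at `v_k = 1 / N_k`. -/
def evalV {r : ℕ} (N : Fin r → ℕ) : LaurentV r →ₐ[ℤ] ℂ :=
  AddMonoidAlgebra.lift ℤ ℂ (Fin r → ℤ)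
    { toFun := fun m => negPow N fun k => (m.toAdd k : ℂ)
      map_one' := by simp [negPow]
      map_mul' := fun a b => by rw [← negPow_add]; congr 1; ext k; simp }

theorem evalV_single {r : ℕ} (N : Fin r → ℕ) (m : Fin r → ℤ) (a : ℤ) :
    evalV N (AddMonoidAlgebra.single m a) = a * negPow N fun k => (m k : ℂ) := by
  rw [evalV, AddMonoidAlgebra.lift_single]; simp

theorem evalV_eq_sum {r : ℕ} (N : Fin r → ℕ) (f : LaurentV r) :
    evalV N f = ∑ m ∈ f.coeff.support, (f.coeff m : ℂ) * negPow N fun k => (m k : ℂ) := by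
  rw [evalV, AddMonoidAlgebra.lift_apply, Finsupp.sum]; simp

theorem negPow_single {r : ℕ} (N : Fin r → ℕ) (j : Fin r) (hj : 0 < N j) (a : ℤ) :
    (negPow N fun k => ((Pi.single j a : Fin r → ℤ) k : ℂ)) = (N j : ℂ) ^ (-a) := by
  have h : (∑ k, ((Pi.single j a : Fin r → ℤ) k : ℂ) * (Real.log (N k) : ℂ)) =
      (a : ℂ) * (Real.log (N j) : ℂ) := by
    rw [Finset.sum_eq_single j] <;> simp +contextual
  have h0 : (N j : ℂ) ≠ 0 := by exact_mod_cast hj.ne'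
  rw [negPow, h, ← neg_mul, ← Int.cast_neg, Complex.exp_int_mul]
  congr 1
  rw [← Complex.ofReal_exp, Real.exp_log (by exact_mod_cast hj)]; simp

/-- `n_j = N_j - N_{j-1}`, with `N_0 = 0`. -/
def gap {r : ℕ} (N : Fin r → ℕ) (j : Fin r) : ℕ :=
  N j - if 0 < (j : ℕ) then N ⟨(j : ℕ) - 1, lt_of_le_of_lt (Nat.sub_le _ _) j.2⟩ else 0

/-- Under v_k = 1/N_k the convention v_0^{-1} = 0 matches N_0 = 0. Monotonicity of N makes the
truncated subtraction in `gap` a true one. -/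
theorem evalV_vInv_sub {r : ℕ} (N : LiIndex r) (j : Fin r) :
    evalV N.1 (vInv j - vInvPrev j) = gap N.1 j := by
  have h : ∀ j, evalV N.1 (vInv j) = N.1 j := fun j => by
    rw [vInv, evalV_single, negPow_single _ _ (N.2.2 j)]; simp
  rw [map_sub, h, vInvPrev, gap]
  split_ifs with hj
  · rw [h, Nat.cast_sub]
    exact N.2.1.monotone (by rw [Fin.le_def]; exact Nat.sub_le _ _)
  · simp

theorem evalV_vVar {r : ℕ} (N : LiIndex r) (j : Fin r) : evalV N.1 (vVar j) = 1 / (N.1 j : ℂ) := by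
  rw [vVar, evalV_single, negPow_single _ _ (N.2.2 j)]; simp

/-- The polynomial `∏_j (1 + n_j λ - n_j ∑_{k ≥ j} u_k / N_k)`. -/
def gapPoly {r : ℕ} (N : Fin r → ℕ) (lam : ℂ) : MvPolynomial (Fin r) ℂ :=
  ∏ j, (1 + MvPolynomial.C (gap N j * lam) -
    (∑ k ∈ Finset.Ici j, MvPolynomial.X k * MvPolynomial.C (1 / (N k : ℂ))) *
      MvPolynomial.C (gap N j : ℂ))

theorem map_genPoly {r : ℕ} (N : LiIndex r) :
    MvPolynomial.map (evalV N.1).toRingHom (genPoly r) = gapPoly N.1 0 := by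
  rw [genPoly, gapPoly, map_prod]
  refine Finset.prod_congr rfl fun j _ => ?_
  have h1 := evalV_vInv_sub N j
  have h2 := evalV_vVar N
  simp only [map_sub, map_one, map_mul, map_sum, MvPolynomial.map_X, MvPolynomial.map_C,
    AlgHom.toRingHom_eq_coe, RingHom.coe_coe] at *
  rw [← map_sub MvPolynomial.C, h1]
  simp [h2]

theorem lastIdx_max {r : ℕ} [NeZero r] (j : Fin r) : j ≤ lastIdx r := by
  rw [Fin.le_def, lastIdx]; have := j.2; simp; omega

/-- Since r ≥ j for every j, each factor contains -n_j u_r / N_r. One translation of u_r by -lam N_r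
thus adds n_j lam to all factors at once. -/
theorem shiftVar_gapPoly {r : ℕ} [NeZero r] (N : LiIndex r) (lam : ℂ) :
    shiftVar (lastIdx r) (-lam * N.1 (lastIdx r)) (gapPoly N.1 0) = gapPoly N.1 lam := by
  rw [gapPoly, gapPoly, map_prod]
  refine Finset.prod_congr rfl fun j _ => ?_
  have h0 : (N.1 (lastIdx r) : ℂ) ≠ 0 := by exact_mod_cast (N.2.2 _).ne'
  have hC : ∀ c : ℂ, shiftVar (lastIdx r) (-lam * N.1 (lastIdx r)) (MvPolynomial.C c) =
      MvPolynomial.C c := fun c => by simp [shiftVar]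
  have hX : ∀ k, shiftVar (lastIdx r) (-lam * N.1 (lastIdx r)) (MvPolynomial.X k) =
      MvPolynomial.X k + if k = lastIdx r then MvPolynomial.C (-lam * N.1 (lastIdx r)) else 0 :=
    fun k => by simp [shiftVar]
  simp only [map_sub, map_add, map_one, map_mul, map_sum, mul_zero, hC, hX, add_mul,
    Finset.sum_add_distrib, ite_mul, zero_mul, Finset.sum_ite_eq', Finset.mem_Ici, lastIdx_max,
    if_true, map_zero]
  have e : (MvPolynomial.C (-lam) * MvPolynomial.C (N.1 (lastIdx r) : ℂ)) *
      MvPolynomial.C (1 / (N.1 (lastIdx r) : ℂ)) = (MvPolynomial.C (-lam) : MvPolynomial (Fin r) ℂ) := by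
    rw [← map_mul, ← map_mul]; congr 1; field_simp
  rw [e, map_neg]
  ring

/-- Each of the r factors is affine in the u-variables. This bound ends the Taylor expansion at q =
r and makes Z_q vanish beyond it. -/
theorem degreeOf_genPoly_le {r : ℕ} (i : Fin r) : (genPoly r).degreeOf i ≤ r := by
  refine (MvPolynomial.degreeOf_prod_le i _ _).trans ?_
  refine (Finset.sum_le_card_nsmul _ _ 1 fun j _ => ?_).trans (by simp)
  refine (MvPolynomial.degreeOf_sub_le i _ _).trans (max_le (by simp) ?_)
  refine (MvPolynomial.degreeOf_mul_C_le _ i _).trans ?_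
  refine (MvPolynomial.degreeOf_sum_le i _ _).trans (Finset.sup_le fun k _ => ?_)
  refine (MvPolynomial.degreeOf_mul_C_le _ i _).trans ?_
  nontriviality LaurentV r
  classical
  rw [MvPolynomial.degreeOf_X]
  split_ifs <;> simp

/-- The factor v_r^{-1} is a constant for ∂/∂u_r, so its powers collect in front. -/
theorem genPolyDeriv_eq {r : ℕ} [NeZero r] (q : ℕ) :
    genPolyDeriv r q = MvPolynomial.C (vInv (lastIdx r) ^ q) *
      (MvPolynomial.pderiv (lastIdx r))^[q] (genPoly r) := by
  rw [genPolyDeriv]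
  induction q with
  | zero => simp
  | succ q ih =>
    rw [Function.iterate_succ_apply', ih, lastDeriv, Function.iterate_succ_apply',
      Derivation.leibniz, MvPolynomial.pderiv_C]
    simp only [smul_eq_mul, mul_zero, add_zero, map_pow]
    ring

theorem genPolyDeriv_eq_zero {r : ℕ} [NeZero r] {q : ℕ} (h : r < q) : genPolyDeriv r q = 0 := by
  rw [genPolyDeriv_eq, pderiv_iterate_eq_zero _ _ _ ((degreeOf_genPoly_le _).trans_lt h), mul_zero]

theorem map_pderiv_iterate {σ R S : Type*} [CommSemiring R] [CommSemiring S] (f : R →+* S) (i : σ)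
    (P : MvPolynomial σ R) (q : ℕ) :
    MvPolynomial.map f ((MvPolynomial.pderiv i)^[q] P) =
      (MvPolynomial.pderiv i)^[q] (MvPolynomial.map f P) := by
  induction q with
  | zero => simp
  | succ q ih =>
    rw [Function.iterate_succ_apply', Function.iterate_succ_apply', ← ih, MvPolynomial.pderiv_map]

theorem map_genPolyDeriv {r : ℕ} [NeZero r] (N : LiIndex r) (q : ℕ) :
    MvPolynomial.map (evalV N.1).toRingHom (genPolyDeriv r q) =
      MvPolynomial.C ((N.1 (lastIdx r) : ℂ) ^ q) *
        (MvPolynomial.pderiv (lastIdx r))^[q] (gapPoly N.1 0) := by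
  rw [genPolyDeriv_eq, map_mul, map_pderiv_iterate, map_genPoly, MvPolynomial.map_C, map_pow]
  congr 3
  have := negPow_single _ _ (N.2.2 (lastIdx r)) (-1)
  simp only [vInv, AlgHom.toRingHom_eq_coe, RingHom.coe_coe, evalV_single, this]
  simp

/-- Taylor's formula with increment -lam N_r; the power N_r^q is the value of v_r^{-q}, which the
operator v_r^{-1} ∂/∂u_r already carries. -/
theorem gapPoly_eq_sum {r : ℕ} [NeZero r] (N : LiIndex r) (lam : ℂ) :
    gapPoly N.1 lam = ∑ q ∈ Finset.range (r + 1), ((-lam) ^ q / (q.factorial : ℂ)) •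
      MvPolynomial.map (evalV N.1).toRingHom (genPolyDeriv r q) := by
  rw [← shiftVar_gapPoly, shiftVar_eq_sum _ _ r]
  · refine Finset.sum_congr rfl fun q _ => ?_
    rw [map_genPolyDeriv, MvPolynomial.smul_eq_C_mul, MvPolynomial.smul_eq_C_mul, ← mul_assoc,
      ← map_mul]
    congr 2
    rw [mul_pow]; ring
  · rw [← map_genPoly]
    exact MvPolynomial.degreeOf_le_iff.2 fun m hm => MvPolynomial.degreeOf_le_iff.1
      (degreeOf_genPoly_le (lastIdx r)) m (MvPolynomial.support_map_subset _ _ hm)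

/-! ### Homogeneity in the Laurent variables -/

/-- The sum of the exponents of the `v_j`. -/
def expSum (r : ℕ) : (Fin r → ℤ) →+ ℤ where
  toFun m := ∑ j, m j
  map_zero' := by simp
  map_add' a b := by simp [Finset.sum_add_distrib]

/-- All coefficients of `P` are homogeneous of degree `d` in the `v_j`. -/
def VHomogeneous {r : ℕ} (d : ℤ) (P : MvPolynomial (Fin r) (LaurentV r)) : Prop :=
  ∀ l, P.coeff l ∈ AddMonoidAlgebra.gradeBy ℤ (expSum r) d

theorem VHomogeneous.mul {r : ℕ} {d e : ℤ} {P Q : MvPolynomial (Fin r) (LaurentV r)}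
    (hP : VHomogeneous d P) (hQ : VHomogeneous e Q) : VHomogeneous (d + e) (P * Q) := by
  classical
  intro l
  rw [MvPolynomial.coeff_mul]
  exact Submodule.sum_mem _ fun x _ => SetLike.mul_mem_graded (hP _) (hQ _)

theorem VHomogeneous.sum {r : ℕ} {d : ℤ} {ι : Type*} {S : Finset ι}
    {P : ι → MvPolynomial (Fin r) (LaurentV r)} (hP : ∀ i ∈ S, VHomogeneous d (P i)) :
    VHomogeneous d (∑ i ∈ S, P i) := by
  intro l
  rw [MvPolynomial.coeff_sum]
  exact Submodule.sum_mem _ fun x hx => hP x hx l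

theorem VHomogeneous.sub {r : ℕ} {d : ℤ} {P Q : MvPolynomial (Fin r) (LaurentV r)}
    (hP : VHomogeneous d P) (hQ : VHomogeneous d Q) : VHomogeneous d (P - Q) := by
  intro l
  rw [MvPolynomial.coeff_sub]
  exact Submodule.sub_mem _ (hP l) (hQ l)

theorem VHomogeneous.C {r : ℕ} {d : ℤ} {a : LaurentV r}
    (h : a ∈ AddMonoidAlgebra.gradeBy ℤ (expSum r) d) : VHomogeneous d (MvPolynomial.C a) := by
  classical
  intro l
  rw [MvPolynomial.coeff_C]
  split_ifs
  exacts [h, Submodule.zero_mem _]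

theorem VHomogeneous.one {r : ℕ} : VHomogeneous 0 (1 : MvPolynomial (Fin r) (LaurentV r)) := by
  rw [← MvPolynomial.C_1]
  exact VHomogeneous.C (SetLike.one_mem_graded _)

theorem VHomogeneous.X {r : ℕ} (k : Fin r) :
    VHomogeneous 0 (MvPolynomial.X k : MvPolynomial (Fin r) (LaurentV r)) := by
  classical
  intro l
  rw [MvPolynomial.coeff_X]
  split_ifs
  exacts [SetLike.one_mem_graded _, Submodule.zero_mem _]

theorem VHomogeneous.prod {r : ℕ} {ι : Type*} {S : Finset ι}
    {P : ι → MvPolynomial (Fin r) (LaurentV r)} (hP : ∀ i ∈ S, VHomogeneous 0 (P i)) :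
    VHomogeneous 0 (∏ i ∈ S, P i) := by
  classical
  induction S using Finset.induction_on with
  | empty => simpa using VHomogeneous.one
  | insert a S ha ih =>
    rw [Finset.prod_insert ha]
    simpa using (hP a (Finset.mem_insert_self _ _)).mul
      (ih fun i hi => hP i (Finset.mem_insert_of_mem hi))

theorem VHomogeneous.pderiv {r : ℕ} {d : ℤ} (i : Fin r) {P : MvPolynomial (Fin r) (LaurentV r)}
    (hP : VHomogeneous d P) : VHomogeneous d (MvPolynomial.pderiv i P) := by
  rw [P.as_sum, map_sum]
  refine VHomogeneous.sum fun m _ => ?_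
  classical
  intro l
  rw [MvPolynomial.pderiv_monomial, MvPolynomial.coeff_monomial]
  split_ifs
  · rw [mul_comm, ← nsmul_eq_mul]
    exact Submodule.smul_of_tower_mem _ _ (hP m)
  · exact Submodule.zero_mem _

theorem vInv_mem {r : ℕ} (j : Fin r) : vInv j ∈ AddMonoidAlgebra.gradeBy ℤ (expSum r) (-1) := by
  have := AddMonoidAlgebra.single_mem_gradeBy (expSum r) (Pi.single j (-1) : Fin r → ℤ) (1 : ℤ)
  simpa [expSum, vInv] using this

theorem vVar_mem {r : ℕ} (j : Fin r) : vVar j ∈ AddMonoidAlgebra.gradeBy ℤ (expSum r) 1 := by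
  have := AddMonoidAlgebra.single_mem_gradeBy (expSum r) (Pi.single j 1 : Fin r → ℤ) (1 : ℤ)
  simpa [expSum, vVar] using this

/-- In G_r every v_k is paired with an inverse v, giving degree 0, and each application of the
operator adds one v_r^{-1}. Hence the condition m_1 + ⋯ + m_r = -q in the theorem discards no term.
-/
theorem vHomogeneous_genPolyDeriv {r : ℕ} [NeZero r] (q : ℕ) :
    VHomogeneous (-(q : ℤ)) (genPolyDeriv r q) := by
  rw [genPolyDeriv]
  induction q with
  | zero =>
    simp only [Function.iterate_zero, id, Nat.cast_zero, neg_zero]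
    refine VHomogeneous.prod fun j _ => VHomogeneous.one.sub ?_
    have h1 : VHomogeneous 1 (∑ k ∈ Finset.Ici j,
        (MvPolynomial.X k * MvPolynomial.C (vVar k) : MvPolynomial (Fin r) (LaurentV r))) :=
      VHomogeneous.sum fun k _ => by
        simpa using (VHomogeneous.X k).mul (VHomogeneous.C (vVar_mem k))
    have h2 : VHomogeneous (-1) (MvPolynomial.C (vInv j - vInvPrev j) :
        MvPolynomial (Fin r) (LaurentV r)) := by
      refine VHomogeneous.C (Submodule.sub_mem _ (vInv_mem j) ?_)
      rw [vInvPrev]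
      split_ifs
      exacts [vInv_mem _, Submodule.zero_mem _]
    simpa using h1.mul h2
  | succ q ih =>
    rw [Function.iterate_succ_apply']
    have := (VHomogeneous.C (vInv_mem (lastIdx r))).mul (ih.pderiv (lastIdx r))
    have e : (-1 : ℤ) + -(q : ℤ) = -((q + 1 : ℕ) : ℤ) := by push_cast; ring
    rw [e] at this
    exact this

theorem VHomogeneous.sum_eq {r : ℕ} {d : ℤ} {P : MvPolynomial (Fin r) (LaurentV r)}
    (hP : VHomogeneous d P) (l : Fin r →₀ ℕ) {m : Fin r → ℤ}
    (hm : m ∈ (P.coeff l).coeff.support) : ∑ j, m j = d :=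
  AddMonoidAlgebra.mem_gradeBy_iff (R := ℤ) _ _ _ |>.1 (hP l) hm

/-! ### Sums over several natural numbers -/

theorem hasSum_of_eq {ι : Type*} {f g : ι → ℂ} {a : ℂ} (h : HasSum f a) (e : ∀ i, g i = f i) :
    HasSum g a := by rwa [funext e]

/-- Induction on r, splitting off the first coordinate; absolute convergence is carried along
because the product of two series requires it. -/
theorem hasSum_prod_pi {r : ℕ} (f : Fin r → ℕ → ℂ) (hf : ∀ j, Summable fun n => ‖f j n‖) :
    (Summable fun n : Fin r → ℕ => ‖∏ j, f j (n j)‖) ∧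
      HasSum (fun n : Fin r → ℕ => ∏ j, f j (n j)) (∏ j, ∑' n, f j n) := by
  induction r with
  | zero =>
    refine ⟨(hasSum_fintype _).summable, ?_⟩
    convert hasSum_fintype (fun n : Fin 0 → ℕ => ∏ j, f j (n j)) using 1
    simp
  | succ r ih =>
    obtain ⟨h1, h2⟩ := ih (fun j => f j.succ) fun j => hf j.succ
    let E : ℕ × (Fin r → ℕ) ≃ (Fin (r + 1) → ℕ) := Fin.consEquiv fun _ => ℕ
    have e : ∀ p, ∏ j, f j (E p j) = f 0 p.1 * ∏ j : Fin r, f j.succ (p.2 j) := fun p => by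
      rw [Fin.prod_univ_succ]; simp [E, Fin.consEquiv]
    have h3 : Summable fun p : ℕ × (Fin r → ℕ) => ‖f 0 p.1 * ∏ j : Fin r, f j.succ (p.2 j)‖ :=
      Summable.mul_norm (f := f 0) (g := fun n : Fin r → ℕ => ∏ j : Fin r, f j.succ (n j)) (hf 0) h1
    constructor
    · refine E.summable_iff.1 (h3.congr fun p => ?_)
      rw [Function.comp_apply, e]
    · refine E.hasSum_iff.1 ?_
      rw [Fin.prod_univ_succ]
      have h4 := (hf 0).of_norm.hasSum.mul h2 h3.of_norm
      exact hasSum_of_eq h4 fun p => by rw [Function.comp_apply, e]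

theorem summable_prod_pi {r : ℕ} (g : ℕ → ℝ) (h0 : ∀ n, 0 ≤ g n) (hg : Summable g) :
    Summable fun n : Fin r → ℕ => ∏ j, g (n j) := by
  have h := (hasSum_prod_pi (r := r) (fun _ n => (g n : ℂ)) fun _ => by
    simpa [abs_of_nonneg (h0 _)] using hg).1
  refine h.congr fun n => ?_
  rw [norm_prod]
  exact Finset.prod_congr rfl fun j _ => by simp [abs_of_nonneg (h0 _)]

/-! ### Gaps -/

theorem gap_pos {r : ℕ} (N : LiIndex r) (j : Fin r) : 0 < gap N.1 j := by
  rw [gap]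
  split_ifs with h
  · refine Nat.sub_pos_of_lt (N.2.1 ?_)
    rw [Fin.lt_def]; exact Nat.sub_lt h one_pos
  · simpa using N.2.2 j

theorem sum_Iic_eq {r : ℕ} (f : Fin r → ℕ) (j : Fin r) :
    ∑ i ∈ Finset.Iic j, f i = f j + if 0 < (j : ℕ) then
      ∑ i ∈ Finset.Iic (⟨(j : ℕ) - 1, lt_of_le_of_lt (Nat.sub_le _ _) j.2⟩ : Fin r), f i else 0 := by
  split_ifs with h
  · rw [← Finset.sum_insert (f := f)]
    · congr 1
      ext i
      simp only [Finset.mem_Iic, Finset.mem_insert, Fin.le_def, Fin.ext_iff]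
      omega
    · simp only [Finset.mem_Iic, Fin.le_def]; omega
  · have : Finset.Iic j = {j} := by
      ext i
      simp only [Finset.mem_Iic, Finset.mem_singleton, Fin.le_def, Fin.ext_iff]
      omega
    rw [this, Finset.sum_singleton, add_zero]

theorem sum_gap {r : ℕ} (N : LiIndex r) (k : Fin r) : ∑ j ∈ Finset.Iic k, gap N.1 j = N.1 k := by
  obtain ⟨k, hk⟩ := k
  induction k with
  | zero => rw [sum_Iic_eq, gap]; simp
  | succ k ih =>
    rw [sum_Iic_eq, gap]
    have hlt : N.1 ⟨k, Nat.lt_of_succ_lt hk⟩ < N.1 ⟨k + 1, hk⟩ := N.2.1 (by simp [Fin.lt_def])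
    simp only [Nat.succ_pos, if_true, Nat.add_sub_cancel, ih (Nat.lt_of_succ_lt hk)]
    omega

/-- The strictly increasing sequence with given gaps. -/
def ofGaps {r : ℕ} (m : Fin r → ℕ) : LiIndex r :=
  ⟨fun k => ∑ j ∈ Finset.Iic k, (m j + 1),
    fun a b hab => Finset.sum_lt_sum_of_subset (Finset.Iic_subset_Iic.2 hab.le)
      (Finset.mem_Iic.2 le_rfl) (by simpa using hab) (Nat.succ_pos _) fun _ _ _ => Nat.zero_le _,
    fun j => lt_of_lt_of_le (Nat.succ_pos (m j))
      (Finset.single_le_sum (f := fun j => m j + 1) (fun _ _ => Nat.zero_le _)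
        (Finset.mem_Iic.2 le_rfl))⟩

/-- The parameters start at 0 while gaps start at 1. The same shift appears in the kernel expansion,
indexed by n + 1. -/
theorem gap_ofGaps {r : ℕ} (m : Fin r → ℕ) (j : Fin r) : gap (ofGaps m).1 j = m j + 1 := by
  have h := sum_Iic_eq (fun j => m j + 1) j
  simp only [gap, ofGaps]
  rw [h]
  split_ifs <;> simp

/-- Strictly increasing sequences correspond to their gaps. -/
def gapEquiv (r : ℕ) : (Fin r → ℕ) ≃ LiIndex r where
  toFun := ofGaps
  invFun N j := gap N.1 j - 1
  left_inv m := by ext j; simp [gap_ofGaps]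
  right_inv N := by
    refine Subtype.ext (funext fun k => ?_)
    have : ∀ j, gap N.1 j - 1 + 1 = gap N.1 j := fun j => Nat.sub_add_cancel (gap_pos N j)
    simp only [ofGaps, this, sum_gap]

/-- Summation by parts: x_k occurs in y_j exactly for j ≤ k, with total weight n_1 + ⋯ + n_k = N_k.
-/
theorem sum_gap_mul_tailSum {r : ℕ} (N : LiIndex r) (x : Fin r → ℂ) :
    ∑ j, (gap N.1 j : ℂ) * tailSum x j = ∑ k, (N.1 k : ℂ) * x k := by
  simp only [tailSum, Finset.mul_sum, ← sum_gap N, Nat.cast_sum, Finset.sum_mul]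
  rw [Finset.sum_comm']
  simp

theorem sum_gap_eq {r : ℕ} [NeZero r] (N : LiIndex r) :
    ∑ j, (gap N.1 j : ℂ) = N.1 (lastIdx r) := by
  rw [← sum_gap N, Nat.cast_sum]
  refine Finset.sum_congr ?_ fun _ _ => rfl
  ext j; simp [lastIdx_max]

/-! ### Multiple polylogarithms with complex exponents -/

/-- `z^{N_r} ∏ N_k ^ (-s_k)`. -/
def liTermC {r : ℕ} [NeZero r] (s : Fin r → ℂ) (z : ℂ) (N : LiIndex r) : ℂ :=
  z ^ (N.1 (lastIdx r)) * negPow N.1 s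

/-- The multiple polylogarithm with complex exponents. -/
def LiC {r : ℕ} [NeZero r] (s : Fin r → ℂ) (z : ℂ) : ℂ := ∑' N : LiIndex r, liTermC s z N

theorem negPow_int {r : ℕ} (N : LiIndex r) (k : Fin r → ℤ) :
    (negPow N.1 fun j => (k j : ℂ)) = (∏ j, (N.1 j : ℂ) ^ (k j))⁻¹ := by
  rw [negPow, Complex.exp_neg, Complex.exp_sum]
  congr 1
  refine Finset.prod_congr rfl fun j _ => ?_
  rw [Complex.exp_int_mul, ← Complex.ofReal_exp, Real.exp_log (by exact_mod_cast N.2.2 j)]; simp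

theorem liTermC_int {r : ℕ} [NeZero r] (k : Fin r → ℤ) (z : ℂ) :
    liTermC (fun j => (k j : ℂ)) z = liTerm k z := by
  ext N; rw [liTermC, liTerm, negPow_int, div_eq_mul_inv]

theorem LiC_int {r : ℕ} [NeZero r] (k : Fin r → ℤ) (z : ℂ) :
    LiC (fun j => (k j : ℂ)) z = Li k z := by rw [LiC, Li, liTermC_int]

theorem norm_negPow_le {r : ℕ} (N : LiIndex r) (s : Fin r → ℂ) (M : ℕ) (hM : ‖s‖ ≤ M) :
    ‖negPow N.1 s‖ ≤ ∏ k, (N.1 k : ℝ) ^ M := by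
  have h : ∏ k, (N.1 k : ℝ) ^ M = Real.exp (∑ k, M * Real.log (N.1 k)) := by
    rw [Real.exp_sum]
    refine Finset.prod_congr rfl fun k _ => ?_
    rw [Real.exp_nat_mul, Real.exp_log (by exact_mod_cast N.2.2 k)]
  rw [h, negPow, Complex.norm_exp, Real.exp_le_exp, Complex.neg_re, Complex.re_sum,
    ← Finset.sum_neg_distrib]
  refine Finset.sum_le_sum fun k _ => ?_
  rw [Complex.re_mul_ofReal, ← neg_mul]
  refine mul_le_mul_of_nonneg_right ?_ (Real.log_natCast_nonneg _)
  exact ((neg_le_abs _).trans (Complex.abs_re_le_norm _)).trans ((norm_le_pi_norm s k).trans hM)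

/-- Because N_1 + ⋯ + N_r ≤ r N_r, the decay in N_r alone can be shared equally among all N_k.
Convergence of the multiple series then reduces to one-variable series with ratio ρ, the r-th root
of the radius. -/
theorem pow_last_le {r : ℕ} [NeZero r] (N : LiIndex r) {ρ : ℝ} (h0 : 0 ≤ ρ) (h1 : ρ ≤ 1) :
    (ρ ^ r) ^ (N.1 (lastIdx r)) ≤ ∏ k, ρ ^ (N.1 k) := by
  rw [Finset.prod_pow_eq_pow_sum, ← pow_mul]
  refine pow_le_pow_of_le_one h0 h1 ?_
  refine (Finset.sum_le_card_nsmul _ _ (N.1 (lastIdx r)) fun k _ =>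
    N.2.1.monotone (lastIdx_max k)).trans (by simp)

theorem exists_root {r : ℕ} [NeZero r] {R : ℝ} (h0 : 0 ≤ R) (h1 : R < 1) :
    ∃ ρ : ℝ, 0 ≤ ρ ∧ ρ < 1 ∧ ρ ^ r = R :=
  ⟨R ^ (1 / (r : ℝ)), by positivity, Real.rpow_lt_one h0 h1 (by
    have := NeZero.pos r; positivity), by
    rw [← Real.rpow_natCast, ← Real.rpow_mul h0, one_div_mul_cancel
      (by exact_mod_cast NeZero.ne r), Real.rpow_one]⟩

theorem summable_pow_mul_prod {r : ℕ} (M : ℕ) {ρ : ℝ} (h0 : 0 ≤ ρ) (h1 : ρ < 1) :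
    Summable fun N : LiIndex r => ∏ k, ((N.1 k : ℝ) ^ M * ρ ^ (N.1 k)) := by
  have h := summable_prod_pi (r := r) (fun n : ℕ => (n : ℝ) ^ M * ρ ^ n) (fun n => by positivity)
    (summable_pow_mul_geometric_of_norm_lt_one M (by rwa [Real.norm_of_nonneg h0]))
  exact h.comp_injective Subtype.val_injective

theorem norm_liTermC_le {r : ℕ} [NeZero r] {s : Fin r → ℂ} {z : ℂ} {M : ℕ} {ρ : ℝ} (h0 : 0 ≤ ρ)
    (h1 : ρ ≤ 1) (hz : ‖z‖ ≤ ρ ^ r) (hM : ‖s‖ ≤ M) (N : LiIndex r) :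
    ‖liTermC s z N‖ ≤ ∏ k, ((N.1 k : ℝ) ^ M * ρ ^ (N.1 k)) := by
  rw [liTermC, norm_mul, norm_pow, Finset.prod_mul_distrib, mul_comm]
  gcongr
  · exact norm_negPow_le N s M hM
  · exact (pow_le_pow_left₀ (norm_nonneg _) hz _).trans (pow_last_le N h0 h1)

theorem summable_liTermC {r : ℕ} [NeZero r] (s : Fin r → ℂ) {z : ℂ} (hz : ‖z‖ < 1) :
    Summable (liTermC s z) := by
  obtain ⟨ρ, h0, h1, h2⟩ := exists_root (r := r) (norm_nonneg z) hz
  obtain ⟨M, hM⟩ := exists_nat_ge ‖s‖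
  exact Summable.of_norm_bounded (summable_pow_mul_prod M h0 h1)
    (norm_liTermC_le h0 h1.le h2.ge hM)

theorem differentiableOn_LiC {r : ℕ} [NeZero r] (s : Fin r → ℂ) :
    DifferentiableOn ℂ (LiC s) (Metric.ball 0 1) := by
  intro z hz
  have hz' : ‖z‖ < 1 := by simpa using hz
  obtain ⟨R, hzR, hR⟩ := exists_between hz'
  obtain ⟨ρ, h0, h1, h2⟩ := exists_root (r := r) ((norm_nonneg z).trans hzR.le) hR
  obtain ⟨M, hM⟩ := exists_nat_ge ‖s‖
  have := Complex.differentiableOn_tsum_of_summable_norm (U := Metric.ball (0 : ℂ) R)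
    (F := fun N z => liTermC s z N) (summable_pow_mul_prod (r := r) M h0 h1)
    (fun N => by unfold liTermC; fun_prop) Metric.isOpen_ball
    fun N w hw => norm_liTermC_le h0 h1.le (by rw [h2]; simpa using (Metric.mem_ball.1 hw).le) hM N
  exact (this.differentiableAt (Metric.isOpen_ball.mem_nhds (by simpa using hzR))).differentiableWithinAt

theorem negPow_lower {r : ℕ} [NeZero r] (N : LiIndex r) (s : Fin r → ℂ) (j : ℕ) :
    negPow N.1 (Function.update s (lastIdx r) (s (lastIdx r) - j)) =
      (N.1 (lastIdx r) : ℂ) ^ j * negPow N.1 s := by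
  have e : Function.update s (lastIdx r) (s (lastIdx r) - j) =
      (fun k => ((Pi.single (lastIdx r) (-j : ℤ) : Fin r → ℤ) k : ℂ)) + s := by
    ext k
    by_cases h : k = lastIdx r
    · subst h; simp; ring
    · simp [h]
  rw [e, negPow_add, negPow_single _ _ (N.2.2 _)]
  simp

/-- Termwise, z d/dz multiplies z^{N_r} by N_r, which is the same as lowering s_r by one. -/
theorem hasDerivAt_LiC {r : ℕ} [NeZero r] (s : Fin r → ℂ) {z : ℂ} (hz : ‖z‖ < 1) (h0 : z ≠ 0) :
    HasDerivAt (LiC s)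
      (LiC (Function.update s (lastIdx r) (s (lastIdx r) - 1)) z / z) z := by
  obtain ⟨R, hzR, hR⟩ := exists_between hz
  obtain ⟨ρ, h0', h1, h2⟩ := exists_root (r := r) ((norm_nonneg z).trans hzR.le) hR
  obtain ⟨M, hM⟩ := exists_nat_ge ‖s‖
  have h := Complex.hasSum_deriv_of_summable_norm (U := Metric.ball (0 : ℂ) R) (z := z)
    (F := fun N z => liTermC s z N) (summable_pow_mul_prod (r := r) M h0' h1)
    (fun N => by unfold liTermC; fun_prop) Metric.isOpen_ball
    (fun N w hw => norm_liTermC_le h0' h1.le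
      (by rw [h2]; simpa using (Metric.mem_ball.1 hw).le) hM N) (by simpa using hzR)
  have hd : DifferentiableAt ℂ (LiC s) z := (differentiableOn_LiC s).differentiableAt
    (Metric.isOpen_ball.mem_nhds (by simpa using hz))
  have e : LiC (Function.update s (lastIdx r) (s (lastIdx r) - 1)) z / z = deriv (LiC s) z := by
    refine HasSum.unique ((summable_liTermC _ hz).hasSum.div_const z) ?_
    refine hasSum_of_eq h fun N => ?_
    have h3 := negPow_lower N s 1
    rw [Nat.cast_one, pow_one] at h3
    have h4 : deriv (fun z => liTermC s z N) z =
        N.1 (lastIdx r) * z ^ (N.1 (lastIdx r) - 1) * negPow N.1 s := by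
      simp [liTermC]
    rw [h4, liTermC, h3, div_eq_iff h0, ← Nat.succ_pred_eq_of_pos (N.2.2 (lastIdx r)), pow_succ]
    simp only [Nat.succ_eq_add_one, Nat.pred_eq_sub_one, Nat.add_sub_cancel]
    ring
  rw [e]
  exact hd.hasDerivAt

theorem hasFDerivAt_negPow {r : ℕ} (N : Fin r → ℕ) (s : Fin r → ℂ) :
    HasFDerivAt (negPow N) (negPow N s •
      -∑ k, (Real.log (N k) : ℂ) • (ContinuousLinearMap.proj k : (Fin r → ℂ) →L[ℂ] ℂ)) s := by
  unfold negPow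
  refine HasFDerivAt.cexp (HasFDerivAt.neg (HasFDerivAt.fun_sum fun k _ => ?_))
  have := (ContinuousLinearMap.proj (R := ℂ) (φ := fun _ : Fin r => ℂ) k).hasFDerivAt (x := s)
  exact this.mul_const _

theorem differentiable_LiC {r : ℕ} [NeZero r] {z : ℂ} (hz : ‖z‖ < 1) :
    Differentiable ℂ fun s : Fin r → ℂ => LiC s z := by
  intro s
  obtain ⟨ρ, h0, h1, h2⟩ := exists_root (r := r) (norm_nonneg z) hz
  obtain ⟨M, hM⟩ := exists_nat_gt ‖s‖
  -- Differentiating in s brings down logarithms of the N_k; their sum is at most r ∏ N_k, which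
  -- costs one more power, hence M + 1.
  have hu := (summable_pow_mul_prod (r := r) (M + 1) h0 h1).mul_left (r : ℝ)
  refine (hasFDerivAt_tsum_of_isPreconnected (x := s) (x₀ := s) (s := Metric.ball (0 : Fin r → ℂ) M)
    (f := fun N s => liTermC s z N)
    (f' := fun N s => z ^ (N.1 (lastIdx r)) • (negPow N.1 s •
      -∑ k, (Real.log (N.1 k) : ℂ) • (ContinuousLinearMap.proj k : (Fin r → ℂ) →L[ℂ] ℂ)))
    hu Metric.isOpen_ball (convex_ball _ _).isPreconnected
    (fun N x _ => (hasFDerivAt_negPow N.1 x).const_mul _) ?_ (by simpa using hM)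
    (summable_liTermC s hz) (by simpa using hM)).differentiableAt
  intro N x hx
  have hx' : ‖x‖ ≤ M := by simpa using (Metric.mem_ball.1 hx).le
  rw [smul_smul, norm_smul, norm_neg]
  have hN : ∀ k, (1 : ℝ) ≤ N.1 k := fun k => by exact_mod_cast N.2.2 k
  have h3 : ‖∑ k, (Real.log (N.1 k) : ℂ) •
      (ContinuousLinearMap.proj k : (Fin r → ℂ) →L[ℂ] ℂ)‖ ≤ r * ∏ k, (N.1 k : ℝ) := by
    refine (norm_sum_le _ _).trans ((Finset.sum_le_card_nsmul _ _ (∏ k, (N.1 k : ℝ))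
      fun k _ => ?_).trans (by simp))
    have hp : ‖(ContinuousLinearMap.proj k : (Fin r → ℂ) →L[ℂ] ℂ)‖ ≤ 1 :=
      ContinuousLinearMap.opNorm_le_bound _ zero_le_one fun y => by
        simpa using norm_le_pi_norm y k
    rw [norm_smul, Complex.norm_real, Real.norm_of_nonneg (Real.log_natCast_nonneg _)]
    calc Real.log (N.1 k) * _ ≤ (N.1 k : ℝ) * 1 := by
          gcongr
          exact (Real.log_le_sub_one_of_pos (by linarith [hN k])).trans (by linarith)
      _ ≤ ∏ k, (N.1 k : ℝ) := by
          rw [mul_one, ← Finset.mul_prod_erase _ _ (Finset.mem_univ k)]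
          exact le_mul_of_one_le_right (by linarith [hN k])
            (Finset.one_le_prod fun i _ => hN i)
  have h4 := norm_liTermC_le h0 h1.le h2.ge hx' N
  rw [liTermC] at h4
  refine (mul_le_mul h4 h3 (norm_nonneg _) ?_).trans_eq ?_
  · exact Finset.prod_nonneg fun k _ => by positivity
  · rw [mul_left_comm, ← Finset.prod_mul_distrib]
    congr 1
    exact Finset.prod_congr rfl fun k _ => by ring

/-! ### Combinations of polylogarithms -/

/-- The combination of polylogarithms attached to a polynomial in the `u_j`, `v_j^{±1}`: the rising
factorials are taken at `σ`, the exponents of the polylogarithms are shifts of `s`. -/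
def polyLi {r : ℕ} [NeZero r] (P : MvPolynomial (Fin r) (LaurentV r)) (σ s : Fin r → ℂ) (z : ℂ) :
    ℂ :=
  ∑ l ∈ P.support, ∑ m ∈ (P.coeff l).coeff.support,
    (((P.coeff l).coeff m : ℂ) * ∏ j, (ascPochhammer ℂ (l j)).eval (σ j)) *
      LiC (s + fun j => (m j : ℂ)) z

/-- A Laurent monomial evaluated at v_k = 1/N_k shifts the exponents of the term. Keeping σ apart
from s matters later: the Euler operator changes s and leaves the rising factorials alone. -/
theorem hasSum_polyLi {r : ℕ} [NeZero r] (P : MvPolynomial (Fin r) (LaurentV r)) (σ s : Fin r → ℂ)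
    {z : ℂ} (hz : ‖z‖ < 1) :
    HasSum (fun N : LiIndex r => liTermC s z N *
      riseFun σ (MvPolynomial.map (evalV N.1).toRingHom P)) (polyLi P σ s z) := by
  have h : ∀ l m, HasSum (fun N : LiIndex r =>
      (((P.coeff l).coeff m : ℂ) * ∏ j, (ascPochhammer ℂ (l j)).eval (σ j)) *
        liTermC (s + fun j => (m j : ℂ)) z N)
      ((((P.coeff l).coeff m : ℂ) * ∏ j, (ascPochhammer ℂ (l j)).eval (σ j)) *
        LiC (s + fun j => (m j : ℂ)) z) := fun l m => (summable_liTermC _ hz).hasSum.mul_left _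
  have h2 := hasSum_sum fun l (_ : l ∈ P.support) =>
    hasSum_sum fun m (_ : m ∈ (P.coeff l).coeff.support) => h l m
  rw [polyLi]
  refine hasSum_of_eq h2 fun N => ?_
  conv_lhs => rw [P.as_sum]
  simp only [map_sum, MvPolynomial.map_monomial, riseFun_monomial]
  rw [Finset.mul_sum]
  refine Finset.sum_congr rfl fun l _ => ?_
  have : (evalV N.1).toRingHom (P.coeff l) = evalV N.1 (P.coeff l) := rfl
  rw [this, evalV_eq_sum, Finset.sum_mul, Finset.mul_sum]
  refine Finset.sum_congr rfl fun m _ => ?_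
  rw [liTermC, liTermC, negPow_add]
  ring

theorem differentiable_polyLi {r : ℕ} [NeZero r] (P : MvPolynomial (Fin r) (LaurentV r)) {z : ℂ}
    (hz : ‖z‖ < 1) : Differentiable ℂ fun s : Fin r → ℂ => polyLi P s s z := by
  unfold polyLi
  have h1 : ∀ c : Fin r → ℂ, Differentiable ℂ fun s : Fin r → ℂ => LiC (s + c) z := fun c =>
    (differentiable_LiC hz).comp (differentiable_id.add_const c)
  have h2 : ∀ n j, Differentiable ℂ fun s : Fin r → ℂ => (ascPochhammer ℂ n).eval (s j) :=
    fun n j => (ascPochhammer ℂ n).differentiable.comp (differentiable_pi.1 differentiable_id j)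
  refine Differentiable.fun_sum fun l _ => Differentiable.fun_sum fun m _ => ?_
  refine Differentiable.mul (Differentiable.const_mul ?_ _) (h1 _)
  exact fun x => (HasFDerivAt.finsetProd fun j _ =>
    (h2 (l j) j).differentiableAt.hasFDerivAt).differentiableAt

theorem differentiableOn_polyLi {r : ℕ} [NeZero r] (P : MvPolynomial (Fin r) (LaurentV r))
    (σ s : Fin r → ℂ) : DifferentiableOn ℂ (polyLi P σ s) (Metric.ball 0 1) := by
  unfold polyLi
  exact DifferentiableOn.fun_sum fun l _ => DifferentiableOn.fun_sum fun m _ =>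
    (differentiableOn_LiC _).const_mul _

/-! ### The Hankel contour in one variable -/

/-- `x ^ (s - 1) dx` along the Hankel contour. -/
def hankelWeight (ε : ℝ) (s : ℂ) (a : ℝ) : ℂ :=
  Complex.exp ((s - 1) * hankelLog ε a) * hankelVelocity ε a

theorem measurable_hankelLog (ε : ℝ) : Measurable (hankelLog ε) := by
  unfold hankelLog
  refine Measurable.ite measurableSet_Iio (by fun_prop) (Measurable.ite measurableSet_Iic ?_ ?_) <;>
    fun_prop

theorem measurable_hankelPoint (ε : ℝ) : Measurable (hankelPoint ε) :=
  (measurable_hankelLog ε).cexp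

theorem measurable_hankelVelocity (ε : ℝ) : Measurable (hankelVelocity ε) := by
  unfold hankelVelocity
  refine Measurable.ite measurableSet_Iio (by fun_prop) (Measurable.ite measurableSet_Iic ?_ ?_) <;>
    fun_prop

theorem measurable_hankelWeight (ε : ℝ) (s : ℂ) : Measurable (hankelWeight ε s) :=
  (((measurable_hankelLog ε).const_mul _).cexp).mul (measurable_hankelVelocity ε)

theorem hankelPoint_of_neg {ε a : ℝ} (hε : 0 < ε) (ha : a < 0) :
    hankelPoint ε a = ((ε - a : ℝ) : ℂ) := by
  rw [hankelPoint, hankelLog, if_pos ha, ← Complex.ofReal_exp, Real.exp_log (by linarith)]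

theorem hankelPoint_of_mem {ε a : ℝ} (hε : 0 < ε) (ha : 0 ≤ a) (ha' : a ≤ 2 * Real.pi) :
    hankelPoint ε a = ε * Complex.exp (a * Complex.I) := by
  rw [hankelPoint, hankelLog, if_neg (not_lt.2 ha), if_pos ha', Complex.exp_add,
    ← Complex.ofReal_exp, Real.exp_log hε]

theorem hankelPoint_of_gt {ε a : ℝ} (hε : 0 < ε) (ha : 2 * Real.pi < a) :
    hankelPoint ε a = ((a + (ε - 2 * Real.pi) : ℝ) : ℂ) := by
  have h0 : ¬ a < 0 := by have := Real.pi_pos; linarith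
  rw [hankelPoint, hankelLog, if_neg h0, if_neg (not_le.2 ha), Complex.exp_add,
    ← Complex.ofReal_exp, Real.exp_log (by linarith), Complex.exp_two_pi_mul_I, mul_one]
  congr 1; ring

theorem hankelPoint_re_ge {ε : ℝ} (hε : 0 < ε) (a : ℝ) : -ε ≤ (hankelPoint ε a).re := by
  rcases lt_or_ge a 0 with h | h
  · rw [hankelPoint_of_neg hε h, Complex.ofReal_re]; linarith
  rcases le_or_gt a (2 * Real.pi) with h' | h'
  · rw [hankelPoint_of_mem hε h h', Complex.re_ofReal_mul, Complex.exp_ofReal_mul_I_re]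
    nlinarith [Real.neg_one_le_cos a]
  · rw [hankelPoint_of_gt hε h', Complex.ofReal_re]; linarith

theorem abs_hankelPoint_im_le {ε : ℝ} (hε : 0 < ε) (a : ℝ) : |(hankelPoint ε a).im| ≤ ε := by
  rcases lt_or_ge a 0 with h | h
  · rw [hankelPoint_of_neg hε h, Complex.ofReal_im, abs_zero]; exact hε.le
  rcases le_or_gt a (2 * Real.pi) with h' | h'
  · rw [hankelPoint_of_mem hε h h', Complex.im_ofReal_mul, Complex.exp_ofReal_mul_I_im, abs_mul,
      abs_of_pos hε]
    exact mul_le_of_le_one_right hε.le (Real.abs_sin_le_one a)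
  · rw [hankelPoint_of_gt hε h', Complex.ofReal_im, abs_zero]; exact hε.le

/-- `x ^ (s - 1) e ^ (-δ x)` on the positive real axis. -/
def gammaKernel (s : ℂ) (δ x : ℝ) : ℂ :=
  Complex.exp ((s - 1) * (Real.log x : ℂ)) * Complex.exp (-(δ : ℂ) * x)

/-- `x ^ (s - 1) e ^ (-δ x) dx` on the circle of radius `ε`. -/
def circleKernel (s : ℂ) (δ ε θ : ℝ) : ℂ :=
  Complex.I * (Complex.exp (s * ((Real.log ε : ℂ) + θ * Complex.I)) *
    Complex.exp (-(δ : ℂ) * Complex.exp ((Real.log ε : ℂ) + θ * Complex.I)))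

theorem hankelWeight_of_neg {ε a δ : ℝ} (s : ℂ) (hε : 0 < ε) (ha : a < 0) :
    hankelWeight ε s a * Complex.exp (-(δ : ℂ) * hankelPoint ε a) = -gammaKernel s δ (ε - a) := by
  rw [hankelPoint_of_neg hε ha, hankelWeight, hankelLog, hankelVelocity, if_pos ha, if_pos ha,
    gammaKernel]
  ring

theorem hankelWeight_of_mem {ε a δ : ℝ} (s : ℂ) (hε : 0 < ε) (ha : 0 ≤ a)
    (ha' : a ≤ 2 * Real.pi) :
    hankelWeight ε s a * Complex.exp (-(δ : ℂ) * hankelPoint ε a) = circleKernel s δ ε a := by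
  have h : Complex.exp ((Real.log ε : ℂ) + a * Complex.I) = ε * Complex.exp (a * Complex.I) := by
    rw [Complex.exp_add, ← Complex.ofReal_exp, Real.exp_log hε]
  have h2 : s * ((Real.log ε : ℂ) + a * Complex.I) = (s - 1) * ((Real.log ε : ℂ) + a * Complex.I) +
    ((Real.log ε : ℂ) + a * Complex.I) := by ring
  rw [hankelPoint_of_mem hε ha ha', hankelWeight, hankelLog, hankelVelocity, if_neg (not_lt.2 ha),
    if_pos ha', if_neg (not_lt.2 ha), if_pos ha', circleKernel, h2, Complex.exp_add _ (_ + _), h]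
  ring

/-- The argument is 2π on the returning ray, which produces the monodromy factor e^{2πis}. -/
theorem hankelWeight_of_gt {ε a δ : ℝ} (s : ℂ) (hε : 0 < ε) (ha : 2 * Real.pi < a) :
    hankelWeight ε s a * Complex.exp (-(δ : ℂ) * hankelPoint ε a) =
      Complex.exp (2 * Real.pi * Complex.I * s) * gammaKernel s δ (a + (ε - 2 * Real.pi)) := by
  have h0 : ¬ a < 0 := by have := Real.pi_pos; linarith
  have h1 : ε + (a - 2 * Real.pi) = a + (ε - 2 * Real.pi) := by ring
  have h2 : Complex.exp ((s - 1) * (2 * Real.pi * Complex.I)) =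
      Complex.exp (2 * Real.pi * Complex.I * s) := by
    rw [sub_mul, one_mul, Complex.exp_sub, Complex.exp_two_pi_mul_I, div_one, mul_comm]
  rw [hankelPoint_of_gt hε ha, hankelWeight, hankelLog, hankelVelocity, if_neg h0,
    if_neg (not_le.2 ha), if_neg h0, if_neg (not_le.2 ha), gammaKernel, mul_add, Complex.exp_add,
    h1, h2]
  ring

theorem continuousOn_gammaKernel (s : ℂ) (δ : ℝ) : ContinuousOn (gammaKernel s δ) (Set.Ioi 0) := by
  unfold gammaKernel
  refine ContinuousOn.mul (ContinuousOn.cexp ?_) (by fun_prop)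
  exact continuousOn_const.mul (Complex.continuous_ofReal.comp_continuousOn
    (Real.continuousOn_log.mono fun x hx => ne_of_gt hx))

theorem continuous_circleKernel (s : ℂ) (δ ε : ℝ) : Continuous (circleKernel s δ ε) := by
  unfold circleKernel; fun_prop

theorem norm_gammaKernel {x : ℝ} (hx : 0 < x) (s : ℂ) (δ : ℝ) :
    ‖gammaKernel s δ x‖ = x ^ (s.re - 1) * Real.exp (-δ * x) := by
  rw [gammaKernel, norm_mul, Complex.norm_exp, Complex.norm_exp, Complex.re_mul_ofReal,
    Real.rpow_def_of_pos hx, ← Complex.ofReal_neg, ← Complex.ofReal_mul, Complex.ofReal_re]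
  simp [mul_comm]

theorem rpow_mul_exp_isBigO (c : ℝ) (δ : ℝ) (hδ : 0 < δ) :
    (fun x : ℝ => x ^ c * Real.exp (-δ * x)) =O[atTop] fun x => Real.exp (-(δ / 2) * x) := by
  have h := ((isLittleO_rpow_exp_pos_mul_atTop c (half_pos hδ)).isBigO).mul
    (Asymptotics.isBigO_refl (fun x : ℝ => Real.exp (-δ * x)) atTop)
  refine h.congr_right fun x => ?_
  rw [← Real.exp_add]; congr 1; ring

theorem integrableOn_gammaKernel {ε δ : ℝ} (hε : 0 < ε) (hδ : 0 < δ) (s : ℂ) :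
    IntegrableOn (gammaKernel s δ) (Set.Ioi ε) := by
  have hpos : ∀ x ∈ Set.Ici ε, x ≠ 0 := fun x hx => (hε.trans_le hx).ne'
  have h : IntegrableOn (fun x : ℝ => x ^ (s.re - 1) * Real.exp (-δ * x)) (Set.Ioi ε) := by
    refine integrable_of_isBigO_exp_neg (half_pos hδ) ?_ (rpow_mul_exp_isBigO _ _ hδ)
    exact ContinuousOn.mul (fun x hx => (Real.continuousAt_rpow_const _ _
      (Or.inl (hpos x hx))).continuousWithinAt) (by fun_prop)
  refine h.mono' (((continuousOn_gammaKernel s δ).mono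
    (Set.Ioi_subset_Ioi hε.le)).aestronglyMeasurable measurableSet_Ioi) ?_
  filter_upwards [ae_restrict_mem measurableSet_Ioi] with x hx
  rw [norm_gammaKernel (hε.trans hx)]

theorem measurePreserving_const_sub (c : ℝ) : MeasurePreserving (fun a : ℝ => c - a) volume volume :=
  Measure.measurePreserving_sub_left volume c

theorem measurableEmbedding_const_sub (c : ℝ) : MeasurableEmbedding fun a : ℝ => c - a :=
  (Homeomorph.subLeft c).measurableEmbedding

theorem measurableEmbedding_add_const (c : ℝ) : MeasurableEmbedding fun a : ℝ => a + c :=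
  (Homeomorph.addRight c).measurableEmbedding

theorem univ_eq_hankel : (Set.univ : Set ℝ) =
    Set.Iio 0 ∪ (Set.Icc 0 (2 * Real.pi) ∪ Set.Ioi (2 * Real.pi)) := by
  ext x
  simp only [Set.mem_univ, Set.mem_union, Set.mem_Iio, Set.mem_Icc, Set.mem_Ioi, true_iff]
  rcases lt_or_ge x 0 with h | h
  · exact Or.inl h
  · rcases le_or_gt x (2 * Real.pi) with h' | h'
    exacts [Or.inr (Or.inl ⟨h, h'⟩), Or.inr (Or.inr h')]

theorem preimage_const_sub_Ioi (ε : ℝ) : (fun a : ℝ => ε - a) ⁻¹' Set.Ioi ε = Set.Iio 0 := by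
  ext a; simp

theorem preimage_add_const_Ioi (ε : ℝ) :
    (fun a : ℝ => a + (ε - 2 * Real.pi)) ⁻¹' Set.Ioi ε = Set.Ioi (2 * Real.pi) := by
  ext a; simp only [Set.mem_preimage, Set.mem_Ioi]; constructor <;> intro h <;> linarith

theorem hankelWeight_integrableOn {ε δ : ℝ} (hε : 0 < ε) (hδ : 0 < δ) (s : ℂ) :
    IntegrableOn (fun a => hankelWeight ε s a * Complex.exp (-(δ : ℂ) * hankelPoint ε a))
        (Set.Iio 0) ∧
      IntegrableOn (fun a => hankelWeight ε s a * Complex.exp (-(δ : ℂ) * hankelPoint ε a))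
        (Set.Icc 0 (2 * Real.pi)) ∧
      IntegrableOn (fun a => hankelWeight ε s a * Complex.exp (-(δ : ℂ) * hankelPoint ε a))
        (Set.Ioi (2 * Real.pi)) := by
  refine ⟨?_, ?_, ?_⟩
  · rw [integrableOn_congr_fun (fun a (ha : a ∈ Set.Iio (0 : ℝ)) => hankelWeight_of_neg s hε ha) measurableSet_Iio,
      ← preimage_const_sub_Ioi ε]
    exact ((measurePreserving_const_sub ε).integrableOn_comp_preimage
      (measurableEmbedding_const_sub ε)).2 (integrableOn_gammaKernel hε hδ s).neg
  · rw [integrableOn_congr_fun (fun a ha => hankelWeight_of_mem s hε ha.1 ha.2) measurableSet_Icc]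
    exact (continuous_circleKernel s δ ε).integrableOn_Icc
  · rw [integrableOn_congr_fun
      (fun a (ha : a ∈ Set.Ioi (2 * Real.pi)) => hankelWeight_of_gt s hε ha) measurableSet_Ioi,
      ← preimage_add_const_Ioi ε]
    exact ((measurePreserving_add_right volume (ε - 2 * Real.pi)).integrableOn_comp_preimage
      (measurableEmbedding_add_const _)).2 ((integrableOn_gammaKernel hε hδ s).const_mul _)

theorem integrable_hankelWeight {ε δ : ℝ} (hε : 0 < ε) (hδ : 0 < δ) (s : ℂ) :
    Integrable fun a => hankelWeight ε s a * Complex.exp (-(δ : ℂ) * hankelPoint ε a) := by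
  obtain ⟨h1, h2, h3⟩ := hankelWeight_integrableOn hε hδ s
  rw [← integrableOn_univ, univ_eq_hankel]
  exact h1.union (h2.union h3)

theorem integral_hankelWeight {ε δ : ℝ} (hε : 0 < ε) (hδ : 0 < δ) (s : ℂ) :
    ∫ a, hankelWeight ε s a * Complex.exp (-(δ : ℂ) * hankelPoint ε a) =
      (Complex.exp (2 * Real.pi * Complex.I * s) - 1) * (∫ x in Set.Ioi ε, gammaKernel s δ x) +
        ∫ θ in (0 : ℝ)..2 * Real.pi, circleKernel s δ ε θ := by
  obtain ⟨h1, h2, h3⟩ := hankelWeight_integrableOn hε hδ s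
  rw [← setIntegral_univ, univ_eq_hankel, setIntegral_union _ _ h1 (h2.union h3),
    setIntegral_union _ measurableSet_Ioi h2 h3]
  rotate_left
  · exact Set.disjoint_left.2 fun x hx hx' => not_lt.2 hx.2 hx'
  · refine Set.disjoint_left.2 fun x hx hx' => ?_
    have := Real.pi_pos
    rcases hx' with hx' | hx'
    · exact not_lt.2 hx'.1 hx
    · simp only [Set.mem_Iio, Set.mem_Ioi] at hx hx'; linarith
  · exact measurableSet_Icc.union measurableSet_Ioi
  have e1 : ∫ a in Set.Iio (0 : ℝ),
      hankelWeight ε s a * Complex.exp (-(δ : ℂ) * hankelPoint ε a) =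
      -∫ x in Set.Ioi ε, gammaKernel s δ x := by
    rw [setIntegral_congr_fun measurableSet_Iio fun a ha => hankelWeight_of_neg s hε ha,
      integral_neg, ← preimage_const_sub_Ioi ε]
    congr 1
    exact (measurePreserving_const_sub ε).setIntegral_preimage_emb
      (measurableEmbedding_const_sub ε) (gammaKernel s δ) _
  have e3 : ∫ a in Set.Ioi (2 * Real.pi),
      hankelWeight ε s a * Complex.exp (-(δ : ℂ) * hankelPoint ε a) =
      Complex.exp (2 * Real.pi * Complex.I * s) * ∫ x in Set.Ioi ε, gammaKernel s δ x := by
    rw [setIntegral_congr_fun measurableSet_Ioi fun a ha => hankelWeight_of_gt s hε ha,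
      integral_const_mul, ← preimage_add_const_Ioi ε]
    congr 1
    exact (measurePreserving_add_right volume (ε - 2 * Real.pi)).setIntegral_preimage_emb
      (measurableEmbedding_add_const _) (gammaKernel s δ) _
  have e2 : ∫ a in Set.Icc 0 (2 * Real.pi),
      hankelWeight ε s a * Complex.exp (-(δ : ℂ) * hankelPoint ε a) =
      ∫ θ in (0 : ℝ)..2 * Real.pi, circleKernel s δ ε θ := by
    rw [setIntegral_congr_fun measurableSet_Icc fun a ha => hankelWeight_of_mem s hε ha.1 ha.2,
      intervalIntegral.integral_of_le (by positivity), integral_Icc_eq_integral_Ioc]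
  rw [e1, e2, e3]
  ring

/-! ### Functional equation, change of radius and Hankel's formula -/

theorem gammaKernel_succ {x : ℝ} (hx : 0 < x) (s : ℂ) (δ : ℝ) :
    gammaKernel (s + 1) δ x = x * gammaKernel s δ x := by
  have h : (s + 1 - 1) * (Real.log x : ℂ) = (s - 1) * (Real.log x : ℂ) + Real.log x := by ring
  rw [gammaKernel, gammaKernel, h, Complex.exp_add, ← Complex.ofReal_exp, Real.exp_log hx]
  ring

/-- Integration by parts on the positive real axis. -/
theorem integral_gammaKernel_succ {ε δ : ℝ} (hε : 0 < ε) (hδ : 0 < δ) (s : ℂ) :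
    s * (∫ x in Set.Ioi ε, gammaKernel s δ x) - δ * ∫ x in Set.Ioi ε, gammaKernel (s + 1) δ x =
      -gammaKernel (s + 1) δ ε := by
  have hd : ∀ x : ℝ, 0 < x → HasDerivAt (gammaKernel (s + 1) δ)
      (s * gammaKernel s δ x - δ * gammaKernel (s + 1) δ x) x := fun x hx => by
    have h1 : HasDerivAt (fun x : ℝ => (Real.log x : ℂ)) ((x⁻¹ : ℝ) : ℂ) x :=
      (Real.hasDerivAt_log hx.ne').ofReal_comp
    have h2 : HasDerivAt (fun x : ℝ => -(δ : ℂ) * x) (-(δ : ℂ) * 1) x :=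
      (Complex.ofRealCLM.hasDerivAt (x := x)).const_mul _
    have h3 := ((h1.const_mul (s + 1 - 1)).cexp).mul h2.cexp
    refine h3.congr_deriv ?_
    have hx' : (x : ℂ) ≠ 0 := by exact_mod_cast hx.ne'
    have h4 := gammaKernel_succ hx s δ
    have h5 : gammaKernel s δ x = gammaKernel (s + 1) δ x * (x : ℂ)⁻¹ := by
      rw [h4]; field_simp
    rw [h5, gammaKernel]
    push_cast
    ring
  have hi := (integrableOn_gammaKernel hε hδ s).const_mul s
  have hi' := (integrableOn_gammaKernel hε hδ (s + 1)).const_mul (δ : ℂ)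
  have hlim : Tendsto (gammaKernel (s + 1) δ) atTop (𝓝 0) := by
    refine squeeze_zero_norm' (a := fun x => x ^ ((s + 1).re - 1) * Real.exp (-δ * x)) ?_ ?_
    · filter_upwards [eventually_gt_atTop 0] with x hx
      rw [norm_gammaKernel hx]
    · refine (rpow_mul_exp_isBigO _ _ hδ).trans_tendsto ?_
      refine Real.tendsto_exp_atBot.comp ?_
      exact tendsto_id.const_mul_atTop_of_neg (by linarith)
  have h := integral_Ioi_of_hasDerivAt_of_tendsto (a := ε) (f := gammaKernel (s + 1) δ)
    (hd ε hε).continuousAt.continuousWithinAt (fun x hx => hd x (hε.trans hx)) (hi.sub hi') hlim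
  rw [integral_sub hi hi', integral_const_mul, integral_const_mul] at h
  rw [h, zero_sub]

theorem gammaKernel_eq {ε : ℝ} (s : ℂ) (δ : ℝ) : gammaKernel (s + 1) δ ε =
    Complex.exp (s * (Real.log ε : ℂ)) * Complex.exp (-(δ : ℂ) * ε) := by
  rw [gammaKernel, add_sub_cancel_right]

/-- Integration by parts on the circle. -/
theorem integral_circleKernel_succ {ε : ℝ} (hε : 0 < ε) (δ : ℝ) (s : ℂ) :
    s * (∫ θ in (0 : ℝ)..2 * Real.pi, circleKernel s δ ε θ) -
        δ * ∫ θ in (0 : ℝ)..2 * Real.pi, circleKernel (s + 1) δ ε θ =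
      (Complex.exp (2 * Real.pi * Complex.I * s) - 1) * gammaKernel (s + 1) δ ε := by
  let F : ℝ → ℂ := fun θ => Complex.exp (s * ((Real.log ε : ℂ) + θ * Complex.I)) *
    Complex.exp (-(δ : ℂ) * Complex.exp ((Real.log ε : ℂ) + θ * Complex.I))
  have hd : ∀ θ : ℝ, HasDerivAt F (s * circleKernel s δ ε θ - δ * circleKernel (s + 1) δ ε θ) θ :=
    fun θ => by
      have h1 : HasDerivAt (fun θ : ℝ => (Real.log ε : ℂ) + θ * Complex.I) (1 * Complex.I) θ :=
        ((Complex.ofRealCLM.hasDerivAt (x := θ)).mul_const _).const_add _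
      have h3 := ((h1.const_mul s).cexp).mul ((h1.cexp.const_mul (-(δ : ℂ))).cexp)
      refine h3.congr_deriv ?_
      rw [circleKernel, circleKernel, add_mul s 1, one_mul, Complex.exp_add (s * _)]
      ring_nf
  have hc : ∀ s, Continuous (circleKernel s δ ε) := fun s => continuous_circleKernel s δ ε
  have h := intervalIntegral.integral_eq_sub_of_hasDerivAt (a := 0) (b := 2 * Real.pi)
    (fun θ _ => hd θ) ((((hc s).const_mul s).sub ((hc (s + 1)).const_mul _)).intervalIntegrable _ _)
  rw [intervalIntegral.integral_sub (((hc s).const_mul s).intervalIntegrable _ _)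
    (((hc (s + 1)).const_mul _).intervalIntegrable _ _), intervalIntegral.integral_const_mul,
    intervalIntegral.integral_const_mul] at h
  rw [h, gammaKernel_eq]
  have e : Complex.exp ((Real.log ε : ℂ)) = ε := by rw [← Complex.ofReal_exp, Real.exp_log hε]
  simp only [F]
  push_cast
  rw [Complex.exp_add, Complex.exp_two_pi_mul_I, mul_add, Complex.exp_add, zero_mul, add_zero, e,
    mul_one, mul_comm s (2 * Real.pi * Complex.I)]
  ring

/-- The boundary terms at ε from the rays and from the circle cancel, so integration by parts on the
whole contour leaves none. -/
theorem integral_hankelWeight_succ {ε δ : ℝ} (hε : 0 < ε) (hδ : 0 < δ) (s : ℂ) :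
    δ * ∫ a, hankelWeight ε (s + 1) a * Complex.exp (-(δ : ℂ) * hankelPoint ε a) =
      s * ∫ a, hankelWeight ε s a * Complex.exp (-(δ : ℂ) * hankelPoint ε a) := by
  rw [integral_hankelWeight hε hδ, integral_hankelWeight hε hδ]
  have h1 := integral_gammaKernel_succ hε hδ s
  have h2 := integral_circleKernel_succ hε δ s
  have h3 : Complex.exp (2 * Real.pi * Complex.I * (s + 1)) =
      Complex.exp (2 * Real.pi * Complex.I * s) := by
    rw [mul_add, mul_one, Complex.exp_add, Complex.exp_two_pi_mul_I, mul_one]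
  rw [h3]
  linear_combination -(Complex.exp (2 * Real.pi * Complex.I * s) - 1) * h1 - h2

/-- The difference of two circles, by Cauchy's theorem in the logarithmic plane. -/
theorem integral_circleKernel_sub {ε ε' : ℝ} (hε' : 0 < ε') (h : ε' ≤ ε) (δ : ℝ) (s : ℂ) :
    (∫ θ in (0 : ℝ)..2 * Real.pi, circleKernel s δ ε θ) -
        ∫ θ in (0 : ℝ)..2 * Real.pi, circleKernel s δ ε' θ =
      (Complex.exp (2 * Real.pi * Complex.I * s) - 1) * ∫ x in ε'..ε, gammaKernel s δ x := by
  have hε := hε'.trans_le h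
  let f : ℂ → ℂ := fun w => Complex.exp (s * w) * Complex.exp (-(δ : ℂ) * Complex.exp w)
  have hf : Differentiable ℂ f := by fun_prop
  -- Rectangle with real part in [log ε', log ε] and imaginary part in [0, 2π]: the vertical sides
  -- are the two circles, the horizontal ones the radial segment, the upper one multiplied by
  -- e^{2πis}. In this plane the integrand is entire.
  have hrect := Complex.integral_boundary_rect_eq_zero_of_differentiableOn f (Real.log ε' : ℂ)
    ((Real.log ε : ℂ) + (2 * Real.pi : ℝ) * Complex.I) hf.differentiableOn
  have hper : ∀ w, f (w + (2 * Real.pi : ℝ) * Complex.I) =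
      Complex.exp (2 * Real.pi * Complex.I * s) * f w := fun w => by
    simp only [f]
    push_cast
    rw [mul_add, Complex.exp_add, Complex.exp_add, Complex.exp_two_pi_mul_I, mul_one,
      mul_comm s (2 * Real.pi * Complex.I)]
    ring
  have hsub : ∫ u in Real.log ε'..Real.log ε, f u = ∫ x in ε'..ε, gammaKernel s δ x := by
    have := intervalIntegral.integral_deriv_smul_comp'' (a := Real.log ε') (b := Real.log ε)
      (f := Real.exp) (f' := Real.exp) (g := gammaKernel s δ) Real.continuous_exp.continuousOn
      (fun x _ => (Real.hasDerivAt_exp x).hasDerivWithinAt) Real.continuous_exp.continuousOn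
      ((continuousOn_gammaKernel s δ).mono (by rintro _ ⟨x, -, rfl⟩; exact Real.exp_pos x))
    rw [Real.exp_log hε, Real.exp_log hε'] at this
    rw [← this]
    refine intervalIntegral.integral_congr fun u _ => ?_
    simp only [f, gammaKernel, Function.comp_apply, Real.log_exp, Complex.real_smul,
      Complex.ofReal_exp]
    have e : s * (u : ℂ) = u + (s - 1) * u := by ring
    rw [e, Complex.exp_add, mul_assoc]
  have hcirc : ∀ ε : ℝ, Complex.I • ∫ y in (0 : ℝ)..2 * Real.pi, f (Real.log ε + y * Complex.I) =
      ∫ θ in (0 : ℝ)..2 * Real.pi, circleKernel s δ ε θ := fun ε => by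
    rw [← intervalIntegral.integral_smul]; rfl
  simp only [Complex.ofReal_re, Complex.ofReal_im, Complex.add_re, Complex.add_im, Complex.mul_re,
    Complex.mul_im, Complex.I_re, Complex.I_im, mul_zero, mul_one, zero_mul, sub_zero, add_zero,
    zero_add, hper, intervalIntegral.integral_const_mul, Complex.ofReal_zero, hcirc, hsub] at hrect
  linear_combination hrect

theorem integral_hankelWeight_radius {ε ε' δ : ℝ} (hε' : 0 < ε') (h : ε' ≤ ε) (hδ : 0 < δ) (s : ℂ) :
    ∫ a, hankelWeight ε s a * Complex.exp (-(δ : ℂ) * hankelPoint ε a) =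
      ∫ a, hankelWeight ε' s a * Complex.exp (-(δ : ℂ) * hankelPoint ε' a) := by
  rw [integral_hankelWeight (hε'.trans_le h) hδ, integral_hankelWeight hε' hδ]
  have h1 := integral_circleKernel_sub hε' h δ s
  have h2 : (∫ x in ε'..ε, gammaKernel s δ x) + ∫ x in Set.Ioi ε, gammaKernel s δ x =
      ∫ x in Set.Ioi ε', gammaKernel s δ x := by
    rw [intervalIntegral.integral_of_le h, ← setIntegral_union
      (Set.Ioc_disjoint_Ioi le_rfl) measurableSet_Ioi
      ((integrableOn_gammaKernel hε' hδ s).mono_set Set.Ioc_subset_Ioi_self)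
      (integrableOn_gammaKernel (hε'.trans_le h) hδ s), Set.Ioc_union_Ioi_eq_Ioi h]
  linear_combination h1 + (Complex.exp (2 * Real.pi * Complex.I * s) - 1) * h2

theorem gammaKernel_eq_cpow {x : ℝ} (hx : 0 < x) (s : ℂ) (δ : ℝ) :
    gammaKernel s δ x = (x : ℂ) ^ (s - 1) * Complex.exp (-((δ : ℂ) * x)) := by
  rw [gammaKernel, Complex.cpow_def_of_ne_zero (by exact_mod_cast hx.ne'), ← Complex.ofReal_log hx.le,
    neg_mul, mul_comm (s - 1)]

theorem integrableOn_gammaKernel_zero {δ : ℝ} (hδ : 0 < δ) {s : ℂ} (hs : 0 < s.re) :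
    IntegrableOn (gammaKernel s δ) (Set.Ioi 0) := by
  have h : IntegrableOn (fun x : ℝ => x ^ (s.re - 1) * Real.exp (-δ * x ^ (1 : ℝ))) (Set.Ioi 0) :=
    integrableOn_rpow_mul_exp_neg_mul_rpow (by linarith) zero_lt_one hδ
  refine h.mono' ((continuousOn_gammaKernel s δ).aestronglyMeasurable measurableSet_Ioi) ?_
  filter_upwards [ae_restrict_mem measurableSet_Ioi] with x hx
  rw [norm_gammaKernel hx, Real.rpow_one]

theorem norm_circleKernel_le {ε δ θ : ℝ} (hε : 0 < ε) (hδ : 0 < δ) (h0 : 0 ≤ θ)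
    (h1 : θ ≤ 2 * Real.pi) (s : ℂ) :
    ‖circleKernel s δ ε θ‖ ≤ ε ^ s.re * (Real.exp (2 * Real.pi * |s.im|) * Real.exp (δ * ε)) := by
  have e : Complex.exp ((Real.log ε : ℂ) + θ * Complex.I) = ε * Complex.exp (θ * Complex.I) := by
    rw [Complex.exp_add, ← Complex.ofReal_exp, Real.exp_log hε]
  rw [circleKernel, e, norm_mul, Complex.norm_I, one_mul, norm_mul, Complex.norm_exp,
    Complex.norm_exp, Real.rpow_def_of_pos hε, ← mul_assoc (Real.exp _) (Real.exp _),
    ← Real.exp_add (Real.log ε * s.re)]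
  refine mul_le_mul (Real.exp_le_exp.2 ?_) (Real.exp_le_exp.2 ?_) (Real.exp_pos _).le
    (Real.exp_pos _).le
  · have : θ * -s.im ≤ 2 * Real.pi * |s.im| :=
      (mul_le_mul_of_nonneg_left (neg_le_abs s.im) h0).trans
        (mul_le_mul_of_nonneg_right h1 (abs_nonneg _))
    simp [Complex.mul_re, Complex.add_re, Complex.mul_im]
    linarith
  · rw [neg_mul, Complex.neg_re, Complex.re_ofReal_mul, Complex.re_ofReal_mul,
      Complex.exp_ofReal_mul_I_re]
    have := Real.neg_one_le_cos θ
    have h3 : 0 < δ * ε := mul_pos hδ hε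
    nlinarith

/-- The value is independent of the radius. Letting the radius tend to 0, the circle contributes
O(ε^{Re s}), which vanishes in the limit. -/
theorem integral_hankelWeight_of_re_pos {ε δ : ℝ} (hε : 0 < ε) (hδ : 0 < δ) {s : ℂ}
    (hs : 0 < s.re) :
    ∫ a, hankelWeight ε s a * Complex.exp (-(δ : ℂ) * hankelPoint ε a) =
      (Complex.exp (2 * Real.pi * Complex.I * s) - 1) * ∫ x in Set.Ioi 0, gammaKernel s δ x := by
  let e : ℕ → ℝ := fun n => ε / (n + 1)
  have he : ∀ n, 0 < e n := fun n => by positivity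
  have hle : ∀ n, e n ≤ ε := fun n => div_le_self hε.le (by linarith [n.cast_nonneg (α := ℝ)])
  have hanti : Antitone e := fun m n hmn => by
    simp only [e]; gcongr
  have hlim : Tendsto e atTop (𝓝 0) := by
    have := (tendsto_one_div_add_atTop_nhds_zero_nat (𝕜 := ℝ)).const_mul ε
    simpa [e, div_eq_mul_inv] using this
  have hU : ⋃ n, Set.Ioi (e n) = Set.Ioi 0 := by
    ext x
    simp only [Set.mem_iUnion, Set.mem_Ioi]
    refine ⟨fun ⟨n, hn⟩ => (he n).trans hn, fun hx => ?_⟩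
    exact ((hlim.eventually (gt_mem_nhds hx)).exists)
  have h1 : Tendsto (fun n => ∫ x in Set.Ioi (e n), gammaKernel s δ x) atTop
      (𝓝 (∫ x in Set.Ioi 0, gammaKernel s δ x)) := by
    rw [← hU]
    refine tendsto_setIntegral_of_monotone (fun n => measurableSet_Ioi)
      (fun m n hmn => Set.Ioi_subset_Ioi (hanti hmn)) ?_
    rw [hU]
    exact integrableOn_gammaKernel_zero hδ hs
  have h2 : Tendsto (fun n => ∫ θ in (0 : ℝ)..2 * Real.pi, circleKernel s δ (e n) θ) atTop
      (𝓝 0) := by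
    refine squeeze_zero_norm (a := fun n => (e n ^ s.re * (Real.exp (2 * Real.pi * |s.im|) *
      Real.exp (δ * e n))) * |2 * Real.pi - 0|) (fun n => ?_) ?_
    · refine intervalIntegral.norm_integral_le_of_norm_le_const fun θ hθ => ?_
      rw [Set.uIoc_of_le (by positivity)] at hθ
      exact norm_circleKernel_le (he n) hδ hθ.1.le hθ.2 s
    · have h3 : Tendsto (fun n => e n ^ s.re) atTop (𝓝 0) := by
        have := (Real.continuousAt_rpow_const 0 s.re (Or.inr hs.le)).tendsto.comp hlim
        rwa [Real.zero_rpow hs.ne'] at this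
      have h4 : Tendsto (fun n => Real.exp (δ * e n)) atTop (𝓝 (Real.exp (δ * 0))) :=
        (Real.continuous_exp.tendsto _).comp (hlim.const_mul δ)
      have := (h3.mul (h4.const_mul (Real.exp (2 * Real.pi * |s.im|)))).mul_const
        |2 * Real.pi - 0|
      simpa using this
  have h3 := (h1.const_mul (Complex.exp (2 * Real.pi * Complex.I * s) - 1)).add h2
  rw [add_zero] at h3
  refine tendsto_nhds_unique (tendsto_const_nhds.congr fun n => ?_) h3
  rw [integral_hankelWeight_radius (he n) (hle n) hδ, integral_hankelWeight (he n) hδ]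

/-- Hankel's formula for the Gamma function. -/
theorem integral_hankelWeight_eq {ε δ : ℝ} (hε : 0 < ε) (hδ : 0 < δ) {s : ℂ}
    (hs : ∀ n : ℤ, s ≠ n) :
    ∫ a, hankelWeight ε s a * Complex.exp (-(δ : ℂ) * hankelPoint ε a) =
      (Complex.exp (2 * Real.pi * Complex.I * s) - 1) * Complex.Gamma s *
        Complex.exp (-(s * (Real.log δ : ℂ))) := by
  have hδ' : (δ : ℂ) ≠ 0 := by exact_mod_cast hδ.ne'
  -- Starting from Re s > 0, the functional equation moves the formula one unit to the left at each
  -- step; s is not an integer, so the division by s is legitimate.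
  have key : ∀ (m : ℕ) (s : ℂ), (∀ n : ℤ, s ≠ n) → -(m : ℝ) < s.re →
      ∫ a, hankelWeight ε s a * Complex.exp (-(δ : ℂ) * hankelPoint ε a) =
      (Complex.exp (2 * Real.pi * Complex.I * s) - 1) * Complex.Gamma s *
        Complex.exp (-(s * (Real.log δ : ℂ))) := by
    intro m
    induction m with
    | zero =>
      intro s _ hs
      have hs' : 0 < s.re := by simpa using hs
      have e : (1 / (δ : ℂ)) ^ s = Complex.exp (-(s * (Real.log δ : ℂ))) := by
        rw [Complex.cpow_def_of_ne_zero (one_div_ne_zero hδ'), one_div, ← Complex.ofReal_inv,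
          ← Complex.ofReal_log (inv_pos.2 hδ).le, Real.log_inv]
        congr 1
        push_cast; ring
      rw [integral_hankelWeight_of_re_pos hε hδ hs',
        setIntegral_congr_fun measurableSet_Ioi fun x hx => gammaKernel_eq_cpow hx s δ,
        Complex.integral_cpow_mul_exp_neg_mul_Ioi hs' hδ, e]
      ring
    | succ m ih =>
      intro s hs hm
      have hs0 : s ≠ 0 := by simpa using hs 0
      have h := ih (s + 1) (fun n hn => hs (n - 1) (by push_cast; rw [← hn]; ring)) (by
        push_cast at hm; rw [Complex.add_re, Complex.one_re]; linarith)
      have h2 := integral_hankelWeight_succ hε hδ s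
      have h3 : Complex.exp (2 * Real.pi * Complex.I * (s + 1)) =
          Complex.exp (2 * Real.pi * Complex.I * s) := by
        rw [mul_add, mul_one, Complex.exp_add, Complex.exp_two_pi_mul_I, mul_one]
      have h4 : Complex.exp (-((s + 1) * (Real.log δ : ℂ))) =
          Complex.exp (-(s * (Real.log δ : ℂ))) / δ := by
        rw [add_mul, one_mul, neg_add, Complex.exp_add, Complex.exp_neg (Real.log δ : ℂ),
          ← Complex.ofReal_exp, Real.exp_log hδ, div_eq_mul_inv]
      rw [h, h3, h4, Complex.Gamma_add_one s hs0] at h2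
      apply mul_left_cancel₀ hs0
      rw [← h2]
      field_simp
  obtain ⟨m, hm⟩ := exists_nat_gt (-s.re)
  exact key m s hs (by linarith)

theorem hankelWeight_mul_pow (ε : ℝ) (s : ℂ) (l : ℕ) (a : ℝ) :
    hankelWeight ε s a * hankelPoint ε a ^ l = hankelWeight ε (s + l) a := by
  rw [hankelWeight, hankelWeight, hankelPoint, ← Complex.exp_nat_mul, mul_right_comm,
    ← Complex.exp_add]
  congr 2; ring

/-- Each factor x raises s by one, and the functional equation turns this into s (s + 1) ⋯. Using
powers of δx instead of x keeps the exponent of δ equal to -s for every l. -/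
theorem integral_hankelWeight_pow {ε δ : ℝ} (hε : 0 < ε) (hδ : 0 < δ) {s : ℂ}
    (hs : ∀ n : ℤ, s ≠ n) (l : ℕ) :
    ∫ a, hankelWeight ε s a *
        ((δ * hankelPoint ε a) ^ l * Complex.exp (-(δ : ℂ) * hankelPoint ε a)) =
      (Complex.exp (2 * Real.pi * Complex.I * s) - 1) * Complex.Gamma s *
        ((ascPochhammer ℂ l).eval s * Complex.exp (-(s * (Real.log δ : ℂ)))) := by
  have h1 : ∀ a, hankelWeight ε s a *
      ((δ * hankelPoint ε a) ^ l * Complex.exp (-(δ : ℂ) * hankelPoint ε a)) =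
      δ ^ l * (hankelWeight ε (s + l) a * Complex.exp (-(δ : ℂ) * hankelPoint ε a)) := fun a => by
    rw [← hankelWeight_mul_pow]; ring
  simp only [h1, integral_const_mul]
  have h2 : δ ^ l * ∫ a, hankelWeight ε (s + l) a * Complex.exp (-(δ : ℂ) * hankelPoint ε a) =
      (ascPochhammer ℂ l).eval s *
        ∫ a, hankelWeight ε s a * Complex.exp (-(δ : ℂ) * hankelPoint ε a) := by
    induction l with
    | zero => simp
    | succ l ih =>
      rw [pow_succ, mul_assoc, Nat.cast_succ, ← add_assoc, integral_hankelWeight_succ hε hδ,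
        ascPochhammer_succ_eval]
      linear_combination (s + l) * ih (fun a => by rw [← hankelWeight_mul_pow]; ring)
  rw [h2, integral_hankelWeight_eq hε hδ hs]
  ring

theorem integrable_hankelWeight_pow {ε δ : ℝ} (hε : 0 < ε) (hδ : 0 < δ) (s : ℂ) (l : ℕ) :
    Integrable fun a => hankelWeight ε s a *
      ((δ * hankelPoint ε a) ^ l * Complex.exp (-(δ : ℂ) * hankelPoint ε a)) := by
  refine ((integrable_hankelWeight hε hδ (s + l)).const_mul ((δ : ℂ) ^ l)).congr
    (Eventually.of_forall fun a => ?_)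
  simp only [← hankelWeight_mul_pow]; ring

/-! ### Domination on the product of Hankel contours -/

theorem hankelIntegrand_eq {r : ℕ} (ε : ℝ) (Φ : (Fin r → ℂ) → ℂ) (s : Fin r → ℂ) (a : Fin r → ℝ) :
    hankelIntegrand ε Φ s a =
      Φ (fun k => hankelPoint ε (a k)) * ∏ k, hankelWeight ε (s k) (a k) := rfl

/-- Every other summand of the tail is at least -ε, so y_j inherits the growth of its first variable
x_j. -/
theorem tailSum_re_ge {r : ℕ} {ε : ℝ} (hε : 0 ≤ ε) {x : Fin r → ℂ} (hx : ∀ k, -ε ≤ (x k).re)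
    (j : Fin r) : (x j).re + ε - r * ε ≤ (tailSum x j).re := by
  have h1 : ∑ k ∈ Finset.Ici j, ((x k).re + ε) = (tailSum x j).re + (Finset.Ici j).card * ε := by
    rw [Finset.sum_add_distrib, tailSum, Complex.re_sum, Finset.sum_const, nsmul_eq_mul]
  have h2 : (x j).re + ε ≤ ∑ k ∈ Finset.Ici j, ((x k).re + ε) :=
    Finset.single_le_sum (f := fun k => (x k).re + ε) (fun k _ => by linarith [hx k])
      (Finset.mem_Ici.2 le_rfl)
  have h3 : ((Finset.Ici j).card : ℝ) ≤ r := by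
    exact_mod_cast (Finset.card_le_univ _).trans (by simp)
  nlinarith

theorem abs_tailSum_im_le {r : ℕ} {ε : ℝ} (hε : 0 ≤ ε) {x : Fin r → ℂ} (hx : ∀ k, |(x k).im| ≤ ε)
    (j : Fin r) : |(tailSum x j).im| ≤ r * ε := by
  rw [tailSum, Complex.im_sum]
  refine (Finset.abs_sum_le_sum_abs _ _).trans ((Finset.sum_le_card_nsmul _ _ ε
    fun k _ => hx k).trans ?_)
  rw [nsmul_eq_mul]
  have h3 : ((Finset.Ici j).card : ℝ) ≤ r := by
    exact_mod_cast (Finset.card_le_univ _).trans (by simp)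
  gcongr

/-- The half-strip `Re y ≥ -b`, `|Im y| ≤ b`. -/
def halfStrip (b : ℝ) : Set ℂ := {y | -b ≤ y.re ∧ |y.im| ≤ b}

theorem tailSum_mem_halfStrip {r : ℕ} {ε : ℝ} (hε : 0 < ε) (a : Fin r → ℝ) (j : Fin r) :
    tailSum (fun k => hankelPoint ε (a k)) j ∈ halfStrip (r * ε) := by
  refine ⟨?_, abs_tailSum_im_le hε.le (fun k => abs_hankelPoint_im_le hε (a k)) j⟩
  have h1 := tailSum_re_ge hε.le (fun k => hankelPoint_re_ge hε (a k)) j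
  have h2 := hankelPoint_re_ge hε (a j)
  linarith

theorem measurable_tailSum {r : ℕ} (ε : ℝ) (j : Fin r) :
    Measurable fun a : Fin r → ℝ => tailSum (fun k => hankelPoint ε (a k)) j := by
  unfold tailSum
  exact Finset.measurable_sum _ fun k _ => (measurable_hankelPoint ε).comp (measurable_pi_apply k)

theorem measurable_prod_hankelWeight {r : ℕ} (ε : ℝ) (s : Fin r → ℂ) :
    Measurable fun a : Fin r → ℝ => ∏ k, hankelWeight ε (s k) (a k) :=
  Finset.measurable_prod _ fun k _ => (measurable_hankelWeight ε (s k)).comp (measurable_pi_apply k)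

/-- An integrable majorant on the product of Hankel contours. -/
def hankelMajorant {r : ℕ} (ε δ : ℝ) (s : Fin r → ℂ) (a : Fin r → ℝ) : ℝ :=
  ∏ k, (‖hankelWeight ε (s k) (a k)‖ * Real.exp (-δ * (hankelPoint ε (a k)).re))

theorem integrable_hankelMajorant {r : ℕ} {ε δ : ℝ} (hε : 0 < ε) (hδ : 0 < δ) (s : Fin r → ℂ) :
    Integrable (hankelMajorant ε δ s) := by
  refine Integrable.fintype_prod (f := fun k a => ‖hankelWeight ε (s k) a‖ *
    Real.exp (-δ * (hankelPoint ε a).re)) fun k => ?_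
  refine (integrable_hankelWeight hε hδ (s k)).norm.congr (Eventually.of_forall fun a => ?_)
  simp only [norm_mul, Complex.norm_exp]
  rw [← Complex.ofReal_neg, Complex.re_ofReal_mul]

/-- The decay of the j-th factor in y_j dominates a decay in x_j, up to a constant. The r factors
therefore supply one decaying exponential for each of the r variables. -/
theorem norm_prod_le_hankelMajorant {r : ℕ} {ε δ : ℝ} (hε : 0 < ε) (hδ : 0 < δ) (s : Fin r → ℂ)
    (a : Fin r → ℝ) (C : Fin r → ℝ) (φ : Fin r → ℂ)
    (h : ∀ j, ‖φ j‖ ≤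
      C j * Real.exp (-δ * (tailSum (fun k => hankelPoint ε (a k)) j).re)) :
    ‖(∏ j, φ j) * ∏ k, hankelWeight ε (s k) (a k)‖ ≤
      (∏ j, C j) * (Real.exp (δ * (r * ε)) ^ r * hankelMajorant ε δ s a) := by
  have h1 : ∀ j, ‖φ j‖ ≤ C j * (Real.exp (δ * (r * ε)) *
      Real.exp (-δ * (hankelPoint ε (a j)).re)) := fun j => by
    refine (h j).trans ?_
    have hC : 0 ≤ C j := by
      have := (norm_nonneg _).trans (h j)
      exact nonneg_of_mul_nonneg_left this (Real.exp_pos _)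
    rw [← Real.exp_add]
    have h1 := tailSum_re_ge hε.le (fun k => hankelPoint_re_ge hε (a k)) j
    gcongr
    nlinarith
  rw [norm_mul, norm_prod, norm_prod]
  refine (mul_le_mul_of_nonneg_right (Finset.prod_le_prod (fun _ _ => norm_nonneg _)
    fun j _ => h1 j) (Finset.prod_nonneg fun _ _ => norm_nonneg _)).trans_eq ?_
  rw [hankelMajorant, Finset.prod_mul_distrib, Finset.prod_mul_distrib, Finset.prod_mul_distrib,
    Finset.prod_const, Finset.card_univ, Fintype.card_fin]
  ring

theorem norm_hankelIntegrand_le {r : ℕ} {ε δ C : ℝ} (hε : 0 < ε) (hδ : 0 < δ) (s : Fin r → ℂ)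
    (φ : ℂ → ℂ) (h : ∀ y ∈ halfStrip (r * ε), ‖φ y‖ ≤ C * Real.exp (-δ * y.re)) (a : Fin r → ℝ) :
    ‖hankelIntegrand ε (fun x => ∏ j, φ (tailSum x j)) s a‖ ≤
      C ^ r * (Real.exp (δ * (r * ε)) ^ r * hankelMajorant ε δ s a) := by
  rw [hankelIntegrand_eq]
  refine (norm_prod_le_hankelMajorant hε hδ s a (fun _ => C) _
    fun j => h _ (tailSum_mem_halfStrip hε a j)).trans_eq ?_
  simp

theorem measurable_hankelIntegrand {r : ℕ} (ε : ℝ) (s : Fin r → ℂ) {φ : ℂ → ℂ}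
    (hφ : Measurable φ) :
    Measurable (hankelIntegrand ε (fun x : Fin r → ℂ => ∏ j, φ (tailSum x j)) s) :=
  (Finset.measurable_prod _ fun j _ => hφ.comp (measurable_tailSum ε j)).mul
    (measurable_prod_hankelWeight ε s)

theorem integrable_hankelIntegrand {r : ℕ} {ε δ C : ℝ} (hε : 0 < ε) (hδ : 0 < δ) (s : Fin r → ℂ)
    {φ : ℂ → ℂ} (hφ : Measurable φ)
    (h : ∀ y ∈ halfStrip (r * ε), ‖φ y‖ ≤ C * Real.exp (-δ * y.re)) :
    Integrable (hankelIntegrand ε (fun x : Fin r → ℂ => ∏ j, φ (tailSum x j)) s) :=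
  (((integrable_hankelMajorant hε hδ s).const_mul _).const_mul _).mono'
    (measurable_hankelIntegrand ε s hφ).aestronglyMeasurable
    (Eventually.of_forall (norm_hankelIntegrand_le hε hδ s φ h))

/-- On a half-strip |y| exceeds Re y by a bounded amount only, so a linear factor in y can be
absorbed at the price of an arbitrarily small exponential rate. -/
theorem exists_add_norm_le_exp (A b : ℝ) {κ : ℝ} (hκ : 0 < κ) :
    ∃ C, 0 < C ∧ ∀ y ∈ halfStrip b, A + ‖y‖ ≤ C * Real.exp (κ * y.re) := by
  refine ⟨1 / κ + (|A| + 3 * |b|) * Real.exp (κ * |b|), by positivity, fun y hy => ?_⟩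
  have h1 : ‖y‖ ≤ y.re + 3 * |b| := by
    have h2 := Complex.norm_le_abs_re_add_abs_im y
    have h3 : |y.re| ≤ y.re + 2 * |b| := by
      have := hy.1; have := le_abs_self b; have := abs_nonneg b
      rw [abs_le]; constructor <;> linarith
    have := hy.2; have := le_abs_self b
    linarith
  have h2 : y.re ≤ 1 / κ * Real.exp (κ * y.re) := by
    have := Real.add_one_le_exp (κ * y.re)
    rw [div_mul_eq_mul_div, one_mul, le_div_iff₀ hκ]; linarith
  have h3 : 1 ≤ Real.exp (κ * |b|) * Real.exp (κ * y.re) := by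
    rw [← Real.exp_add]
    refine Real.one_le_exp ?_
    have := hy.1; have := le_abs_self b
    rw [← mul_add]; exact mul_nonneg hκ.le (by linarith)
  have h4 : (|A| + 3 * |b|) * 1 ≤ (|A| + 3 * |b|) * (Real.exp (κ * |b|) * Real.exp (κ * y.re)) :=
    mul_le_mul_of_nonneg_left h3 (by positivity)
  have := le_abs_self A
  linarith

/-! ### Expansion of the kernel -/

/-- `1 / (e^{y - L} - 1) + (λ - y) e^{y - L} / (e^{y - L} - 1)²`. -/
def kernelFactor (lam L y : ℂ) : ℂ :=
  1 / (Complex.exp (y - L) - 1) +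
    (lam - y) * Complex.exp (y - L) / (Complex.exp (y - L) - 1) ^ 2

/-- The `n`-th term of the expansion of `kernelFactor` into powers of `e^{L - y}`. -/
def kernelTerm (lam L y : ℂ) (n : ℕ) : ℂ :=
  (1 + (n : ℂ) * (lam - y)) * Complex.exp (n * (L - y))

/-- With q = e^{L - y} of modulus less than 1, these are the series Σ q^n = q/(1-q) and Σ n q^n =
q/(1-q)^2, over n ≥ 1. -/
theorem hasSum_kernelTerm {lam L y : ℂ} (h : L.re < y.re) :
    HasSum (fun n : ℕ => kernelTerm lam L y (n + 1)) (kernelFactor lam L y) := by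
  set q := Complex.exp (L - y) with hq
  have hq1 : ‖q‖ < 1 := by
    rw [hq, Complex.norm_exp, Real.exp_lt_one_iff, Complex.sub_re]; linarith
  have hq0 : q ≠ 0 := Complex.exp_ne_zero _
  have hqi : Complex.exp (y - L) = q⁻¹ := by rw [hq, ← Complex.exp_neg, neg_sub]
  have hne : 1 - q ≠ 0 := fun h0 => by
    rw [sub_eq_zero] at h0; rw [← h0, norm_one] at hq1; exact lt_irrefl _ hq1
  have h1 := (hasSum_geometric_of_norm_lt_one hq1).mul_right q
  have h2 := (hasSum_nat_add_iff' (f := fun n : ℕ => (n : ℂ) * q ^ n) 1).2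
    (hasSum_coe_mul_geometric_of_norm_lt_one hq1)
  have h3 := h1.add (h2.mul_left (lam - y))
  have e : kernelFactor lam L y =
      (1 - q)⁻¹ * q + (lam - y) * (q / (1 - q) ^ 2 - ∑ i ∈ Finset.range 1, (i : ℂ) * q ^ i) := by
    rw [kernelFactor, hqi]
    have : q⁻¹ - 1 = (1 - q) / q := by field_simp
    rw [this]
    simp
    field_simp
  rw [e]
  refine hasSum_of_eq h3 fun n => ?_
  rw [kernelTerm, hq, Complex.exp_nat_mul, ← hq, pow_succ]
  push_cast
  ring

theorem summable_norm_kernelTerm {lam L y : ℂ} (h : L.re < y.re) :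
    Summable fun n : ℕ => ‖kernelTerm lam L y (n + 1)‖ :=
  (hasSum_kernelTerm h).summable.norm

theorem prod_kernelTerm {r : ℕ} [NeZero r] (N : LiIndex r) (lam L : ℂ) (x : Fin r → ℂ) :
    ∏ j, kernelTerm lam L (tailSum x j) (gap N.1 j) =
      Complex.exp L ^ (N.1 (lastIdx r)) *
        (MvPolynomial.eval (fun k => (N.1 k : ℂ) * x k) (gapPoly N.1 lam) *
          ∏ k, Complex.exp (-(N.1 k : ℂ) * x k)) := by
  have h0 : ∀ k, (N.1 k : ℂ) ≠ 0 := fun k => by exact_mod_cast (N.2.2 k).ne'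
  have h1 : MvPolynomial.eval (fun k => (N.1 k : ℂ) * x k) (gapPoly N.1 lam) =
      ∏ j, (1 + (gap N.1 j : ℂ) * (lam - tailSum x j)) := by
    rw [gapPoly, map_prod]
    refine Finset.prod_congr rfl fun j _ => ?_
    have h2 : ∀ k, (N.1 k : ℂ) * x k * (1 / (N.1 k : ℂ)) = x k := fun k => by
      have := h0 k; field_simp
    simp only [map_sub, map_add, map_one, map_mul, map_sum, MvPolynomial.eval_C,
      MvPolynomial.eval_X, h2]
    rw [tailSum]; ring
  have h2 : ∏ j, Complex.exp ((gap N.1 j : ℂ) * (L - tailSum x j)) =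
      Complex.exp L ^ (N.1 (lastIdx r)) * ∏ k, Complex.exp (-(N.1 k : ℂ) * x k) := by
    rw [← Complex.exp_sum, ← Complex.exp_sum, ← Complex.exp_nat_mul, ← Complex.exp_add]
    congr 1
    simp only [mul_sub, Finset.sum_sub_distrib, neg_mul, Finset.sum_neg_distrib]
    rw [← Finset.sum_mul, sum_gap_eq, sum_gap_mul_tailSum]
    ring
  simp only [kernelTerm]
  rw [Finset.prod_mul_distrib, h1, h2]
  ring

/-! ### Termwise integration of the expansion -/

/-- `∏ (e^{2πi s_k} - 1) Γ(s_k)`. -/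
def hankelGamma {r : ℕ} (s : Fin r → ℂ) : ℂ :=
  ∏ k, ((Complex.exp (2 * Real.pi * Complex.I * s k) - 1) * Complex.Gamma (s k))

theorem gammaFactor_mul_hankelGamma {r : ℕ} {s : Fin r → ℂ} (hs : NonInteger s) :
    gammaFactor s * hankelGamma s = 1 := by
  rw [gammaFactor, hankelGamma, ← Finset.prod_mul_distrib]
  refine Finset.prod_eq_one fun k _ => ?_
  have h1 : Complex.exp (2 * Real.pi * Complex.I * s k) - 1 ≠ 0 := fun h => by
    rw [sub_eq_zero, Complex.exp_eq_one_iff] at h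
    obtain ⟨n, hn⟩ := h
    refine hs k n ?_
    have : (2 * Real.pi * Complex.I : ℂ) ≠ 0 := by
      simp [Real.pi_ne_zero]
    apply mul_left_cancel₀ this
    rw [hn, mul_comm]
  have h2 : Complex.Gamma (s k) ≠ 0 := Complex.Gamma_ne_zero fun m h => hs k (-m) (by simpa using h)
  field_simp

/-- By linearity only monomials matter, and for these the integral is a product of one-variable
Hankel integrals. The contour integral thus realises the functional `riseFun`. -/
theorem integral_eval_mul_exp {r : ℕ} {ε : ℝ} (hε : 0 < ε) (N : LiIndex r) {s : Fin r → ℂ}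
    (hs : NonInteger s) (Q : MvPolynomial (Fin r) ℂ) :
    Integrable (hankelIntegrand ε (fun x => MvPolynomial.eval (fun k => (N.1 k : ℂ) * x k) Q *
        ∏ k, Complex.exp (-(N.1 k : ℂ) * x k)) s) ∧
      hankelIntegral ε (fun x => MvPolynomial.eval (fun k => (N.1 k : ℂ) * x k) Q *
        ∏ k, Complex.exp (-(N.1 k : ℂ) * x k)) s = hankelGamma s * (riseFun s Q * negPow N.1 s) := by
  have hN : ∀ k, (0 : ℝ) < N.1 k := fun k => by exact_mod_cast N.2.2 k
  induction Q using MvPolynomial.induction_on' with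
  | add p q hp hq =>
    have e : hankelIntegrand ε (fun x => MvPolynomial.eval (fun k => (N.1 k : ℂ) * x k) (p + q) *
        ∏ k, Complex.exp (-(N.1 k : ℂ) * x k)) s =
        hankelIntegrand ε (fun x => MvPolynomial.eval (fun k => (N.1 k : ℂ) * x k) p *
          ∏ k, Complex.exp (-(N.1 k : ℂ) * x k)) s +
        hankelIntegrand ε (fun x => MvPolynomial.eval (fun k => (N.1 k : ℂ) * x k) q *
          ∏ k, Complex.exp (-(N.1 k : ℂ) * x k)) s := by
      ext a; simp only [hankelIntegrand_eq, map_add, Pi.add_apply]; ring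
    refine ⟨e ▸ hp.1.add hq.1, ?_⟩
    rw [hankelIntegral, e]
    refine (integral_add hp.1 hq.1).trans ?_
    have h1 := hp.2
    have h2 := hq.2
    rw [hankelIntegral] at h1 h2
    rw [h1, h2, map_add]
    ring
  | monomial l c =>
    have e : hankelIntegrand ε (fun x => MvPolynomial.eval (fun k => (N.1 k : ℂ) * x k)
        (MvPolynomial.monomial l c) * ∏ k, Complex.exp (-(N.1 k : ℂ) * x k)) s =
        fun a => c * ∏ k, (hankelWeight ε (s k) (a k) * (((N.1 k : ℝ) * hankelPoint ε (a k)) ^ (l k) *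
          Complex.exp (-((N.1 k : ℝ) : ℂ) * hankelPoint ε (a k)))) := by
      ext a
      rw [hankelIntegrand_eq, MvPolynomial.eval_monomial, Finsupp.prod_fintype _ _ (by simp)]
      simp only [Finset.prod_mul_distrib, Complex.ofReal_natCast]
      ring
    refine ⟨e ▸ (Integrable.fintype_prod (f := fun k a => hankelWeight ε (s k) a *
      (((N.1 k : ℝ) * hankelPoint ε a) ^ (l k) *
        Complex.exp (-((N.1 k : ℝ) : ℂ) * hankelPoint ε a)))
      fun k => integrable_hankelWeight_pow hε (hN k) (s k) (l k)).const_mul c, ?_⟩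
    rw [hankelIntegral, e, integral_const_mul, integral_fintype_prod_volume_eq_prod
      (fun k a => hankelWeight ε (s k) a * (((N.1 k : ℝ) * hankelPoint ε a) ^ (l k) *
          Complex.exp (-((N.1 k : ℝ) : ℂ) * hankelPoint ε a)))]
    simp only [fun k => integral_hankelWeight_pow hε (hN k) (hs k) (l k)]
    rw [riseFun_monomial, hankelGamma, negPow, ← Finset.sum_neg_distrib, Complex.exp_sum]
    simp only [Finset.prod_mul_distrib]
    ring

/-- Since n ≥ 1 and Re y + b ≥ 0, one copy of e^{-(Re y + b)} is kept for integrability in y; the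
remaining geometric factor in n makes the series summable once Re L + b < 0. -/
theorem norm_kernelTerm_le {lam L y : ℂ} {b : ℝ} (hy : -b ≤ y.re) {n : ℕ} (hn : 0 < n) :
    ‖kernelTerm lam L y n‖ ≤ ((n : ℝ) * Real.exp (L.re + b) ^ n) *
      ((1 + ‖lam‖ + ‖y‖) * (Real.exp (-b) * Real.exp (-y.re))) := by
  have hn1 : (1 : ℝ) ≤ n := by exact_mod_cast hn
  have h1 : ‖1 + (n : ℂ) * (lam - y)‖ ≤ n * (1 + ‖lam‖ + ‖y‖) := by
    refine (norm_add_le _ _).trans ?_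
    rw [norm_one, norm_mul, Complex.norm_natCast]
    have := norm_sub_le lam y
    nlinarith [norm_nonneg lam, norm_nonneg y]
  have h2 : ‖Complex.exp (n * (L - y))‖ ≤
      Real.exp (L.re + b) ^ n * (Real.exp (-b) * Real.exp (-y.re)) := by
    rw [Complex.norm_exp, ← Real.exp_nat_mul, ← Real.exp_add, ← Real.exp_add, Real.exp_le_exp,
      ← Complex.ofReal_natCast, Complex.re_ofReal_mul, Complex.sub_re]
    nlinarith
  rw [kernelTerm, norm_mul]
  calc _ ≤ (n * (1 + ‖lam‖ + ‖y‖)) *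
        (Real.exp (L.re + b) ^ n * (Real.exp (-b) * Real.exp (-y.re))) := by gcongr
    _ = _ := by ring

/-- The combination of polylogarithms that represents the zeta functions. -/
def zetaSum (r : ℕ) [NeZero r] (lam z : ℂ) (s : Fin r → ℂ) : ℂ :=
  ∑ q ∈ Finset.range (r + 1), ((-lam) ^ q / (q.factorial : ℂ)) * polyLi (genPolyDeriv r q) s s z

theorem hasSum_zetaSum {r : ℕ} [NeZero r] (lam : ℂ) {z : ℂ} (hz : ‖z‖ < 1) (s : Fin r → ℂ) :
    HasSum (fun N : LiIndex r => liTermC s z N * riseFun s (gapPoly N.1 lam))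
      (zetaSum r lam z s) := by
  have h := hasSum_sum fun q (_ : q ∈ Finset.range (r + 1)) =>
    (hasSum_polyLi (genPolyDeriv r q) s s hz).mul_left ((-lam) ^ q / (q.factorial : ℂ))
  refine hasSum_of_eq h fun N => ?_
  rw [gapPoly_eq_sum, map_sum, Finset.mul_sum]
  refine Finset.sum_congr rfl fun q _ => ?_
  rw [map_smul, smul_eq_mul]
  ring

/-- The bound on r ε puts all y_j in the region of convergence of the expansion. The majorant
factors into a summable part and an integrable part, so sum and integral may be exchanged. -/
theorem hankelIntegral_kernelFactor {r : ℕ} [NeZero r] {ε : ℝ} (hε : 0 < ε) (lam : ℂ) {L : ℂ}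
    (hL : r * ε < -L.re) {s : Fin r → ℂ} (hs : NonInteger s) :
    hankelIntegral ε (fun x => ∏ j, kernelFactor lam L (tailSum x j)) s =
      hankelGamma s * zetaSum r lam (Complex.exp L) s := by
  set b : ℝ := r * ε with hb
  have hb0 : 0 ≤ b := by positivity
  have hz : ‖Complex.exp L‖ < 1 := by
    rw [Complex.norm_exp, Real.exp_lt_one_iff]; linarith
  let T : (Fin r → ℕ) → (Fin r → ℂ) → ℂ := fun m x =>
    ∏ j, kernelTerm lam L (tailSum x j) (m j + 1)
  have hT : ∀ m, T m = fun x => Complex.exp L ^ ((ofGaps m).1 (lastIdx r)) *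
        (MvPolynomial.eval (fun k => ((ofGaps m).1 k : ℂ) * x k) (gapPoly (ofGaps m).1 lam) *
          ∏ k, Complex.exp (-((ofGaps m).1 k : ℂ) * x k)) := fun m => by
    ext x
    rw [← prod_kernelTerm]
    simp only [T, gap_ofGaps]
  have hTI : ∀ m, hankelIntegrand ε (T m) s = fun a => Complex.exp L ^ ((ofGaps m).1 (lastIdx r)) *
      hankelIntegrand ε (fun x => MvPolynomial.eval (fun k => ((ofGaps m).1 k : ℂ) * x k)
        (gapPoly (ofGaps m).1 lam) * ∏ k, Complex.exp (-((ofGaps m).1 k : ℂ) * x k)) s a := fun m => by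
    ext a; rw [hT]; simp only [hankelIntegrand_eq]; ring
  have hint : ∀ m, Integrable (hankelIntegrand ε (T m) s) := fun m => by
    rw [hTI]; exact ((integral_eval_mul_exp hε (ofGaps m) hs _).1).const_mul _
  have hval : ∀ m, ∫ a, hankelIntegrand ε (T m) s a =
      hankelGamma s * (liTermC s (Complex.exp L) (ofGaps m) *
        riseFun s (gapPoly (ofGaps m).1 lam)) := fun m => by
    rw [hTI, integral_const_mul]
    have := (integral_eval_mul_exp hε (ofGaps m) hs (gapPoly (ofGaps m).1 lam)).2
    rw [hankelIntegral] at this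
    rw [this, liTermC]
    ring
  -- Half of the decay e^{-Re y} absorbs the linear factor in y; the other half is the rate 1/2 of
  -- the majorant.
  obtain ⟨C, hC0, hC⟩ := exists_add_norm_le_exp (1 + ‖lam‖) b (κ := 1 / 2) (by norm_num)
  let g : ℕ → ℝ := fun n => ((n + 1 : ℕ) : ℝ) * Real.exp (L.re + b) ^ (n + 1)
  have hg0 : ∀ n, 0 ≤ g n := fun n => by positivity
  have hg : Summable g := by
    have hlt : ‖Real.exp (L.re + b)‖ < 1 := by
      rw [Real.norm_of_nonneg (Real.exp_pos _).le, Real.exp_lt_one_iff]; linarith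
    have := summable_pow_mul_geometric_of_norm_lt_one 1 hlt
    simpa [g] using (summable_nat_add_iff 1).2 this
  have hbound : ∀ m a, ‖hankelIntegrand ε (T m) s a‖ ≤ (∏ j, g (m j)) *
      ((C * Real.exp (-b)) ^ r * (Real.exp (1 / 2 * (r * ε)) ^ r *
        hankelMajorant ε (1 / 2) s a)) := fun m a => by
    rw [hankelIntegrand_eq]
    refine (norm_prod_le_hankelMajorant hε (δ := 1 / 2) (by norm_num) s a
      (fun j => g (m j) * (C * Real.exp (-b))) _ fun j => ?_).trans_eq ?_
    · have hy := tailSum_mem_halfStrip hε a j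
      refine (norm_kernelTerm_le hy.1 (Nat.succ_pos _)).trans ?_
      rw [mul_assoc (g (m j))]
      refine mul_le_mul_of_nonneg_left ?_ (hg0 _)
      have e : ∀ t : ℝ, C * Real.exp (-b) * Real.exp (-(1 / 2) * t) =
          C * Real.exp (1 / 2 * t) * (Real.exp (-b) * Real.exp (-t)) := fun t => by
        have : Real.exp (-(1 / 2) * t) = Real.exp (1 / 2 * t) * Real.exp (-t) := by
          rw [← Real.exp_add]; congr 1; ring
        rw [this]; ring
      rw [e]
      exact mul_le_mul_of_nonneg_right (hC _ hy) (by positivity)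
    · rw [Finset.prod_mul_distrib, Finset.prod_const, Finset.card_univ, Fintype.card_fin]
      ring
  have hmaj := (integrable_hankelMajorant hε (δ := 1 / 2) (by norm_num) s).const_mul
    (Real.exp (1 / 2 * (r * ε)) ^ r) |>.const_mul ((C * Real.exp (-b)) ^ r)
  have hsum : Summable fun m => ∫ a, ‖hankelIntegrand ε (T m) s a‖ := by
    refine Summable.of_nonneg_of_le (fun m => integral_nonneg fun a => norm_nonneg _) (fun m => ?_)
      ((summable_prod_pi g hg0 hg).mul_right (∫ a, (C * Real.exp (-b)) ^ r *
        (Real.exp (1 / 2 * (r * ε)) ^ r * hankelMajorant ε (1 / 2) s a)))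
    rw [← integral_const_mul]
    exact integral_mono (hint m).norm (hmaj.const_mul _) fun a => hbound m a
  have hpt : ∀ a, ∑' m, hankelIntegrand ε (T m) s a =
      hankelIntegrand ε (fun x => ∏ j, kernelFactor lam L (tailSum x j)) s a := fun a => by
    have hre : ∀ j, L.re < (tailSum (fun k => hankelPoint ε (a k)) j).re := fun j => by
      have := (tailSum_mem_halfStrip hε a j).1; linarith
    have := (hasSum_prod_pi (fun j n => kernelTerm lam L
      (tailSum (fun k => hankelPoint ε (a k)) j) (n + 1))
      fun j => summable_norm_kernelTerm (hre j)).2.mul_right (∏ k, hankelWeight ε (s k) (a k))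
    simp only [fun j => (hasSum_kernelTerm (lam := lam) (hre j)).tsum_eq] at this
    exact this.tsum_eq
  have hmain := hasSum_integral_of_summable_integral_norm hint hsum
  simp only [hpt, hval] at hmain
  refine hmain.unique ?_
  exact (gapEquiv r).hasSum_iff.2 ((hasSum_zetaSum lam hz s).mul_left (hankelGamma s))

/-! ### Holomorphic dependence of integrals on a parameter -/

/-- No bound on the derivative is assumed: Cauchy's estimate on discs of radius R/2 supplies it.
Measurability of the derivative comes from writing it as a limit of difference quotients along a
sequence. -/
theorem differentiableAt_integral_of_dominated {α : Type*} [MeasurableSpace α] {μ : Measure α}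
    {F : ℂ → α → ℂ} {z₀ : ℂ} {R : ℝ} (hR : 0 < R) {bound : α → ℝ}
    (hmeas : ∀ z ∈ Metric.ball z₀ R, AEStronglyMeasurable (F z) μ)
    (hbound : ∀ a, ∀ z ∈ Metric.ball z₀ R, ‖F z a‖ ≤ bound a) (hint : Integrable bound μ)
    (hdiff : ∀ a, DifferentiableOn ℂ (fun z => F z a) (Metric.ball z₀ R)) :
    DifferentiableAt ℂ (fun z => ∫ a, F z a ∂μ) z₀ := by
  have hz₀ : z₀ ∈ Metric.ball z₀ R := Metric.mem_ball_self hR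
  have hd : ∀ a, ∀ z ∈ Metric.ball z₀ R, HasDerivAt (fun z => F z a) (deriv (fun z => F z a) z) z :=
    fun a z hz => ((hdiff a).differentiableAt (Metric.isOpen_ball.mem_nhds hz)).hasDerivAt
  refine (hasDerivAt_integral_of_dominated_loc_of_deriv_le
    (F' := fun z a => deriv (fun z => F z a) z) (bound := fun a => bound a / (R / 2))
    (Metric.ball_mem_nhds z₀ (half_pos hR)) ?_ (hint.mono' (hmeas _ hz₀) ?_) ?_ ?_
    (hint.div_const _) ?_).2.differentiableAt
  · filter_upwards [Metric.ball_mem_nhds z₀ hR] with z hz using hmeas z hz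
  · exact Eventually.of_forall fun a => hbound a _ hz₀
  · let h : ℕ → ℂ := fun n => ((R / 2 / (n + 1) : ℝ) : ℂ)
    have hpos : ∀ n : ℕ, 0 < R / 2 / (n + 1) := fun n => by positivity
    have hmem : ∀ n, z₀ + h n ∈ Metric.ball z₀ R := fun n => by
      rw [Metric.mem_ball, dist_eq_norm, add_sub_cancel_left, Complex.norm_real,
        Real.norm_of_nonneg (hpos n).le]
      have : R / 2 / (n + 1) ≤ R / 2 :=
        div_le_self (by positivity) (by linarith [n.cast_nonneg (α := ℝ)])
      linarith
    have hlim : Tendsto h atTop (𝓝[≠] 0) := by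
      refine tendsto_nhdsWithin_iff.2 ⟨?_, Eventually.of_forall fun n => ?_⟩
      · have := (tendsto_one_div_add_atTop_nhds_zero_nat (𝕜 := ℝ)).const_mul (R / 2)
        rw [mul_zero] at this
        have h2 := (Complex.continuous_ofReal.tendsto 0).comp this
        rw [Complex.ofReal_zero] at h2
        refine h2.congr fun n => ?_
        simp only [h, Function.comp_apply]
        congr 1; ring
      · simp only [h, Set.mem_compl_iff, Set.mem_singleton_iff, Complex.ofReal_eq_zero]
        exact (hpos n).ne'
    refine aestronglyMeasurable_of_tendsto_ae atTop
      (f := fun n a => (h n)⁻¹ • (F (z₀ + h n) a - F z₀ a))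
      (fun n => ((hmeas _ (hmem n)).sub (hmeas _ hz₀)).const_smul (h n)⁻¹)
      (Eventually.of_forall fun a => ?_)
    exact (hasDerivAt_iff_tendsto_slope_zero.1 (hd a z₀ hz₀)).comp hlim
  · refine Eventually.of_forall fun a z hz => ?_
    have hsub : Metric.closedBall z (R / 2) ⊆ Metric.ball z₀ R := fun w hw => by
      rw [Metric.mem_closedBall] at hw
      rw [Metric.mem_ball] at hz ⊢
      linarith [dist_triangle w z z₀]
    exact Complex.norm_deriv_le_of_forall_mem_sphere_norm_le (half_pos hR)
      ((hdiff a).diffContOnCl_ball hsub)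
      fun w hw => hbound a w (hsub (Metric.sphere_subset_closedBall hw))
  · exact Eventually.of_forall fun a z hz =>
      hd a z (Metric.ball_subset_ball (by linarith) hz)

/-! ### The kernel of the one-parameter zeta function -/

/-- The derivative of `w / (e^w - 1)`. -/
def bernoulliDeriv : ℂ → ℂ := deriv fun w => (dslope Complex.exp 0 w)⁻¹

theorem isOpen_strip (b : ℝ) : IsOpen {w : ℂ | |w.im| < b} :=
  isOpen_lt (continuous_abs.comp Complex.continuous_im) continuous_const

theorem exp_ne_one_of_strip {w : ℂ} (hw : |w.im| < 2 * Real.pi) (h0 : w ≠ 0) :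
    Complex.exp w ≠ 1 := fun h => by
  obtain ⟨n, hn⟩ := Complex.exp_eq_one_iff.1 h
  have him : w.im = n * (2 * Real.pi) := by rw [hn]; simp
  rw [him, abs_mul, abs_of_pos Real.two_pi_pos] at hw
  have h1 : |(n : ℝ)| < 1 := by
    by_contra hc
    exact absurd hw (not_lt.2 (le_mul_of_one_le_left Real.two_pi_pos.le (not_lt.1 hc)))
  have h2 : n = 0 := by
    rw [← Int.cast_abs] at h1
    have : |n| < 1 := by exact_mod_cast h1
    exact Int.abs_lt_one_iff.1 this
  exact h0 (by rw [hn, h2]; simp)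

theorem dslope_exp_of_ne {w : ℂ} (h0 : w ≠ 0) :
    dslope Complex.exp 0 w = (Complex.exp w - 1) / w := by
  rw [dslope_of_ne _ h0, slope_def_field, Complex.exp_zero, sub_zero]

theorem dslope_exp_ne_zero {w : ℂ} (hw : |w.im| < 2 * Real.pi) : dslope Complex.exp 0 w ≠ 0 := by
  by_cases h0 : w = 0
  · rw [h0, dslope_same, Complex.deriv_exp, Complex.exp_zero]; exact one_ne_zero
  · rw [dslope_exp_of_ne h0]
    exact div_ne_zero (sub_ne_zero.2 (exp_ne_one_of_strip hw h0)) h0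

/-- The nonzero zeros of e^w - 1 lie outside the strip |Im w| < 2π, and `dslope` fills in the
quotient (e^w - 1)/w at w = 0 by its limit 1. -/
theorem differentiableOn_bernoulliDeriv :
    DifferentiableOn ℂ bernoulliDeriv {w : ℂ | |w.im| < 2 * Real.pi} := by
  have h1 : Differentiable ℂ (dslope Complex.exp 0) := by
    rw [← differentiableOn_univ, Complex.differentiableOn_dslope univ_mem]
    exact Complex.differentiable_exp.differentiableOn
  refine DifferentiableOn.deriv ?_ (isOpen_strip _)
  exact h1.differentiableOn.inv fun w hw => dslope_exp_ne_zero hw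

theorem bernoulliDeriv_eq {w : ℂ} (hw : |w.im| < 2 * Real.pi) (h0 : w ≠ 0) :
    bernoulliDeriv w =
      1 / (Complex.exp w - 1) + -w * Complex.exp w / (Complex.exp w - 1) ^ 2 := by
  have hne : Complex.exp w - 1 ≠ 0 := sub_ne_zero.2 (exp_ne_one_of_strip hw h0)
  have he : (fun w => (dslope Complex.exp 0 w)⁻¹) =ᶠ[𝓝 w] fun w => w / (Complex.exp w - 1) := by
    filter_upwards [isOpen_ne.mem_nhds h0] with u hu
    rw [dslope_exp_of_ne hu, inv_div]
  have hd : HasDerivAt (fun w => w / (Complex.exp w - 1))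
      ((1 * (Complex.exp w - 1) - w * Complex.exp w) / (Complex.exp w - 1) ^ 2) w :=
    (hasDerivAt_id w).div ((Complex.hasDerivAt_exp w).sub_const 1) hne
  rw [bernoulliDeriv, he.deriv_eq, hd.deriv]
  field_simp
  ring

theorem kernelFactor_eq_bernoulliDeriv {L y : ℂ} (hw : |(y - L).im| < 2 * Real.pi) (h0 : y ≠ L) :
    kernelFactor L L y = bernoulliDeriv (y - L) := by
  rw [bernoulliDeriv_eq hw (sub_ne_zero.2 h0), kernelFactor, neg_sub]

theorem norm_kernel_le {w μ : ℂ} {c : ℝ} (hc : 0 < c)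
    (h : c * Real.exp w.re ≤ ‖Complex.exp w - 1‖) :
    ‖1 / (Complex.exp w - 1) + μ * Complex.exp w / (Complex.exp w - 1) ^ 2‖ ≤
      (1 / c + ‖μ‖ / c ^ 2) * Real.exp (-w.re) := by
  have h0 : 0 < c * Real.exp w.re := by positivity
  refine (norm_add_le _ _).trans ?_
  rw [norm_div, norm_div, norm_mul, norm_one, norm_pow, Complex.norm_exp, add_mul]
  have e : Real.exp (-w.re) = (Real.exp w.re)⁻¹ := Real.exp_neg _
  have hE := Real.exp_pos w.re
  refine add_le_add ?_ ?_
  · calc _ ≤ 1 / (c * Real.exp w.re) := by gcongr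
      _ = _ := by rw [e]; field_simp
  · calc _ ≤ ‖μ‖ * Real.exp w.re / (c * Real.exp w.re) ^ 2 := by gcongr
      _ = _ := by rw [e]; field_simp

theorem le_norm_exp_sub_one {w : ℂ} {δ : ℝ} (h : δ ≤ w.re) :
    (1 - Real.exp (-δ)) * Real.exp w.re ≤ ‖Complex.exp w - 1‖ := by
  have h1 := norm_sub_norm_le (Complex.exp w) 1
  rw [norm_one, Complex.norm_exp] at h1
  refine le_trans ?_ h1
  have h2 : 1 ≤ Real.exp (-δ) * Real.exp w.re := by
    rw [← Real.exp_add]; exact Real.one_le_exp (by linarith)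
  linarith

/-- For -R ≤ Re w ≤ 1 continuity on a compact rectangle suffices, including the removable point. For
Re w > 1 the explicit formula decays like |w| e^{-Re w}. -/
theorem exists_bernoulliDeriv_bound {b R : ℝ} (hb : b < 2 * Real.pi) :
    ∃ C, 0 ≤ C ∧ ∀ w : ℂ, |w.im| ≤ b → -R ≤ w.re →
      ‖bernoulliDeriv w‖ ≤ C * Real.exp (-(1 / 2) * w.re) := by
  have hK : IsCompact (Set.Icc (-R) 1 ×ℂ Set.Icc (-b) b) := isCompact_Icc.reProdIm isCompact_Icc
  have hcont : ContinuousOn (fun w => bernoulliDeriv w * Complex.exp (1 / 2 * w))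
      (Set.Icc (-R) 1 ×ℂ Set.Icc (-b) b) := by
    refine ContinuousOn.mul (differentiableOn_bernoulliDeriv.continuousOn.mono fun w hw => ?_)
      (by fun_prop)
    rw [Complex.mem_reProdIm] at hw
    exact lt_of_le_of_lt (abs_le.2 hw.2) hb
  obtain ⟨C₁, hC₁⟩ := hK.exists_bound_of_continuousOn hcont
  set c : ℝ := 1 - Real.exp (-1) with hcdef
  have hc : 0 < c := by rw [hcdef, sub_pos, Real.exp_lt_one_iff]; norm_num
  obtain ⟨C₃, hC₃, h₃⟩ := exists_add_norm_le_exp (c ^ 2 * (1 / c)) (|b|) (κ := 1 / 2) (by norm_num)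
  refine ⟨max C₁ 0 + C₃ / c ^ 2, by positivity, fun w hw hwR => ?_⟩
  rcases le_or_gt w.re 1 with h1 | h1
  · have := hC₁ w (by rw [Complex.mem_reProdIm]; exact ⟨⟨hwR, h1⟩, abs_le.1 hw⟩)
    rw [norm_mul, Complex.norm_exp] at this
    have e : (1 / 2 * w).re = 1 / 2 * w.re := by simp
    rw [e] at this
    have e2 : Real.exp (-(1 / 2) * w.re) = (Real.exp (1 / 2 * w.re))⁻¹ := by
      rw [← Real.exp_neg]; congr 1; ring
    rw [e2, ← div_eq_mul_inv, le_div_iff₀ (Real.exp_pos _)]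
    have h4 : 0 ≤ C₃ / c ^ 2 := by positivity
    linarith [le_max_left C₁ 0]
  · have h0 : w ≠ 0 := by rintro rfl; simp at h1; linarith
    rw [bernoulliDeriv_eq (hw.trans_lt hb) h0]
    refine (norm_kernel_le hc (le_norm_exp_sub_one h1.le)).trans ?_
    have hmem : w ∈ halfStrip |b| := ⟨by linarith [abs_nonneg b], hw.trans (le_abs_self b)⟩
    have h4 := h₃ w hmem
    have e : Real.exp (-(1 / 2) * w.re) = Real.exp (1 / 2 * w.re) * Real.exp (-w.re) := by
      rw [← Real.exp_add]; congr 1; ring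
    rw [e, ← mul_assoc, norm_neg]
    refine mul_le_mul_of_nonneg_right ?_ (Real.exp_pos _).le
    have h5 : 1 / c + ‖w‖ / c ^ 2 = (c ^ 2 * (1 / c) + ‖w‖) / c ^ 2 := by field_simp
    rw [h5, add_mul (max C₁ 0), div_mul_eq_mul_div C₃]
    have h6 : 0 ≤ max C₁ 0 * Real.exp (1 / 2 * w.re) := by positivity
    have h7 := div_le_div_of_nonneg_right h4 (by positivity : (0 : ℝ) ≤ c ^ 2)
    linarith

theorem measurable_bernoulliDeriv : Measurable bernoulliDeriv := measurable_deriv _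

theorem exists_bernoulliDeriv_sub_bound {b d R : ℝ} (hd : b + d < 2 * Real.pi) :
    ∃ C, 0 ≤ C ∧ ∀ L : ℂ, |L.im| ≤ d → ‖L‖ ≤ R → ∀ y ∈ halfStrip b,
      ‖bernoulliDeriv (y - L)‖ ≤ C * Real.exp (-(1 / 2) * y.re) := by
  obtain ⟨C, hC0, hC⟩ := exists_bernoulliDeriv_bound (R := b + R) hd
  refine ⟨C * Real.exp (1 / 2 * R), by positivity, fun L hL hLR y hy => ?_⟩
  have hre : |L.re| ≤ R := (Complex.abs_re_le_norm L).trans hLR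
  refine (hC (y - L) ?_ ?_).trans ?_
  · rw [Complex.sub_im]
    exact (abs_sub _ _).trans (add_le_add hy.2 hL)
  · rw [Complex.sub_re]; linarith [hy.1, (abs_le.1 hre).2]
  · rw [mul_assoc, ← Real.exp_add, Complex.sub_re]
    gcongr
    linarith [(abs_le.1 hre).2]

/-- The integral attached to `bernoulliDeriv` depends holomorphically on the shift `L`. -/
theorem differentiableAt_hankelIntegral_bernoulliDeriv {r : ℕ} {ε : ℝ} (hε : 0 < ε)
    (s : Fin r → ℂ) {L₀ : ℂ} (hL : r * ε + |L₀.im| < 2 * Real.pi) :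
    DifferentiableAt ℂ (fun L => hankelIntegral ε
      (fun x : Fin r → ℂ => ∏ j, bernoulliDeriv (tailSum x j - L)) s) L₀ := by
  obtain ⟨d, hd1, hd2⟩ := exists_between (lt_sub_iff_add_lt'.2 hL)
  obtain ⟨C, hC0, hC⟩ := exists_bernoulliDeriv_sub_bound (b := r * ε) (d := d)
    (R := ‖L₀‖ + (d - |L₀.im|)) (by linarith)
  have hball : ∀ L ∈ Metric.ball L₀ (d - |L₀.im|), |L.im| ≤ d ∧ ‖L‖ ≤ ‖L₀‖ + (d - |L₀.im|) :=
    fun L hL' => by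
      rw [Metric.mem_ball, dist_eq_norm] at hL'
      have h1 : |L.im - L₀.im| ≤ ‖L - L₀‖ := by
        rw [← Complex.sub_im]; exact Complex.abs_im_le_norm _
      have h2 := abs_sub_abs_le_abs_sub L.im L₀.im
      have h3 := norm_sub_norm_le L L₀
      constructor <;> linarith
  refine differentiableAt_integral_of_dominated (R := d - |L₀.im|) (sub_pos.2 hd1)
    (bound := fun a => C ^ r * (Real.exp (1 / 2 * (r * ε)) ^ r * hankelMajorant ε (1 / 2) s a))
    (fun L _ => (measurable_hankelIntegrand ε s (φ := fun y => bernoulliDeriv (y - L))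
      (measurable_bernoulliDeriv.comp (measurable_id.sub_const L))).aestronglyMeasurable)
    (fun a L hL' => norm_hankelIntegrand_le hε (by norm_num) s (fun y => bernoulliDeriv (y - L))
      (hC L (hball L hL').1 (hball L hL').2) a)
    (((integrable_hankelMajorant hε (by norm_num) s).const_mul _).const_mul _) fun a => ?_
  simp only [hankelIntegrand_eq]
  refine DifferentiableOn.mul_const ?_ _
  refine DifferentiableOn.fun_finsetProd fun j _ => ?_
  refine differentiableOn_bernoulliDeriv.comp (by fun_prop) fun L hL' => ?_
  have h1 := (tailSum_mem_halfStrip hε a j).2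
  have h2 := (hball L hL').1
  simp only [Set.mem_ofPred_eq, Complex.sub_im]
  refine lt_of_le_of_lt (abs_sub _ _) ?_
  linarith

theorem differentiableAt_zetaSum_exp {r : ℕ} [NeZero r] (s : Fin r → ℂ) {L : ℂ} (hL : L.re < 0) :
    DifferentiableAt ℂ (fun L => zetaSum r L (Complex.exp L) s) L := by
  unfold zetaSum
  have hz : Complex.exp L ∈ Metric.ball (0 : ℂ) 1 := by
    rw [mem_ball_zero_iff, Complex.norm_exp, Real.exp_lt_one_iff]; exact hL
  refine DifferentiableAt.fun_sum fun q _ => DifferentiableAt.mul (by fun_prop) ?_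
  exact ((differentiableOn_polyLi _ s s).differentiableAt (Metric.isOpen_ball.mem_nhds hz)).comp L
    Complex.differentiableAt_exp

/-- The evaluation of the Hankel integral for all radii up to `2π / r`. -/
theorem hankelIntegral_bernoulliDeriv {r : ℕ} [NeZero r] {ε : ℝ} (hε : 0 < ε)
    (hr : r * ε < 2 * Real.pi) {s : Fin r → ℂ} (hs : NonInteger s) {L : ℝ} (hL : L < 0) :
    hankelIntegral ε (fun x : Fin r → ℂ => ∏ j, bernoulliDeriv (tailSum x j - L)) s =
      hankelGamma s * zetaSum r L (Complex.exp L) s := by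
  set d := 2 * Real.pi - r * ε with hd
  have hd0 : 0 < d := sub_pos.2 hr
  -- For L in U all differences y_j - L stay in the strip |Im w| < 2π, so the integral is
  -- holomorphic on U. This connected set contains the negative real axis and also points with Re L
  -- < -r ε, where the series expansion applies.
  let U : Set ℂ := Set.Iio 0 ×ℂ Set.Ioo (-d) d
  have hU : IsOpen U := isOpen_Iio.reProdIm isOpen_Ioo
  have hUc : IsPreconnected U := by
    exact (((convex_Iio (0 : ℝ)).linear_preimage Complex.reLm).inter
      ((convex_Ioo (-d) d).linear_preimage Complex.imLm)).isPreconnected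
  have hF : AnalyticOnNhd ℂ (fun L : ℂ => hankelIntegral ε
      (fun x : Fin r → ℂ => ∏ j, bernoulliDeriv (tailSum x j - L)) s) U := by
    refine DifferentiableOn.analyticOnNhd (fun L hL => ?_) hU
    refine (differentiableAt_hankelIntegral_bernoulliDeriv hε s ?_).differentiableWithinAt
    have := abs_lt.2 hL.2
    linarith
  have hG : AnalyticOnNhd ℂ (fun L : ℂ => hankelGamma s * zetaSum r L (Complex.exp L) s) U := by
    refine DifferentiableOn.analyticOnNhd (fun L hL => ?_) hU
    exact ((differentiableAt_zetaSum_exp s hL.1).const_mul _).differentiableWithinAt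
  have hb : (0 : ℝ) ≤ r * ε := by positivity
  have hz₀ : ((-(r * ε) - 1 : ℝ) : ℂ) ∈ U := by
    refine ⟨?_, ?_⟩
    · simp only [Set.mem_preimage, Complex.ofReal_re, Set.mem_Iio]; linarith
    · simp only [Set.mem_preimage, Complex.ofReal_im, Set.mem_Ioo]; constructor <;> linarith
  have hev : (fun L : ℂ => hankelIntegral ε
      (fun x : Fin r → ℂ => ∏ j, bernoulliDeriv (tailSum x j - L)) s) =ᶠ[𝓝 ((-(r * ε) - 1 : ℝ) : ℂ)]
      fun L : ℂ => hankelGamma s * zetaSum r L (Complex.exp L) s := by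
    have hV : IsOpen (Set.Iio (-(r * ε)) ×ℂ Set.Ioo (-d) d) := isOpen_Iio.reProdIm isOpen_Ioo
    filter_upwards [hV.mem_nhds (x := ((-(r * ε) - 1 : ℝ) : ℂ)) ⟨by simp, hz₀.2⟩] with L hL
    have hre : r * ε < -L.re := by have := hL.1; simp at this; linarith
    rw [← hankelIntegral_kernelFactor hε L hre hs]
    refine integral_congr_ae (Eventually.of_forall fun a => ?_)
    simp only [hankelIntegrand_eq]
    congr 1
    refine Finset.prod_congr rfl fun j _ => ?_
    have hy := tailSum_mem_halfStrip hε a j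
    refine (kernelFactor_eq_bernoulliDeriv ?_ ?_).symm
    · rw [Complex.sub_im]
      refine lt_of_le_of_lt (abs_sub _ _) ?_
      have := abs_lt.2 hL.2
      linarith [hy.2]
    · intro h
      have := hy.1
      rw [h] at this
      linarith
  -- The identity theorem carries the evaluation from very negative Re L to every L < 0.
  exact hF.eqOn_of_preconnected_of_eventuallyEq hG hUc hz₀ hev
    (x := (L : ℂ)) ⟨by simpa using hL, by simpa using hd0⟩

/-! ### The removable singularities -/

theorem volume_hankelPoint_eq {ε : ℝ} (hε : 0 < ε) (c : ℂ) :
    volume {u : ℝ | hankelPoint ε u = c} = 0 := by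
  have hcirc : {u : ℝ | (ε : ℂ) * Complex.exp (u * Complex.I) = c}.Countable := by
    rcases Set.eq_empty_or_nonempty {u : ℝ | (ε : ℂ) * Complex.exp (u * Complex.I) = c} with h | h
    · rw [h]; exact Set.countable_empty
    obtain ⟨u₀, hu₀⟩ := h
    refine (Set.countable_range fun n : ℤ => u₀ + n * (2 * Real.pi)).mono fun u hu => ?_
    have h1 : Complex.exp (u * Complex.I) = Complex.exp (u₀ * Complex.I) := by
      apply mul_left_cancel₀ (show (ε : ℂ) ≠ 0 by exact_mod_cast hε.ne')
      exact (Set.mem_ofPred_eq ▸ hu).trans (Set.mem_ofPred_eq ▸ hu₀).symm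
    obtain ⟨n, hn⟩ := Complex.exp_eq_exp_iff_exists_int.1 h1
    refine ⟨n, ?_⟩
    have := congrArg Complex.im hn
    simp at this
    exact this.symm
  refine Set.Countable.measure_zero (Set.Countable.mono (s₂ := {ε - c.re} ∪
    ({c.re - (ε - 2 * Real.pi)} ∪ {u : ℝ | (ε : ℂ) * Complex.exp (u * Complex.I) = c}))
    (fun u hu => ?_) ?_) _
  · rw [Set.mem_ofPred_eq] at hu
    rcases lt_or_ge u 0 with h | h
    · left
      rw [hankelPoint_of_neg hε h] at hu
      rw [Set.mem_singleton_iff, ← hu, Complex.ofReal_re]; ring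
    rcases le_or_gt u (2 * Real.pi) with h' | h'
    · right; right
      rw [hankelPoint_of_mem hε h h'] at hu
      exact hu
    · right; left
      rw [hankelPoint_of_gt hε h'] at hu
      rw [Set.mem_singleton_iff, ← hu, Complex.ofReal_re]; ring
  · exact (Set.countable_singleton _).union ((Set.countable_singleton _).union hcirc)

/-- Fix all parameters except a_j: the equation then prescribes the point x_j of the contour, which
has only countably many parameters. This disposes of y_j = log t, where the kernel as written takes
its division-by-zero value instead of its limit. -/
theorem ae_tailSum_ne {r : ℕ} {ε : ℝ} (hε : 0 < ε) (j : Fin r) (c : ℂ) :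
    ∀ᵐ a : Fin r → ℝ, tailSum (fun k => hankelPoint ε (a k)) j ≠ c := by
  rcases r with _ | n
  · exact j.elim0
  have hmeas : MeasurableSet {a : Fin (n + 1) → ℝ | tailSum (fun k => hankelPoint ε (a k)) j = c} :=
    (measurable_tailSum ε j) (measurableSet_singleton c)
  have hmp := (volume_preserving_piFinSuccAbove (fun _ : Fin (n + 1) => ℝ) j).symm
  rw [ae_iff]
  simp only [not_not]
  rw [← hmp.measure_preimage hmeas.nullMeasurableSet]
  have hmeas' := (MeasurableEquiv.piFinSuccAbove (fun _ : Fin (n + 1) => ℝ) j).symm.measurable hmeas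
  rw [Measure.volume_eq_prod, Measure.prod_apply_symm hmeas', lintegral_eq_zero_iff'
    (measurable_measure_prodMk_right hmeas').aemeasurable]
  refine Eventually.of_forall fun y => ?_
  refine measure_mono_null (fun u hu => ?_) (volume_hankelPoint_eq hε
    (c - ∑ k ∈ Finset.Ioi j, hankelPoint ε ((Fin.insertNth j 0 y : Fin (n + 1) → ℝ) k)))
  simp only [Set.mem_preimage, Set.mem_ofPred_eq] at hu ⊢
  rw [← hu, tailSum, ← Finset.Ioi_insert, Finset.sum_insert (by simp)]
  have h1 : ∀ u k, (MeasurableEquiv.piFinSuccAbove (fun _ : Fin (n + 1) => ℝ) j).symm (u, y) k =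
      (Fin.insertNth j u y : Fin (n + 1) → ℝ) k := fun u k => rfl
  have h2 : ∑ k ∈ Finset.Ioi j, hankelPoint ε ((Fin.insertNth j u y : Fin (n + 1) → ℝ) k) =
      ∑ k ∈ Finset.Ioi j, hankelPoint ε ((Fin.insertNth j 0 y : Fin (n + 1) → ℝ) k) := by
    refine Finset.sum_congr rfl fun k hk => ?_
    obtain ⟨i, rfl⟩ := Fin.exists_succAbove_eq (Finset.mem_Ioi.1 hk).ne'
    simp
  simp only [h1, h2]
  simp

theorem one_div_mul_exp {t : ℝ} (ht : 0 < t) (y : ℂ) :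
    1 / (t : ℂ) * Complex.exp y = Complex.exp (y - (Real.log t : ℝ)) := by
  rw [Complex.exp_sub, ← Complex.ofReal_exp, Real.exp_log ht]; ring

theorem hatKernel_eq {r : ℕ} {t : ℝ} (ht : 0 < t) (x : Fin r → ℂ) :
    hatKernel r t x = ∏ j, kernelFactor (Real.log t : ℝ) (Real.log t : ℝ) (tailSum x j) := by
  rw [hatKernel]
  simp only [one_div_mul_exp ht, kernelFactor]

theorem hatKernel_ae_eq {r : ℕ} {ε t : ℝ} (hε : 0 < ε) (hr : r * ε < 2 * Real.pi) (ht : 0 < t)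
    (s : Fin r → ℂ) : hankelIntegrand ε (hatKernel r t) s =ᵐ[volume]
      hankelIntegrand ε (fun x => ∏ j, bernoulliDeriv (tailSum x j - (Real.log t : ℝ))) s := by
  filter_upwards [ae_all_iff.2 fun j => ae_tailSum_ne (r := r) hε j ((Real.log t : ℝ) : ℂ)] with a ha
  rw [hankelIntegrand_eq, hankelIntegrand_eq, hatKernel_eq ht]
  congr 1
  refine Finset.prod_congr rfl fun j _ => kernelFactor_eq_bernoulliDeriv ?_ (ha j)
  rw [Complex.sub_im, Complex.ofReal_im, sub_zero]
  exact (tailSum_mem_halfStrip hε a j).2.trans_lt hr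

theorem isHatDesZeta_zetaSum {r : ℕ} [NeZero r] {t : ℝ} (ht : t ∈ Set.Ioo (0 : ℝ) 1) :
    IsHatDesZeta r t (zetaSum r (Real.log t : ℝ) t) := by
  have hL : Real.log t < 0 := Real.log_neg ht.1 ht.2
  have hz : ‖(t : ℂ)‖ < 1 := by rw [Complex.norm_real, Real.norm_of_nonneg ht.1.le]; exact ht.2
  refine ⟨?_, fun ε hε hr s hs => ?_⟩
  · unfold zetaSum
    exact Differentiable.fun_sum fun q _ => (differentiable_polyLi _ hz).const_mul _
  have hae := hatKernel_ae_eq hε hr ht.1 s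
  refine ⟨?_, ?_⟩
  · obtain ⟨C, -, hC⟩ := exists_bernoulliDeriv_sub_bound (b := r * ε) (d := 0)
      (R := ‖((Real.log t : ℝ) : ℂ)‖) (by linarith)
    exact (integrable_hankelIntegrand hε (by norm_num) s
      (φ := fun y => bernoulliDeriv (y - (Real.log t : ℝ)))
      (measurable_bernoulliDeriv.comp (measurable_id.sub_const _))
      (hC (Real.log t : ℝ) (by simp) le_rfl)).congr hae.symm
  · have h := hankelIntegral_bernoulliDeriv hε hr hs hL
    rw [hankelIntegral] at h ⊢
    rw [integral_congr_ae hae, h, ← mul_assoc, gammaFactor_mul_hankelGamma hs, one_mul,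
      ← Complex.ofReal_exp, Real.exp_log ht.1]

/-! ### The limit `c → 1` -/

theorem desKernel_eq {r : ℕ} {t : ℝ} (ht : 0 < t) (c : ℝ) (x : Fin r → ℂ) :
    desKernel r t c x = ∏ j, (1 / (Complex.exp (tailSum x j - (Real.log t : ℝ)) - 1) -
      c / (Complex.exp (c * tailSum x j - (Real.log t : ℝ)) - 1)) := by
  rw [desKernel]
  simp only [one_div_mul_exp ht]

/-- The difference quotient whose limit is `kernelFactor 0 L`. -/
def kernelQuotient (L : ℂ) (c : ℝ) (y : ℂ) : ℂ :=
  1 / (1 - (c : ℂ)) * (1 / (Complex.exp (y - L) - 1) - c / (Complex.exp (c * y - L) - 1))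

theorem measurable_kernelQuotient (L : ℂ) (c : ℝ) : Measurable (kernelQuotient L c) := by
  unfold kernelQuotient; fun_prop

/-- At c = 1 this derivative is the kernel with lam = 0, which is why the desingularised limit
belongs to the same family. -/
theorem hasDerivAt_dilatedKernel {L y : ℂ} {c : ℝ} (h : Complex.exp (c * y - L) - 1 ≠ 0) :
    HasDerivAt (fun c : ℝ => (c : ℂ) / (Complex.exp (c * y - L) - 1))
      (1 / (Complex.exp (c * y - L) - 1) +
        (-(c : ℂ) * y) * Complex.exp (c * y - L) / (Complex.exp (c * y - L) - 1) ^ 2) c := by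
  have h1 : HasDerivAt (fun c : ℝ => (c : ℂ)) 1 c := Complex.ofRealCLM.hasDerivAt
  have h2 := ((h1.mul_const y).sub_const L).cexp.sub_const 1
  refine (h1.div h2 h).congr_deriv ?_
  field_simp
  ring

/-- As c stays positive, c y is lowest in real part at the left edge of the half-strip, so
unboundedness of y does no harm. The b + 1 in the denominator covers b = 0. -/
theorem exists_dilation_range {b L : ℝ} (hb : 0 ≤ b) (hL : b < -L) :
    ∃ η δ : ℝ, 0 < η ∧ η ≤ 1 / 2 ∧ 0 < δ ∧ ∀ c : ℝ, |c - 1| ≤ η → ∀ y ∈ halfStrip b,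
      δ ≤ ((c : ℂ) * y - (L : ℂ)).re := by
  refine ⟨min (1 / 2) ((-L - b) / (2 * (b + 1))), (-L - b) / 2,
    lt_min (by norm_num) (div_pos (by linarith) (by linarith)), min_le_left _ _, by linarith,
    fun c hc y hy => ?_⟩
  have h1 := hc.trans (min_le_left _ _)
  have h2 := hc.trans (min_le_right _ _)
  rw [abs_le] at h1
  have h3 : (c - 1) * b ≤ (-L - b) / 2 := by
    refine (mul_le_mul_of_nonneg_right ((le_abs_self _).trans h2) hb).trans ?_
    rw [div_mul_eq_mul_div, div_le_div_iff₀ (by linarith) two_pos]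
    nlinarith
  rw [Complex.sub_re, Complex.re_ofReal_mul, Complex.ofReal_re]
  have h4 : 0 ≤ c * (y.re + b) := mul_nonneg (by linarith) (by linarith [hy.1])
  nlinarith

/-- The quotient is a slope in c, so the mean value inequality bounds it by the derivative,
uniformly for c near 1. -/
theorem exists_kernelQuotient_bound {b L : ℝ} (hb : 0 ≤ b) (hL : b < -L) :
    ∃ η C : ℝ, 0 < η ∧ ∀ y ∈ halfStrip b, ∀ c : ℝ, |c - 1| ≤ η → c ≠ 1 →
      ‖kernelQuotient L c y‖ ≤ C * Real.exp (-(1 / 4) * y.re) := by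
  obtain ⟨η, δ, hη, hη2, hδ, H⟩ := exists_dilation_range hb hL
  set k : ℝ := 1 - Real.exp (-δ) with hk
  have hk0 : 0 < k := by rw [hk, sub_pos, Real.exp_lt_one_iff]; linarith
  -- From c ≥ 1/2 the decay rate is at least 1/2; a quarter is spent on the factor |y|, which leaves
  -- 1/4.
  obtain ⟨C, hC0, hC⟩ := exists_add_norm_le_exp (k ^ 2 / (2 * k)) b (κ := 1 / 4) (by norm_num)
  refine ⟨η, C * (2 / k ^ 2) * Real.exp (L + b), hη, fun y hy c hc hc1 => ?_⟩
  have hlow : ∀ c : ℝ, |c - 1| ≤ η → k * Real.exp ((c : ℂ) * y - (L : ℂ)).re ≤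
      ‖Complex.exp (c * y - L) - 1‖ := fun c hc => le_norm_exp_sub_one (H c hc y hy)
  have hne : ∀ c : ℝ, |c - 1| ≤ η → Complex.exp (c * y - L) - 1 ≠ 0 := fun c hc h => by
    have := hlow c hc
    rw [h, norm_zero] at this
    exact absurd this (not_le.2 (by positivity))
  have hder : ∀ c ∈ {c : ℝ | |c - 1| ≤ η}, ‖1 / (Complex.exp (c * y - L) - 1) +
      (-(c : ℂ) * y) * Complex.exp (c * y - L) / (Complex.exp (c * y - L) - 1) ^ 2‖ ≤
      C * (2 / k ^ 2) * Real.exp (L + b) * Real.exp (-(1 / 4) * y.re) := fun c hc => by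
    have hcab := abs_le.1 (hc.trans hη2)
    refine (norm_kernel_le hk0 (hlow c hc)).trans ?_
    have h1 : 1 / k + ‖-(c : ℂ) * y‖ / k ^ 2 ≤ (2 / k ^ 2) * (C * Real.exp (1 / 4 * y.re)) := by
      refine le_trans ?_ (mul_le_mul_of_nonneg_left (hC y hy) (by positivity))
      rw [norm_mul, norm_neg, Complex.norm_real, Real.norm_eq_abs]
      have h2 : |c| ≤ 2 := abs_le.2 ⟨by linarith, by linarith⟩
      have h3 : |c| * ‖y‖ / k ^ 2 ≤ 2 * ‖y‖ / k ^ 2 := by gcongr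
      have h4 : 2 / k ^ 2 * (k ^ 2 / (2 * k) + ‖y‖) = 1 / k + 2 * ‖y‖ / k ^ 2 := by
        field_simp
      rw [h4]; linarith
    have h5 : Real.exp (-((c : ℂ) * y - (L : ℂ)).re) ≤
        Real.exp (L + b) * Real.exp (-(1 / 2) * y.re) := by
      rw [← Real.exp_add, Real.exp_le_exp, Complex.sub_re, Complex.re_ofReal_mul, Complex.ofReal_re]
      nlinarith [hy.1, hcab.1, hcab.2]
    refine (mul_le_mul h1 h5 (Real.exp_pos _).le (by positivity)).trans_eq ?_
    have h6 : Real.exp (-(1 / 4) * y.re) = Real.exp (1 / 4 * y.re) * Real.exp (-(1 / 2) * y.re) := by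
      rw [← Real.exp_add]; congr 1; ring
    rw [h6]; ring
  have hconv : Convex ℝ {c : ℝ | |c - 1| ≤ η} := by
    have : {c : ℝ | |c - 1| ≤ η} = Metric.closedBall 1 η := by
      ext; simp [Real.dist_eq]
    rw [this]; exact convex_closedBall _ _
  have h1mem : (1 : ℝ) ∈ {c : ℝ | |c - 1| ≤ η} := by simpa using hη.le
  have hmv := hconv.norm_image_sub_le_of_norm_hasDerivWithin_le
    (fun c hc => (hasDerivAt_dilatedKernel (hne c hc)).hasDerivWithinAt) hder hc h1mem
  have hc' : (0 : ℝ) < ‖1 - c‖ := norm_pos_iff.2 (sub_ne_zero.2 hc1.symm)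
  rw [kernelQuotient, norm_mul, norm_div, norm_one, ← Complex.ofReal_one, ← Complex.ofReal_sub,
    Complex.norm_real, div_mul_eq_mul_div, one_mul, div_le_iff₀ hc']
  simpa using hmv

theorem tendsto_kernelQuotient {b L : ℝ} (hb : 0 ≤ b) (hL : b < -L) {y : ℂ} (hy : y ∈ halfStrip b) :
    Tendsto (fun c : ℝ => kernelQuotient L c y) (𝓝[≠] 1) (𝓝 (kernelFactor 0 L y)) := by
  have hne : Complex.exp (((1 : ℝ) : ℂ) * y - L) - 1 ≠ 0 := by
    obtain ⟨η, δ, hη, -, hδ, H⟩ := exists_dilation_range hb hL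
    have h1 := H 1 (by simpa using hη.le) y hy
    intro h
    have h2 := congrArg norm (sub_eq_zero.1 h)
    rw [Complex.norm_exp, norm_one, Real.exp_eq_one_iff] at h2
    linarith
  have h := (hasDerivAt_iff_tendsto_slope.1 (hasDerivAt_dilatedKernel hne))
  have e : kernelFactor 0 L y = 1 / (Complex.exp (((1 : ℝ) : ℂ) * y - L) - 1) +
        (-((1 : ℝ) : ℂ) * y) * Complex.exp (((1 : ℝ) : ℂ) * y - L) /
          (Complex.exp (((1 : ℝ) : ℂ) * y - L) - 1) ^ 2 := by
    rw [kernelFactor]; simp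
  rw [e]
  refine h.congr' ?_
  filter_upwards [self_mem_nhdsWithin] with c hc
  have hc1 : (c : ℂ) - 1 ≠ 0 := by
    rw [sub_ne_zero]; exact_mod_cast hc
  have hc2 : 1 - (c : ℂ) ≠ 0 := by rw [← neg_sub]; exact neg_ne_zero.2 hc1
  have e2 : 1 / (1 - (c : ℂ)) = -(1 / ((c : ℂ) - 1)) := by
    rw [← neg_sub, one_div, one_div, ← inv_neg, neg_sub]
  rw [slope_def_module, kernelQuotient, Complex.real_smul, e2]
  push_cast
  rw [one_mul]
  ring

theorem isDesZeta_zetaSum {r : ℕ} [NeZero r] {t : ℝ} (ht : t ∈ Set.Ioo (0 : ℝ) 1) :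
    IsDesZeta r t (zetaSum r 0 t) := by
  have hL : Real.log t < 0 := Real.log_neg ht.1 ht.2
  have hz : ‖(t : ℂ)‖ < 1 := by rw [Complex.norm_real, Real.norm_of_nonneg ht.1.le]; exact ht.2
  refine ⟨?_, fun ε hε hr s hs => ?_⟩
  · unfold zetaSum
    exact Differentiable.fun_sum fun q _ => (differentiable_polyLi _ hz).const_mul _
  rw [abs_of_neg hL] at hr
  have hb : (0 : ℝ) ≤ r * ε := by positivity
  obtain ⟨η, C, hη, hC⟩ := exists_kernelQuotient_bound hb hr
  have hnear : ∀ᶠ c : ℝ in 𝓝[≠] 1, |c - 1| ≤ η ∧ c ≠ 1 := by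
    refine (Filter.Eventually.and ?_ self_mem_nhdsWithin)
    refine mem_nhdsWithin_of_mem_nhds ?_
    filter_upwards [Metric.closedBall_mem_nhds (1 : ℝ) hη] with c hc
    simpa [Real.dist_eq] using hc
  -- The r factors 1/(1 - c) are distributed over the r factors of the kernel, each of which has a
  -- finite limit.
  have hscale : ∀ c : ℝ, c ≠ 1 → ∀ a, hankelIntegrand ε (desKernel r t c) s a =
      (1 - (c : ℂ)) ^ r * hankelIntegrand ε
        (fun x => ∏ j, kernelQuotient (Real.log t : ℝ) c (tailSum x j)) s a := fun c hc a => by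
    have hc2 : 1 - (c : ℂ) ≠ 0 := sub_ne_zero.2 (by exact_mod_cast hc.symm)
    simp only [hankelIntegrand_eq, desKernel_eq ht.1, kernelQuotient]
    rw [Finset.prod_mul_distrib, Finset.prod_const, Finset.card_univ, Fintype.card_fin,
      ← mul_assoc, ← mul_assoc, ← mul_pow, mul_one_div_cancel hc2, one_pow, one_mul]
  have hint : ∀ c : ℝ, |c - 1| ≤ η → c ≠ 1 → Integrable (hankelIntegrand ε
      (fun x : Fin r → ℂ => ∏ j, kernelQuotient (Real.log t : ℝ) c (tailSum x j)) s) :=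
    fun c hc hc1 => integrable_hankelIntegrand hε (δ := 1 / 4) (by norm_num) s
      (measurable_kernelQuotient _ c) fun y hy => hC y hy c hc hc1
  constructor
  · filter_upwards [hnear] with c hc
    exact ((hint c hc.1 hc.2).const_mul _).congr
      (Eventually.of_forall fun a => (hscale c hc.2 a).symm)
  · have hlim : Tendsto (fun c : ℝ => hankelIntegral ε
        (fun x : Fin r → ℂ => ∏ j, kernelQuotient (Real.log t : ℝ) c (tailSum x j)) s) (𝓝[≠] 1)
        (𝓝 (hankelIntegral ε (fun x => ∏ j, kernelFactor 0 (Real.log t : ℝ) (tailSum x j)) s)) := by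
      refine tendsto_integral_filter_of_dominated_convergence
        (fun a => C ^ r * (Real.exp (1 / 4 * (r * ε)) ^ r * hankelMajorant ε (1 / 4) s a)) ?_ ?_
        (((integrable_hankelMajorant hε (by norm_num) s).const_mul _).const_mul _) ?_
      · exact Eventually.of_forall fun c => (measurable_hankelIntegrand ε s
          (measurable_kernelQuotient _ c)).aestronglyMeasurable
      · filter_upwards [hnear] with c hc
        exact Eventually.of_forall fun a => norm_hankelIntegrand_le hε (by norm_num) s _
          (fun y hy => hC y hy c hc.1 hc.2) a
      · refine Eventually.of_forall fun a => ?_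
        simp only [hankelIntegrand_eq]
        exact (tendsto_finsetProd _ fun j _ =>
          tendsto_kernelQuotient hb hr (tailSum_mem_halfStrip hε a j)).mul_const _
    have hval := hankelIntegral_kernelFactor hε 0 (L := ((Real.log t : ℝ) : ℂ))
      (by rwa [Complex.ofReal_re]) hs
    rw [hval, ← Complex.ofReal_exp, Real.exp_log ht.1] at hlim
    have h2 := hlim.const_mul (gammaFactor s)
    rw [← mul_assoc, gammaFactor_mul_hankelGamma hs, one_mul] at h2
    refine h2.congr' ?_
    filter_upwards [hnear] with c hc
    have hc2 : 1 - (c : ℂ) ≠ 0 := sub_ne_zero.2 (by exact_mod_cast hc.2.symm)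
    have h3 : hankelIntegral ε (desKernel r t c) s = (1 - (c : ℂ)) ^ r * hankelIntegral ε
        (fun x : Fin r → ℂ => ∏ j, kernelQuotient (Real.log t : ℝ) c (tailSum x j)) s := by
      rw [hankelIntegral, hankelIntegral, ← integral_const_mul]
      exact integral_congr_ae (Eventually.of_forall (hscale c hc.2))
    rw [h3]
    field_simp

/-! ### Uniqueness of the analytic continuation -/

/-- Density is all that uniqueness needs: two entire functions are continuous, so agreement at
non-integral points forces equality. -/
theorem dense_nonInteger (r : ℕ) : Dense {s : Fin r → ℂ | NonInteger s} := by
  have h : Dense (Set.range fun n : ℤ => (n : ℂ))ᶜ :=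
    (Set.countable_range _).dense_compl ℂ
  have h2 := dense_pi (Set.univ : Set (Fin r)) (s := fun _ => (Set.range fun n : ℤ => (n : ℂ))ᶜ)
    fun _ _ => h
  refine h2.mono fun s hs j n hn => ?_
  exact hs j (Set.mem_univ j) ⟨n, hn.symm⟩

theorem exists_radius (r : ℕ) {b : ℝ} (hb : 0 < b) : ∃ ε : ℝ, 0 < ε ∧ r * ε < b := by
  refine ⟨b / (r + 1), by positivity, ?_⟩
  rw [mul_div_assoc', div_lt_iff₀ (by positivity)]
  nlinarith

theorem IsHatDesZeta.unique {r : ℕ} {t : ℝ} {f g : (Fin r → ℂ) → ℂ} (hf : IsHatDesZeta r t f)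
    (hg : IsHatDesZeta r t g) : f = g := by
  obtain ⟨ε, hε, hr⟩ := exists_radius r Real.two_pi_pos
  exact Continuous.ext_on (dense_nonInteger r) hf.1.continuous hg.1.continuous fun s hs =>
    (hf.2 ε hε hr s hs).2.trans (hg.2 ε hε hr s hs).2.symm

theorem IsDesZeta.unique {r : ℕ} {t : ℝ} (ht : t ∈ Set.Ioo (0 : ℝ) 1) {f g : (Fin r → ℂ) → ℂ}
    (hf : IsDesZeta r t f) (hg : IsDesZeta r t g) : f = g := by
  obtain ⟨ε, hε, hr⟩ := exists_radius r (abs_pos.2 (Real.log_neg ht.1 ht.2).ne)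
  exact Continuous.ext_on (dense_nonInteger r) hf.1.continuous hg.1.continuous fun s hs =>
    tendsto_nhds_unique (hf.2 ε hε hr s hs).2 (hg.2 ε hε hr s hs).2

/-! ### The Euler operator -/

theorem hasDerivAt_polyLi {r : ℕ} [NeZero r] (P : MvPolynomial (Fin r) (LaurentV r))
    (σ s : Fin r → ℂ) {z : ℂ} (hz : ‖z‖ < 1) (h0 : z ≠ 0) :
    HasDerivAt (polyLi P σ s)
      (polyLi P σ (Function.update s (lastIdx r) (s (lastIdx r) - 1)) z / z) z := by
  unfold polyLi
  simp only [Finset.sum_div]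
  refine HasDerivAt.fun_sum fun l _ => HasDerivAt.fun_sum fun m _ => ?_
  rw [mul_div_assoc]
  refine HasDerivAt.const_mul _ ?_
  have e : Function.update s (lastIdx r) (s (lastIdx r) - 1) + (fun j => (m j : ℂ)) =
      Function.update (s + fun j => (m j : ℂ)) (lastIdx r)
        ((s + fun j => (m j : ℂ)) (lastIdx r) - 1) := by
    ext k
    by_cases h : k = lastIdx r
    · subst h; simp; ring
    · simp [h]
  rw [e]
  exact hasDerivAt_LiC (s + fun j => (m j : ℂ)) hz h0

/-- Equality on the whole open interval is assumed because differentiation needs it in a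
neighbourhood of t. -/
theorem eulerD_iterate {r : ℕ} [NeZero r] (P : MvPolynomial (Fin r) (LaurentV r))
    (σ s : Fin r → ℂ) {f : ℝ → ℂ} (hf : ∀ t ∈ Set.Ioo (0 : ℝ) 1, f t = polyLi P σ s t) (i : ℕ) :
    ∀ t ∈ Set.Ioo (0 : ℝ) 1, (eulerD^[i] f) t =
      polyLi P σ (Function.update s (lastIdx r) (s (lastIdx r) - i)) t := by
  induction i with
  | zero => simpa using hf
  | succ i ih =>
    intro t ht
    have hz : ‖(t : ℂ)‖ < 1 := by rw [Complex.norm_real, Real.norm_of_nonneg ht.1.le]; exact ht.2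
    have h0 : (t : ℂ) ≠ 0 := by exact_mod_cast ht.1.ne'
    rw [Function.iterate_succ_apply', eulerD]
    have he : eulerD^[i] f =ᶠ[𝓝 t] fun t : ℝ =>
        polyLi P σ (Function.update s (lastIdx r) (s (lastIdx r) - i)) t := by
      filter_upwards [isOpen_Ioo.mem_nhds ht] with u hu using ih u hu
    rw [he.deriv_eq, (hasDerivAt_polyLi P σ _ hz h0).comp_ofReal.deriv, mul_div_cancel₀ _ h0]
    simp only [Function.update_self, Function.update_idem, Nat.cast_succ, sub_sub]

/-! ### Values at integers -/

theorem ascPochhammer_eval_intCast (n : ℕ) (k : ℤ) :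
    (((ascPochhammer ℤ n).eval k : ℤ) : ℂ) = (ascPochhammer ℂ n).eval (k : ℂ) := by
  rw [← ascPochhammer_map (Int.castRingHom ℂ), Polynomial.eval_map, ← eq_intCast (Int.castRingHom ℂ) k,
    Polynomial.eval₂_at_apply, eq_intCast]

/-- By homogeneity the filter on m removes nothing. -/
theorem liCombination_eq {r : ℕ} [NeZero r] (q : ℕ) (k : Fin r → ℤ) (t : ℝ) :
    liCombination q k t = polyLi (genPolyDeriv r q) (fun j => (k j : ℂ)) (fun j => (k j : ℂ)) t := by
  rw [liCombination, polyLi]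
  refine Finset.sum_congr rfl fun l _ => ?_
  rw [Finset.filter_true_of_mem fun m hm => (vHomogeneous_genPolyDeriv q).sum_eq l hm]
  refine Finset.sum_congr rfl fun m _ => ?_
  rw [aCoeff, ← LiC_int]
  push_cast
  simp only [ascPochhammer_eval_intCast]
  congr 2
  ext j
  simp

theorem cast_lowerLast {r : ℕ} [NeZero r] (k : Fin r → ℤ) (j : ℕ) :
    (fun i => (lowerLast k j i : ℂ)) =
      Function.update (fun i => (k i : ℂ)) (lastIdx r) ((k (lastIdx r) : ℂ) - j) := by
  ext i
  rw [lowerLast]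
  by_cases h : i = lastIdx r
  · subst h; simp
  · simp [h]

theorem zetaSum_zero {r : ℕ} [NeZero r] (z : ℂ) (s : Fin r → ℂ) :
    zetaSum r 0 z s = polyLi (genPoly r) s s z := by
  rw [zetaSum, Finset.sum_eq_single 0]
  · simp [genPolyDeriv]
  · intro q _ hq; simp [hq]
  · simp

/-- The chosen continuation satisfies its specification because `zetaSum` does, and by uniqueness it
is `zetaSum`. -/
theorem hatDesZeta_eq {r : ℕ} [NeZero r] {t : ℝ} (ht : t ∈ Set.Ioo (0 : ℝ) 1) :
    hatDesZeta r t = zetaSum r (Real.log t : ℝ) t :=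
  (Classical.epsilon_spec (p := IsHatDesZeta r t) ⟨_, isHatDesZeta_zetaSum ht⟩).unique
    (isHatDesZeta_zetaSum ht)

theorem desZeta_eq {r : ℕ} [NeZero r] {t : ℝ} (ht : t ∈ Set.Ioo (0 : ℝ) 1) :
    desZeta r t = zetaSum r 0 t :=
  (Classical.epsilon_spec (p := IsDesZeta r t) ⟨_, isDesZeta_zetaSum ht⟩).unique ht
    (isDesZeta_zetaSum ht)

theorem Z0_eq {r : ℕ} [NeZero r] (k : Fin r → ℤ) {t : ℝ} (ht : t ∈ Set.Ioo (0 : ℝ) 1) :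
    Z0 k t = polyLi (genPoly r) (fun j => (k j : ℂ)) (fun j => (k j : ℂ)) t := by
  rw [Z0, desZeta_eq ht, zetaSum_zero]

theorem contDiffOn_Z0 {r : ℕ} [NeZero r] (k : Fin r → ℤ) :
    ContDiffOn ℝ ∞ (Z0 k) (Set.Ioo (0 : ℝ) 1) := by
  have h : ContDiffOn ℂ ∞ (polyLi (genPoly r) (fun j => (k j : ℂ)) fun j => (k j : ℂ))
      (Metric.ball 0 1) := (differentiableOn_polyLi _ _ _).contDiffOn Metric.isOpen_ball
  refine ContDiffOn.congr (f := fun t : ℝ =>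
    polyLi (genPoly r) (fun j => (k j : ℂ)) (fun j => (k j : ℂ)) t) ?_ fun t ht => Z0_eq k ht
  refine (h.restrict_scalars ℝ).comp Complex.ofRealCLM.contDiff.contDiffOn fun t ht => ?_
  simpa [abs_of_pos ht.1] using ht.2

/-- In each summand the exponent is lowered by j in forming k^{(j)} and by i through D^i, hence
always by q. The common factor N_r^q comes out, and the alternating sum of rising factorials is the
q-th derivative in u_r. -/
theorem Zq_eq {r : ℕ} [NeZero r] (q : ℕ) (k : Fin r → ℤ) {t : ℝ} (ht : t ∈ Set.Ioo (0 : ℝ) 1) :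
    Zq q k t = liCombination q k t := by
  have hz : ‖(t : ℂ)‖ < 1 := by rw [Complex.norm_real, Real.norm_of_nonneg ht.1.le]; exact ht.2
  set s : Fin r → ℂ := fun j => (k j : ℂ) with hs
  have hD : ∀ p ∈ Finset.HasAntidiagonal.antidiagonal q,
      (eulerD^[p.1] (Z0 (lowerLast k p.2))) t =
        polyLi (genPoly r) (Function.update s (lastIdx r) (s (lastIdx r) - p.2))
          (Function.update s (lastIdx r) (s (lastIdx r) - q)) t := fun p hp => by
    rw [eulerD_iterate (genPoly r) _ _ (fun u hu => Z0_eq (lowerLast k p.2) hu) p.1 t ht,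
      cast_lowerLast]
    have e : ((lowerLast k p.2 (lastIdx r) : ℤ) : ℂ) - p.1 = s (lastIdx r) - q := by
      rw [← Finset.HasAntidiagonal.mem_antidiagonal.1 hp, lowerLast, Function.update_self]
      push_cast
      ring
    simp only [Function.update_idem, e, hs]
  rw [Zq, liCombination_eq, Finset.sum_congr rfl fun p hp => by rw [hD p hp]]
  have h1 := hasSum_sum fun p (_ : p ∈ Finset.HasAntidiagonal.antidiagonal q) =>
    (hasSum_polyLi (genPoly r) (Function.update s (lastIdx r) (s (lastIdx r) - p.2))
      (Function.update s (lastIdx r) (s (lastIdx r) - q)) hz).mul_left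
      ((-1) ^ p.2 * (q.choose p.1 : ℂ))
  refine h1.unique (hasSum_of_eq (hasSum_polyLi (genPolyDeriv r q) s s hz) fun N => ?_)
  have hrise := riseFun_pderiv_iterate s (lastIdx r) (gapPoly N.1 0) q
  rw [map_genPolyDeriv, map_genPoly, ← MvPolynomial.smul_eq_C_mul, map_smul, smul_eq_mul, hrise,
    Finset.mul_sum, Finset.mul_sum]
  refine Finset.sum_congr rfl fun p _ => ?_
  rw [liTermC, liTermC, negPow_lower]
  ring

end DesZeta

end

/-! ### Assembly of the theorem -/

theorem mainTheorem4 (r : ℕ) [NeZero r] :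
    -- both zeta functions exist as (unique) entire functions of `s`
    (∀ t ∈ Set.Ioo (0 : ℝ) 1, ∃! f, DesZeta.IsHatDesZeta r t f) ∧
    (∀ t ∈ Set.Ioo (0 : ℝ) 1, ∃! g, DesZeta.IsDesZeta r t g) ∧
    ∀ k : Fin r → ℤ,
      -- the ingredients of `Z(k; t)` and of the explicit formula are well defined
      ContDiffOn ℝ ∞ (DesZeta.Z0 k) (Set.Ioo (0 : ℝ) 1) ∧
      ∀ t ∈ Set.Ioo (0 : ℝ) 1,
        Summable (DesZeta.liTerm k (t : ℂ)) ∧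
        (∀ q : ℕ, r < q → DesZeta.Zq q k t = 0) ∧
        -- the value of the zeta function at `k` is `Z(k; t)`
        DesZeta.hatDesZeta r t (fun j => (k j : ℂ)) = DesZeta.Z k t ∧
        -- and both are given by the explicit combination of polylogarithms
        DesZeta.hatDesZeta r t (fun j => (k j : ℂ)) =
          ∑ q ∈ Finset.range (r + 1),
            (((-Real.log t) ^ q / (q.factorial : ℝ) : ℝ) : ℂ) * DesZeta.liCombination q k t := by
  refine ⟨fun t ht => ⟨_, DesZeta.isHatDesZeta_zetaSum ht,
      fun f hf => hf.unique (DesZeta.isHatDesZeta_zetaSum ht)⟩,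
    fun t ht => ⟨_, DesZeta.isDesZeta_zetaSum ht,
      fun f hf => hf.unique ht (DesZeta.isDesZeta_zetaSum ht)⟩,
    fun k => ⟨DesZeta.contDiffOn_Z0 k, fun t ht => ?_⟩⟩
  have hz : ‖(t : ℂ)‖ < 1 := by rw [Complex.norm_real, Real.norm_of_nonneg ht.1.le]; exact ht.2
  have hzero : ∀ q : ℕ, r < q → DesZeta.Zq q k t = 0 := fun q hq => by
    rw [DesZeta.Zq_eq q k ht, DesZeta.liCombination_eq, DesZeta.genPolyDeriv_eq_zero hq]
    simp [DesZeta.polyLi]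
  have hhat : DesZeta.hatDesZeta r t (fun j => (k j : ℂ)) = ∑ q ∈ Finset.range (r + 1),
      (((-Real.log t) ^ q / (q.factorial : ℝ) : ℝ) : ℂ) * DesZeta.liCombination q k t := by
    rw [DesZeta.hatDesZeta_eq ht, DesZeta.zetaSum]
    refine Finset.sum_congr rfl fun q _ => ?_
    rw [DesZeta.liCombination_eq]
    push_cast
    rfl
  refine ⟨?_, hzero, ?_, hhat⟩
  · rw [← DesZeta.liTermC_int]
    exact DesZeta.summable_liTermC _ hz
  -- The infinite sum is cut at q = r, beyond which Z_q vanishes.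
  · rw [hhat, DesZeta.Z, tsum_eq_sum (s := Finset.range (r + 1)) fun q hq => by
      rw [hzero q (by simpa using hq), mul_zero]]
    exact Finset.sum_congr rfl fun q _ => by rw [DesZeta.Zq_eq q k ht]
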